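/- Let $2<\gamma\le 3$ and let $C_\gamma\subset\mathbb{R}^2$ be a compact convex set contained in the open square $(-1/2,1/2)^2$ such that, in some open neighbourhood $U$ of the origin with $\frac12U\subseteq U$, the boundary $\partial C_\gamma$ coincides with the graph of $x\mapsto|x|^\gamma$, while outside $\frac12U$ the boundary $\partial C_\gamma$ is smooth ($C^\infty$) with curvature bounded below by a positive constant. For $R\ge 1$ and $t\in\mathbb{R}^2$ let $$\mathcal{D}_R(t)=-R^2|C_\gamma|+\mathrm{card}\left((RC_\gamma+t)\cap\mathbb{Z}^2\right),$$ where $|C_\gamma|$ denotes the area; this function is $\mathbb{Z}^2$-periodic. Identifying $\mathbb{T}^2=\mathbb{R}^2/\mathbb{Z}^2$ with $[-1/2,1/2)^2$, put $$\|\mathcal{D}_R\|_p=\left(\int_{\mathbb{T}^2}|\mathcal{D}_R(t)|^p\,dt\right)^{1/p}\quad(1\le p<\infty),\qquad \|\mathcal{D}_R\|_\infty=\sup_{t\in\mathbb{T}^2}|\mathcal{D}_R(t)|.$$ Then there is a constant $c>0$, depending only on $C_\gamma$ (in particular neither on $R$ nor on $p$), such that for all $R\ge1$ and all $p\in[1,\infty]$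 $$\|\mathcal{D}_R\|_p\le\begin{cases} c\,R^{1-1/\gamma} & \text{if } 1\le p\le \frac{4}{3-\gamma},\\[2pt] c\,R^{\frac23\left(1-\frac{2}{\gamma p}\right)} & \text{if } p>\frac{4}{3-\gamma},\end{cases}$$ where $\frac{4}{3-\gamma}=\infty$ if $\gamma=3$, and $\frac{2}{\gamma p}=0$ if $p=\infty$. -/

import Mathlib

open scoped ENNReal Topology ContDiff Pointwise
open MeasureTheory

/-- The signed curvature `(x' y'' - y' x'') / (x'² + y'²)^(3/2)` at time `s` of the plane curve
`s ↦ (x s, y s)`. -/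
noncomputable def planeCurvature (x y : ℝ → ℝ) (s : ℝ) : ℝ :=
  (deriv x s * deriv (deriv y) s - deriv y s * deriv (deriv x) s) /
    ((deriv x s) ^ 2 + (deriv y s) ^ 2) ^ (3 / 2 : ℝ)

/-- Near its point `z`, the plane set `S` is a smooth (`C^∞`) regular curve whose (unsigned)
curvature at `z` is at least `κ`: some neighbourhood of `z` in `S` is parametrized by a `C^∞` curve
with nonvanishing velocity, passing through `z` at time `0`. -/
def SmoothCurveAtWithCurvatureGE (S : Set (ℝ × ℝ)) (z : ℝ × ℝ) (κ : ℝ) : Prop :=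
  ∃ V ∈ 𝓝 z, ∃ δ : ℝ, 0 < δ ∧ ∃ x y : ℝ → ℝ,
    ContDiffOn ℝ ∞ x (Set.Ioo (-δ) δ) ∧ ContDiffOn ℝ ∞ y (Set.Ioo (-δ) δ) ∧
    (∀ s ∈ Set.Ioo (-δ) δ, (deriv x s, deriv y s) ≠ (0, 0)) ∧
    (x 0, y 0) = z ∧
    (fun s => (x s, y s)) '' Set.Ioo (-δ) δ = S ∩ V ∧
    κ ≤ |planeCurvature x y 0|

/-- The family of convex bodies `C_γ`: a planar compact convex set, contained in the open square
`(-1/2, 1/2)²`, whose boundary coincides in a neighbourhood `U` of the origin with the graph of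
`x ↦ |x|^γ` and, outside `(1/2) U`, is smooth with curvature bounded below by a positive
constant. -/
structure IsCGamma (γ : ℝ) (C : Set (ℝ × ℝ)) : Prop where
  isCompact : IsCompact C
  convex : Convex ℝ C
  subset_square : C ⊆ Set.Ioo (-1 / 2 : ℝ) (1 / 2) ×ˢ Set.Ioo (-1 / 2 : ℝ) (1 / 2)
  boundary : ∃ U : Set (ℝ × ℝ), IsOpen U ∧ 0 ∈ U ∧ (1 / 2 : ℝ) • U ⊆ U ∧
    frontier C ∩ U = {z : ℝ × ℝ | z.2 = |z.1| ^ γ} ∩ U ∧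
    ∃ κ : ℝ, 0 < κ ∧ ∀ z ∈ frontier C \ ((1 / 2 : ℝ) • U),
      SmoothCurveAtWithCurvatureGE (frontier C) z κ

/-- The discrepancy function
`D_R(t) = -R² |C| + card ((R C + t) ∩ ℤ²)`. -/
noncomputable def discrepancy (C : Set (ℝ × ℝ)) (R : ℝ) (t : ℝ × ℝ) : ℝ :=
  -(R ^ 2 * volume.real C) +
    (Set.ncard {n : ℤ × ℤ | ∃ z ∈ C, R • z + t = ((n.1 : ℝ), (n.2 : ℝ))} : ℝ)

/-- The square `[-1/2, 1/2)²`, a fundamental domain for the torus `𝕋² = ℝ² / ℤ²`. -/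
def torusSquare : Set (ℝ × ℝ) :=
  Set.Ico (-1 / 2 : ℝ) (1 / 2) ×ˢ Set.Ico (-1 / 2 : ℝ) (1 / 2)

/-- The norm `‖D_R‖_p` over the torus: the `L^p` norm for `p < ∞`, and the (true, not essential)
supremum for `p = ∞`. -/
noncomputable def discrepancyNorm (C : Set (ℝ × ℝ)) (R : ℝ) (p : ℝ≥0∞) : ℝ≥0∞ :=
  if p = ⊤ then ⨆ t ∈ torusSquare, ‖discrepancy C R t‖ₑ
  else eLpNorm (discrepancy C R) p (volume.restrict torusSquare)

/-!
The lattice point count `card ((R C + t) ∩ ℤ²)` is squeezed between the periodizations of two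
smoothings, at scale `ε`, of the indicator functions of a slightly larger and a slightly smaller dilate
of `C` (`IsCGamma.exists_abs_discrepancy_le`). This costs an error `O(R ε)`, and by Poisson summation
(`hasSum_planeFourier_of_hasCompactSupport`) what remains of the discrepancy is a trigonometric series
in `t`, whose coefficients are the Fourier transform of the indicator function of the dilate, damped by
the one of the smoothing kernel.

For a convex set the Fourier transform at `ξ` is at most `2 L / ‖ξ‖`, where `L` bounds the chords
orthogonal to `ξ` whose height is within `1` of an extreme value
(`norm_setIntegral_unitChar_mul_norm_le`): integration over the chords leaves a function of one
variable, concave on its support, and shifting the variable by half a period turns the oscillatory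
integral into one of second differences. The length of the chords is read off from the strict
convexity of `C` (`IsCGamma.exists_strictConvexBound`): if `ξ` is an outer normal of `C` at `z`, then a
point `w` of `C` lies below the supporting line by at least a multiple of `‖ξ‖ ‖z - w‖ ^ γ`, and by at
least a multiple of `√(|ξ₁| ‖ξ‖) ‖z - w‖ ^ 2`. The second estimate holds because the graph of `|x| ^ γ`
has curvature `|x| ^ (γ - 2)` at the point where its slope is `|x| ^ (γ - 1)`, up to constants, and
`2 (γ - 2) ≤ γ - 1` as `γ ≤ 3`. Thus the coefficients satisfy `CoeffDecay`: those with vertical frequency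
`m` are `O(R ^ (1 - 1 / γ) |m| ^ (-1 - 1 / γ))`, hence summable, and the others are `O(R ^ (1 / 2))`
times the decay valid for nonvanishing curvature, with a weak singularity at the vertical axis.

The other coefficients are summed over dyadic shells: Parseval gives the `L^2` norm of a shell, the
Cauchy–Schwarz inequality its supremum, and interpolation its `L^p` norm. For `p > 4` this yields
`O(R ^ (1 / 2) ε ^ (-(1 / 2 - 2 / p)) + R ^ (1 - 1 / γ) + R ε)` for the `L^p` norm of a continuous
majorant of the discrepancy, and the same with `2 / p = 0` for its supremum. The choice
`ε = R ^ (-1 / 3)` gives the supremum bound `O(R ^ (2 / 3))`, and `ε = R ^ (-1 / γ)` gives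
`O(R ^ (1 - 1 / γ))` at the exponent `4 / (3 - γ)`. Hölder's inequality covers the smaller exponents, and
interpolation between `4 / (3 - γ)` and `∞` the larger ones.
-/

/-! ### The character and exponential integrals of concave functions -/

/-- The character `s ↦ exp (2πis)` of `ℝ` with values in `ℂ`. -/
noncomputable def unitChar (s : ℝ) : ℂ := Complex.exp (2 * Real.pi * s * Complex.I)

lemma norm_unitChar (s : ℝ) : ‖unitChar s‖ = 1 := by
  have := Complex.norm_exp_ofReal_mul_I (2 * Real.pi * s)
  rw [unitChar]; push_cast at this; exact this

lemma unitChar_add (s t : ℝ) : unitChar (s + t) = unitChar s * unitChar t := by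
  rw [unitChar, unitChar, unitChar, ← Complex.exp_add]; push_cast; ring_nf

lemma unitChar_zero : unitChar 0 = 1 := by simp [unitChar]

lemma unitChar_half : unitChar (1 / 2) = -1 := by
  rw [unitChar, ← Complex.exp_pi_mul_I]; push_cast; ring_nf

lemma unitChar_int (n : ℤ) : unitChar n = 1 := by
  rw [unitChar, ← Complex.exp_int_mul_two_pi_mul_I n]; push_cast; ring_nf

lemma unitChar_neg (s : ℝ) : unitChar (-s) = (starRingEnd ℂ) (unitChar s) := by
  rw [unitChar, unitChar, ← Complex.exp_conj]
  simp [Complex.conj_ofNat]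

@[fun_prop]
lemma continuous_unitChar : Continuous unitChar := by unfold unitChar; fun_prop

lemma unitChar_add_half (s : ℝ) : unitChar (s + 1 / 2) = -unitChar s := by
  rw [unitChar_add, unitChar_half]; ring

lemma unitChar_sub_half (s : ℝ) : unitChar (s - 1 / 2) = -unitChar s := by
  have := unitChar_add_half (s - 1 / 2)
  rw [sub_add_cancel] at this; rw [this, neg_neg]

/-- The exponential integral of a function that is concave on an interval is controlled by its
size at distance at most one from the end points: translating by half a period twice replaces the
function by its second difference, which has a sign away from the end points and total integral
zero. -/
lemma norm_integral_mul_unitChar_le {h : ℝ → ℝ} {a b L : ℝ} (hint : Integrable h)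
    (h0 : ∀ s, 0 ≤ h s) (hout : ∀ s, s ∉ Set.Icc a b → h s = 0)
    (hmid : ∀ s, a ≤ s - 1 / 2 → s + 1 / 2 ≤ b → h (s - 1 / 2) + h (s + 1 / 2) ≤ 2 * h s)
    (hL : ∀ s ∈ Set.Icc a b, s ≤ a + 1 ∨ b - 1 ≤ s → h s ≤ L) (hL0 : 0 ≤ L) :
    ‖∫ s, (h s : ℂ) * unitChar s‖ ≤ 2 * L := by
  have hle : ∀ s, s ≤ a + 1 ∨ b - 1 ≤ s → h s ≤ L := by
    intro s hs
    by_cases hm : s ∈ Set.Icc a b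
    · exact hL s hm hs
    · rw [hout s hm]; exact hL0
  have hm1 : Integrable fun s => h (s - 1 / 2) := hint.comp_sub_right _
  have hp1 : Integrable fun s => h (s + 1 / 2) := hint.comp_add_right _
  set D : ℝ → ℝ := fun s => 2 * h s - h (s - 1 / 2) - h (s + 1 / 2) with hD
  have i12 : Integrable fun s => 2 * h s - h (s - 1 / 2) := (hint.const_mul 2).sub hm1
  have hDint : Integrable D := i12.sub hp1
  have hD0 : ∫ s, D s = 0 := by
    have e1 : ∫ s, h (s - 1 / 2) = ∫ s, h s := integral_sub_right_eq_self h _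
    have e2 : ∫ s, h (s + 1 / 2) = ∫ s, h s := integral_add_right_eq_self h _
    have : ∫ s, D s = 2 * (∫ s, h s) - (∫ s, h (s - 1 / 2)) - ∫ s, h (s + 1 / 2) := by
      rw [← integral_const_mul, ← integral_sub (hint.const_mul 2) hm1, ← integral_sub i12 hp1]
    rw [this, e1, e2]; ring
  have mulc : ∀ {f : ℝ → ℝ}, Integrable f → Integrable fun s => (f s : ℂ) * unitChar s := by
    intro f hf
    refine hf.ofReal.mul_bdd (c := 1) (by fun_prop) ?_
    exact Filter.Eventually.of_forall fun s => (norm_unitChar s).le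
  have key : 4 * ∫ s, (h s : ℂ) * unitChar s = ∫ s, (D s : ℂ) * unitChar s := by
    have e1 : ∫ s, (h (s - 1 / 2) : ℂ) * unitChar s = -∫ s, (h s : ℂ) * unitChar s := by
      rw [← integral_neg, ← integral_sub_right_eq_self (fun s => -((h s : ℂ) * unitChar s)) (1 / 2)]
      congr 1; ext s; rw [unitChar_sub_half]; ring
    have e2 : ∫ s, (h (s + 1 / 2) : ℂ) * unitChar s = -∫ s, (h s : ℂ) * unitChar s := by
      rw [← integral_neg, ← integral_add_right_eq_self (fun s => -((h s : ℂ) * unitChar s)) (1 / 2)]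
      congr 1; ext s; rw [unitChar_add_half]; ring
    have : ∫ s, (D s : ℂ) * unitChar s = 2 * (∫ s, (h s : ℂ) * unitChar s)
        - (∫ s, (h (s - 1 / 2) : ℂ) * unitChar s) - ∫ s, (h (s + 1 / 2) : ℂ) * unitChar s := by
      have j12 : Integrable fun s => 2 * ((h s : ℂ) * unitChar s)
          - (h (s - 1 / 2) : ℂ) * unitChar s := ((mulc hint).const_mul 2).sub (mulc hm1)
      rw [← integral_const_mul, ← integral_sub ((mulc hint).const_mul 2) (mulc hm1),
        ← integral_sub j12 (mulc hp1)]
      congr 1; ext s; simp only [hD]; push_cast; ring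
    rw [this, e1, e2]; ring
  set E : Set ℝ := Set.Icc (a - 1 / 2) (a + 1 / 2) ∪ Set.Icc (b - 1 / 2) (b + 1 / 2) with hE
  have hEm : MeasurableSet E := measurableSet_Icc.union measurableSet_Icc
  have hEv : volume.real E ≤ 2 := by
    refine (measureReal_union_le _ _).trans ?_
    rw [Real.volume_real_Icc, Real.volume_real_Icc]
    norm_num
  have hEfin : volume E ≠ ⊤ := by
    refine ((measure_union_le _ _).trans_lt ?_).ne
    simp
  have hEint : Integrable (E.indicator fun _ => 4 * L) :=
    (integrable_indicator_iff hEm).2 (integrableOn_const hEfin)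
  have hbound : ∀ s, |D s| ≤ D s + E.indicator (fun _ => 4 * L) s := by
    intro s
    by_cases hs : s ∈ E
    · rw [Set.indicator_of_mem hs]
      have hu : h (s - 1 / 2) ≤ L ∧ h (s + 1 / 2) ≤ L := by
        rcases hs with hs | hs
        · exact ⟨hle _ (Or.inl (by linarith [hs.2])), hle _ (Or.inl (by linarith [hs.2]))⟩
        · exact ⟨hle _ (Or.inr (by linarith [hs.1])), hle _ (Or.inr (by linarith [hs.1]))⟩
      have := h0 s
      rw [abs_le]
      constructor <;> simp only [hD] <;> linarith [hu.1, hu.2]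
    · rw [Set.indicator_of_notMem hs, add_zero]
      refine (abs_of_nonneg ?_).le
      simp only [hE, Set.mem_union, Set.mem_Icc, not_or, not_and_or, not_le] at hs
      by_cases hin : a ≤ s - 1 / 2 ∧ s + 1 / 2 ≤ b
      · have := hmid s hin.1 hin.2
        simp only [hD]; linarith
      · have hz : (s + 1 / 2 < a) ∨ (b < s - 1 / 2) := by
          rcases hs with ⟨h1 | h1, h2 | h2⟩
          · left; linarith
          · left; linarith
          · exact absurd ⟨by linarith, by linarith⟩ hin
          · right; linarith
        have z1 : h (s - 1 / 2) = 0 := hout _ fun hm => by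
          rcases hz with hz | hz <;> linarith [hm.1, hm.2]
        have z2 : h (s + 1 / 2) = 0 := hout _ fun hm => by
          rcases hz with hz | hz <;> linarith [hm.1, hm.2]
        simp only [hD, z1, z2]; linarith [h0 s]
  have hfin : ∫ s, |D s| ≤ 8 * L := by
    calc ∫ s, |D s| ≤ ∫ s, (D s + E.indicator (fun _ => 4 * L) s) :=
          integral_mono hDint.abs (hDint.add hEint) hbound
      _ = volume.real E * (4 * L) := by
          rw [integral_add hDint hEint, hD0, zero_add, integral_indicator hEm, setIntegral_const,
            smul_eq_mul]
      _ ≤ 8 * L := by nlinarith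
  have h4 : 4 * ‖∫ s, (h s : ℂ) * unitChar s‖ ≤ 8 * L := by
    calc 4 * ‖∫ s, (h s : ℂ) * unitChar s‖ = ‖4 * ∫ s, (h s : ℂ) * unitChar s‖ := by simp
      _ = ‖∫ s, (D s : ℂ) * unitChar s‖ := by rw [key]
      _ ≤ ∫ s, ‖(D s : ℂ) * unitChar s‖ := norm_integral_le_integral_norm _
      _ = ∫ s, |D s| := by simp [norm_unitChar]
      _ ≤ 8 * L := hfin
  linarith

/-! ### Fourier transform of planar convex bodies -/

/-- The pairing of a frequency with a point of the plane. -/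
def planeDot (ξ x : ℝ × ℝ) : ℝ := ξ.1 * x.1 + ξ.2 * x.2

lemma planeDot_add (ξ x y : ℝ × ℝ) : planeDot ξ (x + y) = planeDot ξ x + planeDot ξ y := by
  simp [planeDot]; ring

lemma planeDot_sub (ξ x y : ℝ × ℝ) : planeDot ξ (x - y) = planeDot ξ x - planeDot ξ y := by
  simp [planeDot]; ring

lemma planeDot_smul (ξ x : ℝ × ℝ) (r : ℝ) : planeDot ξ (r • x) = r * planeDot ξ x := by
  simp [planeDot]; ring

lemma planeDot_neg_left (ξ x : ℝ × ℝ) : planeDot (-ξ) x = -planeDot ξ x := by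
  simp [planeDot]; ring

@[fun_prop]
lemma continuous_planeDot (ξ : ℝ × ℝ) : Continuous (planeDot ξ) := by
  unfold planeDot; fun_prop

lemma abs_planeDot_le (ξ x : ℝ × ℝ) : |planeDot ξ x| ≤ 2 * ‖ξ‖ * ‖x‖ := by
  have h1 : |ξ.1| ≤ ‖ξ‖ := norm_fst_le ξ
  have h2 : |ξ.2| ≤ ‖ξ‖ := norm_snd_le ξ
  have h3 : |x.1| ≤ ‖x‖ := norm_fst_le x
  have h4 : |x.2| ≤ ‖x‖ := norm_snd_le x
  calc |planeDot ξ x| ≤ |ξ.1| * |x.1| + |ξ.2| * |x.2| := by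
        rw [← abs_mul, ← abs_mul]; exact abs_add_le _ _
    _ ≤ ‖ξ‖ * ‖x‖ + ‖ξ‖ * ‖x‖ := by gcongr
    _ = 2 * ‖ξ‖ * ‖x‖ := by ring

/-- Shearing `K` by `x ↦ (planeDot ξ x, x.2)`, whose determinant is `ξ.1`, turns the chords orthogonal to
`ξ` into vertical sections; their lengths form the concave function of the one-variable estimate. -/
lemma norm_setIntegral_unitChar_mul_abs_fst_le {K : Set (ℝ × ℝ)} (hK : IsCompact K)
    (hconv : Convex ℝ K) {ξ : ℝ × ℝ} {L : ℝ} (hL0 : 0 ≤ L)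
    (hL : ∀ x ∈ K, ∀ y ∈ K, planeDot ξ x = planeDot ξ y →
      ((∀ z ∈ K, planeDot ξ z ≤ planeDot ξ x + 1) ∨ (∀ z ∈ K, planeDot ξ x - 1 ≤ planeDot ξ z)) →
      ‖x - y‖ ≤ L) :
    |ξ.1| * ‖∫ x in K, unitChar (planeDot ξ x)‖ ≤ 2 * L := by
  rcases eq_or_ne ξ.1 0 with hξ | hξ
  · rw [hξ, abs_zero, zero_mul]; positivity
  rcases K.eq_empty_or_nonempty with rfl | hne
  · simp [hL0]
  obtain ⟨xm, hxm, hmin⟩ := hK.exists_isMinOn hne (continuous_planeDot ξ).continuousOn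
  obtain ⟨xM, hxM, hmax⟩ := hK.exists_isMaxOn hne (continuous_planeDot ξ).continuousOn
  rw [isMinOn_iff] at hmin
  rw [isMaxOn_iff] at hmax
  -- the sheared body, whose vertical sections are the chords of `K` orthogonal to `ξ`
  set S : ℝ × ℝ →L[ℝ] ℝ × ℝ :=
    (ξ.1 • ContinuousLinearMap.fst ℝ ℝ ℝ + ξ.2 • ContinuousLinearMap.snd ℝ ℝ ℝ).prod
      (ContinuousLinearMap.snd ℝ ℝ ℝ) with hS
  have hSx : ∀ x, S x = (planeDot ξ x, x.2) := fun x => by simp [hS, planeDot]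
  set K' : Set (ℝ × ℝ) := S '' K with hK'
  have hK'c : IsCompact K' := hK.image S.continuous
  have hK'v : Convex ℝ K' := hconv.linear_image S.toLinearMap
  have mem : ∀ s y, (s, y) ∈ K' ↔ ((s - ξ.2 * y) / ξ.1, y) ∈ K := by
    intro s y
    constructor
    · rintro ⟨x, hx, hxe⟩
      rw [hSx, Prod.mk.injEq] at hxe
      have : ((s - ξ.2 * y) / ξ.1, y) = x := by
        ext
        · simp only; rw [← hxe.1, ← hxe.2, planeDot]; field_simp; ring
        · exact hxe.2.symm
      rwa [this]
    · intro h
      refine ⟨_, h, ?_⟩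
      rw [hSx, planeDot]
      ext
      · simp only; field_simp; ring
      · rfl
  have memS : ∀ x ∈ K, (planeDot ξ x, x.2) ∈ K' := fun x hx => ⟨x, hx, hSx x⟩
  have dotmem : ∀ s y, planeDot ξ ((s - ξ.2 * y) / ξ.1, y) = s := by
    intro s y; simp only [planeDot]; field_simp; ring
  set T : ℝ → Set ℝ := fun s => {y | (s, y) ∈ K'} with hT
  have hTc : ∀ s, IsCompact (T s) := by
    intro s
    have hcl : IsClosed (T s) := hK'c.isClosed.preimage (by fun_prop : Continuous fun y => (s, y))
    refine (hK'c.image continuous_snd).of_isClosed_subset hcl ?_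
    intro y hy; exact ⟨(s, y), hy, rfl⟩
  have hTv : ∀ s, Convex ℝ (T s) := by
    intro s y hy z hz p q hp hq hpq
    have := hK'v hy hz hp hq hpq
    have e : p • (s, y) + q • (s, z) = (s, p • y + q • z) := by
      ext
      · simp only [Prod.smul_mk, Prod.mk_add_mk, smul_eq_mul]; rw [← add_mul, hpq, one_mul]
      · rfl
    rwa [e] at this
  have hTI : ∀ s, (T s).Nonempty → ∃ c d, c ≤ d ∧ T s = Set.Icc c d := by
    intro s hs
    have := eq_Icc_of_connected_compact ⟨hs, (hTv s).isPreconnected⟩ (hTc s)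
    refine ⟨_, _, ?_, this⟩
    rw [this] at hs; exact Set.nonempty_Icc.1 hs
  set h : ℝ → ℝ := fun s => volume.real (T s) with hh
  have hIccval : ∀ {c d : ℝ}, c ≤ d → volume.real (Set.Icc c d) = d - c := by
    intro c d hcd; rw [Real.volume_real_Icc, max_eq_left (by linarith)]
  set ind : ℝ × ℝ → ℂ := K'.indicator fun p => unitChar p.1 with hind
  have hindint : Integrable ind := by
    rw [hind, integrable_indicator_iff hK'c.measurableSet]
    exact (by fun_prop : Continuous fun p : ℝ × ℝ => unitChar p.1).continuousOn.integrableOn_compact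
      hK'c
  have hsec : ∀ s, ∫ y, ind (s, y) = (h s : ℂ) * unitChar s := by
    intro s
    have : (fun y => ind (s, y)) = (T s).indicator fun _ => unitChar s := by
      ext y
      by_cases hy : (s, y) ∈ K'
      · rw [hind, Set.indicator_of_mem hy, Set.indicator_of_mem (show y ∈ T s from hy)]
      · rw [hind, Set.indicator_of_notMem hy, Set.indicator_of_notMem (show y ∉ T s from hy)]
    rw [this, integral_indicator (hTc s).measurableSet, setIntegral_const]
    simp [hh]
  have hhint : Integrable h := by
    have hreal : Integrable (K'.indicator fun _ => (1 : ℝ)) := by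
      rw [integrable_indicator_iff hK'c.measurableSet]
      exact integrableOn_const hK'c.measure_lt_top.ne
    have := Integrable.integral_prod_left hreal
    refine this.congr (Filter.Eventually.of_forall fun s => ?_)
    have e : (fun y => K'.indicator (fun _ => (1 : ℝ)) (s, y)) = (T s).indicator fun _ => 1 := by
      ext y
      by_cases hy : (s, y) ∈ K'
      · rw [Set.indicator_of_mem hy, Set.indicator_of_mem (show y ∈ T s from hy)]
      · rw [Set.indicator_of_notMem hy, Set.indicator_of_notMem (show y ∉ T s from hy)]
    simp only [e]
    rw [integral_indicator (hTc s).measurableSet, setIntegral_const]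
    simp [hh]
  have hcov : ∫ s, (h s : ℂ) * unitChar s = |ξ.1| * ∫ x in K, unitChar (planeDot ξ x) := by
    set F : ℝ × ℝ → ℂ := K.indicator fun x => unitChar (planeDot ξ x) with hF
    have hFint : Integrable F := by
      rw [hF, integrable_indicator_iff hK.measurableSet]
      exact (by fun_prop : Continuous fun p : ℝ × ℝ =>
        unitChar (planeDot ξ p)).continuousOn.integrableOn_compact hK
    have e1 : ∀ s y, ind (s, y) = F ((s - ξ.2 * y) / ξ.1, y) := by
      intro s y
      by_cases hy : (s, y) ∈ K'
      · rw [hind, hF, Set.indicator_of_mem hy, Set.indicator_of_mem ((mem s y).1 hy), dotmem]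
      · rw [hind, hF, Set.indicator_of_notMem hy,
          Set.indicator_of_notMem (fun hc => hy ((mem s y).2 hc))]
    calc ∫ s, (h s : ℂ) * unitChar s = ∫ s, ∫ y, ind (s, y) := by simp_rw [hsec]
      _ = ∫ p, ind p := (integral_prod _ hindint).symm
      _ = ∫ y, ∫ s, ind (s, y) := integral_prod_symm _ hindint
      _ = ∫ y, |ξ.1| * ∫ x, F (x, y) := by
          congr 1; ext y
          simp_rw [e1]
          rw [integral_sub_right_eq_self (fun s => F (s / ξ.1, y)) (ξ.2 * y),
            Measure.integral_comp_div (fun x => F (x, y)) ξ.1]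
          simp
      _ = |ξ.1| * ∫ y, ∫ x, F (x, y) := integral_const_mul _ _
      _ = |ξ.1| * ∫ p, F p := by rw [Measure.volume_eq_prod, integral_prod_symm _ hFint]
      _ = _ := by rw [hF, integral_indicator hK.measurableSet]
  have hTne : ∀ s, planeDot ξ xm ≤ s → s ≤ planeDot ξ xM → (T s).Nonempty := by
    intro s h1 h2
    have hpre : IsPreconnected (planeDot ξ '' K) :=
      hconv.isPreconnected.image _ (continuous_planeDot ξ).continuousOn
    obtain ⟨x, hx, hxs⟩ := hpre.Icc_subset ⟨xm, hxm, rfl⟩ ⟨xM, hxM, rfl⟩ ⟨h1, h2⟩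
    exact ⟨x.2, by simpa [hT, hxs] using memS x hx⟩
  have main := norm_integral_mul_unitChar_le (h := h) (a := planeDot ξ xm) (b := planeDot ξ xM)
    (L := L) hhint (fun s => measureReal_nonneg) ?_ ?_ ?_ hL0
  · rw [hcov, norm_mul, Complex.norm_real, Real.norm_eq_abs, abs_abs] at main
    exact main
  · intro s hs
    have : T s = ∅ := by
      by_contra hc
      obtain ⟨y, hy⟩ := Set.nonempty_iff_ne_empty.2 hc
      have hy' := (mem s y).1 hy
      exact hs ⟨by simpa [dotmem] using hmin _ hy', by simpa [dotmem] using hmax _ hy'⟩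
    simp [hh, this]
  · intro s h1 h2
    obtain ⟨a1, a2, ha, hTa⟩ := hTI (s - 1 / 2) (hTne _ h1 (by linarith))
    obtain ⟨b1, b2, hb, hTb⟩ := hTI (s + 1 / 2) (hTne _ (by linarith) h2)
    have midmem : ∀ u v, u ∈ T (s - 1 / 2) → v ∈ T (s + 1 / 2) → (u + v) / 2 ∈ T s := by
      intro u v hu hv
      have := hK'v hu hv (show (0 : ℝ) ≤ 1 / 2 by norm_num) (show (0 : ℝ) ≤ 1 / 2 by norm_num)
        (by norm_num)
      have e : (1 / 2 : ℝ) • (s - 1 / 2, u) + (1 / 2 : ℝ) • (s + 1 / 2, v) = (s, (u + v) / 2) := by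
        ext <;> simp <;> ring
      rwa [e] at this
    have hsub : Set.Icc ((a1 + b1) / 2) ((a2 + b2) / 2) ⊆ T s := by
      rw [← segment_eq_Icc (by linarith)]
      exact (hTv s).segment_subset
        (midmem _ _ (hTa ▸ Set.left_mem_Icc.2 ha) (hTb ▸ Set.left_mem_Icc.2 hb))
        (midmem _ _ (hTa ▸ Set.right_mem_Icc.2 ha) (hTb ▸ Set.right_mem_Icc.2 hb))
    have := measureReal_mono (μ := volume) hsub (hTc s).measure_lt_top.ne
    rw [hIccval (by linarith)] at this
    simp only [hh, hTa, hTb, hIccval ha, hIccval hb]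
    linarith
  · intro s hs hor
    obtain ⟨c, d, hcd, hTs⟩ := hTI s (hTne _ hs.1 hs.2)
    simp only [hh, hTs, hIccval hcd]
    have hc : c ∈ T s := by rw [hTs]; exact ⟨le_rfl, hcd⟩
    have hd : d ∈ T s := by rw [hTs]; exact ⟨hcd, le_rfl⟩
    have := hL _ ((mem s d).1 hd) _ ((mem s c).1 hc) (by rw [dotmem, dotmem]) ?_
    · refine le_trans ?_ ((norm_snd_le _).trans this)
      simpa using le_abs_self (d - c)
    · rw [dotmem]
      rcases hor with h | h
      · right; intro z hz; linarith [hmin z hz]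
      · left; intro z hz; linarith [hmax z hz]

/-- The Fourier transform of a planar convex body at the frequency `ξ` is at most twice the
quotient by `‖ξ‖` of the length of the longest chord orthogonal to `ξ` within distance one (as
measured by the pairing with `ξ`) of one of the two supporting lines orthogonal to `ξ`. -/
theorem norm_setIntegral_unitChar_mul_norm_le {K : Set (ℝ × ℝ)} (hK : IsCompact K)
    (hconv : Convex ℝ K) {ξ : ℝ × ℝ} {L : ℝ} (hL0 : 0 ≤ L)
    (hL : ∀ x ∈ K, ∀ y ∈ K, planeDot ξ x = planeDot ξ y →
      ((∀ z ∈ K, planeDot ξ z ≤ planeDot ξ x + 1) ∨ (∀ z ∈ K, planeDot ξ x - 1 ≤ planeDot ξ z)) →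
      ‖x - y‖ ≤ L) :
    ‖ξ‖ * ‖∫ x in K, unitChar (planeDot ξ x)‖ ≤ 2 * L := by
  have hswap : ∀ (η x : ℝ × ℝ), planeDot η.swap x.swap = planeDot η x := by
    intro η x; simp [planeDot, add_comm]
  have hnswap : ∀ x : ℝ × ℝ, ‖x.swap‖ = ‖x‖ := fun x => by simp [Prod.norm_def, max_comm]
  have h1 := norm_setIntegral_unitChar_mul_abs_fst_le hK hconv hL0 hL
  have h2 := norm_setIntegral_unitChar_mul_abs_fst_le (K := Prod.swap '' K) (ξ := ξ.swap) (L := L)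
    (hK.image continuous_swap) (hconv.linear_image (LinearEquiv.prodComm ℝ ℝ ℝ).toLinearMap) hL0 ?_
  · have e : ∫ x in Prod.swap '' K, unitChar (planeDot ξ.swap x)
        = ∫ x in K, unitChar (planeDot ξ x) := by
      have hmp : MeasurePreserving (Prod.swap : ℝ × ℝ → ℝ × ℝ) := Measure.measurePreserving_swap
      rw [hmp.setIntegral_image_emb MeasurableEquiv.prodComm.measurableEmbedding]
      simp_rw [hswap]
    rw [e] at h2
    rcases max_choice ‖ξ.1‖ ‖ξ.2‖ with h | h
    · rw [Prod.norm_def, h]; exact h1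
    · rw [Prod.norm_def, h]; exact h2
  · rintro _ ⟨x, hx, rfl⟩ _ ⟨y, hy, rfl⟩ hxy hor
    rw [hswap, hswap] at hxy
    have := hL x hx y hy hxy ?_
    · rw [← Prod.swap_sub, hnswap]; exact this
    · rcases hor with h | h
      · left; intro z hz; simpa [hswap] using h _ ⟨z, hz, rfl⟩
      · right; intro z hz; simpa [hswap] using h _ ⟨z, hz, rfl⟩

/-! ### Poisson summation in the plane -/

open scoped FourierTransform in
/-- Poisson summation on the line for continuous functions of compact support. -/
lemma hasSum_fourier_of_hasCompactSupport {f : ℝ → ℂ} (hf : Continuous f)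
    (hs : HasCompactSupport f)
    (hsum : Summable fun m : ℤ => ∫ x, f x * unitChar (-(m * x))) (t : ℝ) :
    HasSum (fun m : ℤ => (∫ x, f x * unitChar (-(m * x))) * unitChar (m * t))
      (∑' n : ℤ, f (t + n)) := by
  have hF : ∀ m : ℤ, 𝓕 f (m : ℝ) = ∫ x, f x * unitChar (-(m * x)) := by
    intro m
    rw [Real.fourier_real_eq_integral_exp_smul]
    congr 1; ext x
    rw [smul_eq_mul, mul_comm, unitChar]
    congr 2; push_cast; ring
  have hO : f =O[Filter.cocompact ℝ] fun x : ℝ => |x| ^ (-2 : ℝ) := by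
    have : f =ᶠ[Filter.cocompact ℝ] fun _ => 0 := by
      rw [hasCompactSupport_iff_eventuallyEq] at hs
      exact hs.filter_mono Filter.cocompact_le_coclosedCompact
    exact this.trans_isBigO (Asymptotics.isBigO_zero _ _)
  have hsum' : Summable fun m : ℤ => 𝓕 f (m : ℝ) := by simpa only [hF] using hsum
  have hP := Real.tsum_eq_tsum_fourier_of_rpow_decay_of_summable hf (b := 2) (by norm_num) hO hsum' t
  have hfo : ∀ m : ℤ, fourier m (t : UnitAddCircle) = unitChar (m * t) := by
    intro m
    rw [fourier_coe_apply, unitChar]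
    congr 1; push_cast; ring
  rw [hP]
  simp only [hF, hfo]
  refine Summable.hasSum ?_
  refine Summable.of_norm ?_
  simpa [norm_unitChar] using hsum.norm

/-- A frequency in `ℤ²`, or a point of that lattice, as a point of the plane. -/
def latticePoint (m : ℤ × ℤ) : ℝ × ℝ := ((m.1 : ℝ), (m.2 : ℝ))

/-- The Fourier transform of a function on the plane. -/
noncomputable def planeFourier (g : ℝ × ℝ → ℂ) (ξ : ℝ × ℝ) : ℂ :=
  ∫ x, g x * unitChar (-planeDot ξ x)

lemma finite_int_abs_add_le (t B : ℝ) : {n : ℤ | |t + n| ≤ B}.Finite := by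
  refine (Set.finite_Icc ⌈-B - t⌉ ⌊B - t⌋).subset fun n hn => ?_
  change |t + n| ≤ B at hn
  rw [abs_le] at hn
  exact ⟨Int.ceil_le.2 (by linarith), Int.le_floor.2 (by linarith)⟩

/-- Only finitely many lattice translates of a function of compact support meet a given point. -/
lemma finite_support_comp_add_latticePoint {E : Type*} [Zero E] {g : ℝ × ℝ → E} {B : ℝ}
    (hB : ∀ x, g x ≠ 0 → ‖x‖ ≤ B) (t : ℝ × ℝ) :
    (Function.support fun n => g (t + latticePoint n)).Finite := by
  refine ((finite_int_abs_add_le t.1 B).prod (finite_int_abs_add_le t.2 B)).subset ?_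
  intro n hn
  have := hB _ hn
  exact ⟨(norm_fst_le _).trans this, (norm_snd_le _).trans this⟩

/-- Poisson summation in the plane, from two applications of the formula on the line. -/
theorem hasSum_planeFourier_of_hasCompactSupport {g : ℝ × ℝ → ℂ} (hg : Continuous g)
    (hs : HasCompactSupport g) (hsum : Summable fun m => planeFourier g (latticePoint m))
    (t : ℝ × ℝ) :
    HasSum (fun m => planeFourier g (latticePoint m) * unitChar (planeDot (latticePoint m) t))
      (∑' n, g (t + latticePoint n)) := by
  obtain ⟨B, hB'⟩ := hs.isCompact.isBounded.exists_norm_le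
  have hB : ∀ x, g x ≠ 0 → ‖x‖ ≤ B := fun x hx => hB' x (subset_tsupport g hx)
  have hBz : ∀ x, B < ‖x‖ → g x = 0 := fun x hx => by
    by_contra h; exact absurd (hB x h) (not_le.2 hx)
  have hgint : Integrable g := hg.integrable_of_hasCompactSupport hs
  -- partial transform in the first variable
  set φ : ℤ → ℝ → ℂ := fun m y => ∫ x, g (x, y) * unitChar (-(m * x)) with hφ
  have hsec : ∀ y, Continuous fun x => g (x, y) := fun y => by fun_prop
  have hsecs : ∀ y, HasCompactSupport fun x => g (x, y) := by
    intro y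
    refine HasCompactSupport.of_support_subset_isCompact (isCompact_closedBall (0 : ℝ) B) ?_
    intro x hx
    rw [mem_closedBall_zero_iff]
    exact (norm_fst_le (x, y)).trans (hB _ hx)
  have hφint : ∀ (m : ℤ) (y : ℝ), Integrable fun x => g (x, y) * unitChar (-(m * x)) := by
    intro m y
    exact (by fun_prop : Continuous fun x => g (x, y) * unitChar (-(m * x)))
      |>.integrable_of_hasCompactSupport ((hsecs y).mul_right)
  have hφz : ∀ m y, B < |y| → φ m y = 0 := by
    intro m y hy
    simp only [hφ]
    rw [← integral_zero ℝ ℂ]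
    congr 1; ext x
    rw [hBz (x, y) (hy.trans_le (norm_snd_le (x, y))), zero_mul]
  have hφc : ∀ m, Continuous (φ m) := by
    intro m
    have : φ m = fun y => ∫ x in Set.Icc (-B) B, g (x, y) * unitChar (-(m * x)) := by
      ext y
      rw [setIntegral_eq_integral_of_forall_compl_eq_zero]
      intro x hx
      rw [hBz (x, y) ?_, zero_mul]
      rw [Set.mem_Icc, ← abs_le, not_le] at hx
      exact hx.trans_le (norm_fst_le (x, y))
    rw [this]
    exact continuous_parametric_integral_of_continuous (by fun_prop) isCompact_Icc
  have hφs : ∀ m, HasCompactSupport (φ m) := by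
    intro m
    refine HasCompactSupport.of_support_subset_isCompact (isCompact_closedBall (0 : ℝ) B) ?_
    intro y hy
    rw [mem_closedBall_zero_iff]
    by_contra h
    exact hy (hφz m y (not_le.1 h))
  have hφF : ∀ m₁ m₂ : ℤ, ∫ y, φ m₁ y * unitChar (-(m₂ * y))
      = planeFourier g (latticePoint (m₁, m₂)) := by
    intro m₁ m₂
    rw [planeFourier, Measure.volume_eq_prod, integral_prod_symm]
    · congr 1; ext y
      simp only [hφ]
      rw [← integral_mul_const]
      congr 1; ext x
      rw [mul_assoc, ← unitChar_add, planeDot, latticePoint]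
      congr 2; ring
    · refine hgint.mul_bdd (c := 1) (by fun_prop) ?_
      exact Filter.Eventually.of_forall fun s => (norm_unitChar _).le
  have hsn : Summable fun m => ‖planeFourier g (latticePoint m)‖ := hsum.norm
  have hP1 : ∀ m₁ : ℤ, HasSum (fun m₂ : ℤ => planeFourier g (latticePoint (m₁, m₂))
      * unitChar (m₂ * t.2)) (∑' n : ℤ, φ m₁ (t.2 + n)) := by
    intro m₁
    have := hasSum_fourier_of_hasCompactSupport (hφc m₁) (hφs m₁) (by
      simp only [hφF]
      exact (hsn.prod_factor m₁).of_norm) t.2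
    simpa only [hφF] using this
  -- periodization in the second variable
  set N := (finite_int_abs_add_le t.2 B).toFinset with hN
  have hNz : ∀ n : ℤ, n ∉ N → B < |t.2 + n| := by
    intro n hn
    simpa [hN] using hn
  set f : ℝ → ℂ := fun x => ∑ n ∈ N, g (x, t.2 + n) with hf
  have hfc : Continuous f := by fun_prop
  have hfs : HasCompactSupport f := by
    refine HasCompactSupport.of_support_subset_isCompact (isCompact_closedBall (0 : ℝ) B) ?_
    intro x hx
    rw [mem_closedBall_zero_iff]
    obtain ⟨n, -, hn⟩ := Finset.exists_ne_zero_of_sum_ne_zero hx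
    exact (norm_fst_le (x, t.2 + (n : ℝ))).trans (hB _ hn)
  have hfF : ∀ m₁ : ℤ, ∫ x, f x * unitChar (-(m₁ * x)) = ∑' n : ℤ, φ m₁ (t.2 + n) := by
    intro m₁
    rw [tsum_eq_sum (s := N) fun n hn => hφz m₁ _ (hNz n hn)]
    simp only [hf, hφ, Finset.sum_mul]
    exact integral_finsetSum _ fun n _ => hφint m₁ _
  have hbound : ∀ m₁ : ℤ, ‖∑' n : ℤ, φ m₁ (t.2 + n)‖
      ≤ ∑' m₂ : ℤ, ‖planeFourier g (latticePoint (m₁, m₂))‖ := by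
    intro m₁
    rw [← (hP1 m₁).tsum_eq]
    refine tsum_of_norm_bounded (hsn.prod_factor m₁).hasSum fun m₂ => ?_
    rw [norm_mul, norm_unitChar, mul_one]
  have hP2 := hasSum_fourier_of_hasCompactSupport hfc hfs (by
    simp only [hfF]
    exact Summable.of_norm_bounded hsn.prod hbound) t.1
  have hS : Summable fun m => planeFourier g (latticePoint m)
      * unitChar (planeDot (latticePoint m) t) := by
    refine Summable.of_norm ?_
    simpa [norm_unitChar] using hsn
  have hfib : ∀ m₁ : ℤ, HasSum (fun m₂ : ℤ => planeFourier g (latticePoint (m₁, m₂))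
      * unitChar (planeDot (latticePoint (m₁, m₂)) t))
      ((∑' n : ℤ, φ m₁ (t.2 + n)) * unitChar (m₁ * t.1)) := by
    intro m₁
    convert! (hP1 m₁).mul_right (unitChar (m₁ * t.1)) using 2 with m₂
    rw [mul_assoc, ← unitChar_add, planeDot, latticePoint, add_comm]
  have h1 := hS.hasSum.prod_fiberwise hfib
  simp only [hfF] at hP2
  have h2 := h1.unique hP2
  have h3 : ∑' n : ℤ, f (t.1 + n) = ∑' n, g (t + latticePoint n) := by
    have hfin := finite_support_comp_add_latticePoint hB t
    rw [(summable_of_hasFiniteSupport hfin).tsum_prod]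
    congr 1; ext n₁
    rw [tsum_eq_sum (s := N)]
    · rfl
    · intro n hn
      exact hBz _ ((hNz n hn).trans_le (norm_snd_le (t + latticePoint (n₁, n))))
  rw [← h3, ← h2]
  exact hS.hasSum

/-! ### A continuous mollifier of small support -/

/-- The tent function supported on `[-1, 1]`. -/
noncomputable def tent (x : ℝ) : ℝ := max 0 (1 - |x|)

@[fun_prop]
lemma continuous_tent : Continuous tent := by unfold tent; fun_prop

lemma tent_nonneg (x : ℝ) : 0 ≤ tent x := le_max_left _ _

lemma tent_eq_zero {x : ℝ} (hx : 1 ≤ |x|) : tent x = 0 := max_eq_left (by linarith)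

lemma abs_tent_sub_tent_le (x y : ℝ) : |tent x - tent y| ≤ |x - y| := by
  have h := abs_max_sub_max_le_abs (1 - |x|) (1 - |y|) 0
  rw [max_comm _ 0, max_comm _ 0] at h
  refine h.trans ?_
  rw [show 1 - |x| - (1 - |y|) = |y| - |x| by ring, abs_sub_comm x y]
  exact abs_abs_sub_abs_le_abs_sub y x

lemma hasCompactSupport_tent : HasCompactSupport tent := by
  refine HasCompactSupport.of_support_subset_isCompact (isCompact_Icc (a := -1) (b := 1)) ?_
  intro x hx
  by_contra h
  rw [Set.mem_Icc, ← abs_le, not_le] at h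
  exact hx (tent_eq_zero h.le)

lemma integrable_tent : Integrable tent :=
  continuous_tent.integrable_of_hasCompactSupport hasCompactSupport_tent

lemma integral_tent : ∫ x, tent x = 1 := by
  have h1 : ∫ x, tent x = ∫ x in Set.Ioc (-1 : ℝ) 1, tent x := by
    rw [setIntegral_eq_integral_of_forall_compl_eq_zero]
    intro x hx
    refine tent_eq_zero ?_
    by_contra h
    rw [not_le, abs_lt] at h
    exact hx ⟨h.1, h.2.le⟩
  have hi : ∀ a b : ℝ, IntervalIntegrable tent volume a b := fun a b =>
    continuous_tent.intervalIntegrable a b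
  rw [h1, ← intervalIntegral.integral_of_le (by norm_num),
    ← intervalIntegral.integral_add_adjacent_intervals (hi (-1) 0) (hi 0 1)]
  have e1 : ∫ x in (-1 : ℝ)..0, tent x = ∫ x in (-1 : ℝ)..0, (1 + x) := by
    refine intervalIntegral.integral_congr fun x hx => ?_
    rw [Set.uIcc_of_le (by norm_num)] at hx
    simp only [tent]
    rw [abs_of_nonpos hx.2, max_eq_right (by linarith [hx.1])]; ring
  have e2 : ∫ x in (0 : ℝ)..1, tent x = ∫ x in (0 : ℝ)..1, (1 - x) := by
    refine intervalIntegral.integral_congr fun x hx => ?_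
    rw [Set.uIcc_of_le (by norm_num)] at hx
    simp only [tent]
    rw [abs_of_nonneg hx.1, max_eq_right (by linarith [hx.2])]
  rw [e1, e2, intervalIntegral.integral_add (by simp) (by simp),
    intervalIntegral.integral_sub (by simp) (by simp)]
  simp
  norm_num

lemma norm_integral_tent_mul_unitChar_le_one (ξ : ℝ) :
    ‖∫ x, (tent x : ℂ) * unitChar (-(ξ * x))‖ ≤ 1 := by
  refine (norm_integral_le_integral_norm _).trans ?_
  simp_rw [norm_mul, norm_unitChar, mul_one, Complex.norm_real, Real.norm_eq_abs,
    abs_of_nonneg (tent_nonneg _)]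
  exact integral_tent.le

/-- The transform of the tent decays because translation by half a period changes the tent, a
`1`-Lipschitz function, by at most that half period. -/
lemma abs_mul_norm_integral_tent_mul_unitChar_le_one (ξ : ℝ) :
    |ξ| * ‖∫ x, (tent x : ℂ) * unitChar (-(ξ * x))‖ ≤ 1 := by
  rcases lt_or_ge |ξ| 1 with h | h
  · exact mul_le_one₀ h.le (norm_nonneg _) (norm_integral_tent_mul_unitChar_le_one ξ)
  have hξ : ξ ≠ 0 := by rintro rfl; simp at h; linarith
  have hξp : 0 < |ξ| := by linarith
  -- translation by half a period
  set v : ℝ := 1 / (2 * ξ) with hv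
  have hvabs : |v| = 1 / (2 * |ξ|) := by rw [hv, abs_div, abs_mul]; simp
  have hv1 : |v| ≤ 1 := by
    rw [hvabs, div_le_one (by positivity)]; linarith
  set I := ∫ x, (tent x : ℂ) * unitChar (-(ξ * x)) with hI
  have hint : ∀ w : ℝ, Integrable fun x => (tent (x + w) : ℂ) * unitChar (-(ξ * x)) := by
    intro w
    refine (integrable_tent.comp_add_right w).ofReal.mul_bdd (c := 1) (by fun_prop) ?_
    exact Filter.Eventually.of_forall fun s => (norm_unitChar _).le
  have hint0 : Integrable fun x => (tent x : ℂ) * unitChar (-(ξ * x)) := by simpa using hint 0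
  have e1 : I = -∫ x, (tent (x + v) : ℂ) * unitChar (-(ξ * x)) := by
    rw [hI, ← integral_add_right_eq_self _ v, ← integral_neg]
    congr 1; ext x
    have : -(ξ * (x + v)) = -(ξ * x) - 1 / 2 := by rw [hv]; field_simp; ring
    rw [this, unitChar_sub_half]; ring
  have e2 : 2 * I = ∫ x, ((tent x - tent (x + v) : ℝ) : ℂ) * unitChar (-(ξ * x)) := by
    rw [two_mul]
    nth_rewrite 2 [e1]
    rw [hI, ← sub_eq_add_neg, ← integral_sub hint0 (hint v)]
    congr 1; ext x; push_cast; ring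
  have hb : ∀ x, ‖((tent x - tent (x + v) : ℝ) : ℂ) * unitChar (-(ξ * x))‖
      ≤ (Set.Icc (-2 : ℝ) 2).indicator (fun _ => |v|) x := by
    intro x
    rw [norm_mul, norm_unitChar, mul_one, Complex.norm_real, Real.norm_eq_abs]
    by_cases hx : x ∈ Set.Icc (-2 : ℝ) 2
    · rw [Set.indicator_of_mem hx]
      refine (abs_tent_sub_tent_le _ _).trans ?_
      rw [show x - (x + v) = -v by ring, abs_neg]
    · rw [Set.indicator_of_notMem hx]
      rw [Set.mem_Icc, ← abs_le, not_le] at hx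
      have : |x| - |v| ≤ |x + v| := by
        have := abs_sub_abs_le_abs_sub x (-v); rwa [abs_neg, sub_neg_eq_add] at this
      rw [tent_eq_zero (by linarith), tent_eq_zero (by linarith)]; simp
  have hfin : ‖2 * I‖ ≤ 4 * |v| := by
    rw [e2]
    refine (norm_integral_le_of_norm_le ?_ (Filter.Eventually.of_forall hb)).trans ?_
    · rw [integrable_indicator_iff measurableSet_Icc]
      exact integrableOn_const (by simp)
    · rw [integral_indicator measurableSet_Icc, setIntegral_const, Real.volume_real_Icc, smul_eq_mul]
      norm_num
  rw [norm_mul, Complex.norm_ofNat, hvabs] at hfin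
  have : |ξ| * (1 / (2 * |ξ|)) = 1 / 2 := by field_simp
  nlinarith

/-- The product mollifier at scale `ε`, supported on the square of side `2ε`. -/
noncomputable def tentKernel (ε : ℝ) (u : ℝ × ℝ) : ℝ :=
  tent (u.1 / ε) / ε * (tent (u.2 / ε) / ε)

@[fun_prop]
lemma continuous_tentKernel (ε : ℝ) : Continuous (tentKernel ε) := by
  unfold tentKernel; fun_prop

lemma tentKernel_nonneg {ε : ℝ} (hε : 0 < ε) (u : ℝ × ℝ) : 0 ≤ tentKernel ε u := by
  have := tent_nonneg (u.1 / ε)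
  have := tent_nonneg (u.2 / ε)
  unfold tentKernel; positivity

lemma norm_le_of_tentKernel_ne_zero {ε : ℝ} (hε : 0 < ε) {u : ℝ × ℝ} (hu : tentKernel ε u ≠ 0) :
    ‖u‖ ≤ ε := by
  have aux : ∀ s : ℝ, tent (s / ε) ≠ 0 → |s| ≤ ε := by
    intro s hs
    by_contra h
    refine hs (tent_eq_zero ?_)
    rw [abs_div, abs_of_pos hε, one_le_div hε]; exact (not_le.1 h).le
  rw [Prod.norm_def]
  refine max_le (aux _ fun h => hu ?_) (aux _ fun h => hu ?_) <;> simp [tentKernel, h]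

lemma hasCompactSupport_tentKernel {ε : ℝ} (hε : 0 < ε) : HasCompactSupport (tentKernel ε) := by
  refine HasCompactSupport.of_support_subset_isCompact (isCompact_closedBall 0 ε) ?_
  intro u hu
  rw [mem_closedBall_zero_iff]; exact norm_le_of_tentKernel_ne_zero hε hu

lemma integrable_tentKernel {ε : ℝ} (hε : 0 < ε) : Integrable (tentKernel ε) :=
  (continuous_tentKernel ε).integrable_of_hasCompactSupport (hasCompactSupport_tentKernel hε)

lemma integral_tentKernel {ε : ℝ} (hε : 0 < ε) : ∫ u, tentKernel ε u = 1 := by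
  have h1 : ∫ x, tent (x / ε) / ε = 1 := by
    rw [integral_div, Measure.integral_comp_div, integral_tent, abs_of_pos hε, smul_eq_mul]
    field_simp
  unfold tentKernel
  rw [Measure.volume_eq_prod, integral_prod_mul (fun x => tent (x / ε) / ε) fun x =>
    tent (x / ε) / ε, h1, one_mul]

lemma planeFourier_tentKernel {ε : ℝ} (hε : 0 < ε) (ξ : ℝ × ℝ) :
    planeFourier (fun u => (tentKernel ε u : ℂ)) ξ =
      (∫ x, (tent x : ℂ) * unitChar (-(ε * ξ.1 * x))) *
        ∫ x, (tent x : ℂ) * unitChar (-(ε * ξ.2 * x)) := by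
  have h1 : ∀ η : ℝ, ∫ x, (tent x : ℂ) * unitChar (-(ε * η * x))
      = ∫ x, (tent (x / ε) : ℂ) / ε * unitChar (-(η * x)) := by
    intro η
    have := Measure.integral_comp_div (fun x => (tent x : ℂ) * unitChar (-(ε * η * x))) ε
    have e : ∀ x : ℝ, (tent (x / ε) : ℂ) / ε * unitChar (-(η * x))
        = (1 / ε : ℂ) * ((tent (x / ε) : ℂ) * unitChar (-(ε * η * (x / ε)))) := by
      intro x
      have : ε * η * (x / ε) = η * x := by field_simp
      rw [this]; ring
    simp_rw [e]
    rw [integral_const_mul, this, abs_of_pos hε, Complex.real_smul, ← mul_assoc]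
    have : (1 / ε : ℂ) * ε = 1 := by
      have : (ε : ℂ) ≠ 0 := by exact_mod_cast hε.ne'
      field_simp
    rw [this, one_mul]
  rw [h1, h1, ← integral_prod_mul, planeFourier, Measure.volume_eq_prod]
  congr 1; ext u
  rw [tentKernel, planeDot, neg_add, unitChar_add]; push_cast; ring

lemma norm_planeFourier_tentKernel_le_one {ε : ℝ} (hε : 0 < ε) (ξ : ℝ × ℝ) :
    ‖planeFourier (fun u => (tentKernel ε u : ℂ)) ξ‖ ≤ 1 := by
  rw [planeFourier_tentKernel hε, norm_mul]
  exact mul_le_one₀ (norm_integral_tent_mul_unitChar_le_one _) (norm_nonneg _)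
    (norm_integral_tent_mul_unitChar_le_one _)

lemma mul_norm_planeFourier_tentKernel_le_one {ε : ℝ} (hε : 0 < ε) (ξ : ℝ × ℝ) :
    ε * ‖ξ‖ * ‖planeFourier (fun u => (tentKernel ε u : ℂ)) ξ‖ ≤ 1 := by
  rw [planeFourier_tentKernel hε, norm_mul]
  have a1 := norm_integral_tent_mul_unitChar_le_one (ε * ξ.1)
  have a2 := norm_integral_tent_mul_unitChar_le_one (ε * ξ.2)
  have b1 := abs_mul_norm_integral_tent_mul_unitChar_le_one (ε * ξ.1)
  have b2 := abs_mul_norm_integral_tent_mul_unitChar_le_one (ε * ξ.2)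
  rw [abs_mul, abs_of_pos hε] at b1 b2
  rcases max_choice ‖ξ.1‖ ‖ξ.2‖ with h | h
  · rw [Prod.norm_def, h, Real.norm_eq_abs, ← mul_assoc]
    exact mul_le_one₀ b1 (norm_nonneg _) a2
  · rw [Prod.norm_def, h, Real.norm_eq_abs, mul_left_comm]
    exact mul_le_one₀ a1 (by positivity) b2

/-! ### Mollified indicators -/

/-- The indicator function of `K`, mollified at scale `ε`. -/
noncomputable def smoothIndicator (ε : ℝ) (K : Set (ℝ × ℝ)) (x : ℝ × ℝ) : ℝ :=
  ∫ y in K, tentKernel ε (x - y)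

lemma integrable_tentKernel_sub {ε : ℝ} (hε : 0 < ε) (x : ℝ × ℝ) :
    Integrable fun y => tentKernel ε (x - y) := (integrable_tentKernel hε).comp_sub_left x

lemma continuous_smoothIndicator (ε : ℝ) {K : Set (ℝ × ℝ)} (hK : IsCompact K) :
    Continuous (smoothIndicator ε K) :=
  continuous_parametric_integral_of_continuous (by fun_prop) hK

lemma smoothIndicator_nonneg {ε : ℝ} (hε : 0 < ε) (K : Set (ℝ × ℝ)) (x : ℝ × ℝ) :
    0 ≤ smoothIndicator ε K x := integral_nonneg fun _ => tentKernel_nonneg hε _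

lemma smoothIndicator_le_one {ε : ℝ} (hε : 0 < ε) (K : Set (ℝ × ℝ)) (x : ℝ × ℝ) :
    smoothIndicator ε K x ≤ 1 := by
  refine (setIntegral_le_integral (integrable_tentKernel_sub hε x)
    (Filter.Eventually.of_forall fun _ => tentKernel_nonneg hε _)).trans ?_
  rw [integral_sub_left_eq_self (tentKernel ε) volume x, integral_tentKernel hε]

lemma smoothIndicator_eq_one {ε : ℝ} (hε : 0 < ε) {K : Set (ℝ × ℝ)} {x : ℝ × ℝ}
    (hx : ∀ y, ‖x - y‖ ≤ ε → y ∈ K) : smoothIndicator ε K x = 1 := by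
  rw [smoothIndicator, setIntegral_eq_integral_of_forall_compl_eq_zero,
    integral_sub_left_eq_self (tentKernel ε) volume x, integral_tentKernel hε]
  intro y hy
  by_contra h
  exact hy (hx y (norm_le_of_tentKernel_ne_zero hε h))

lemma exists_mem_of_smoothIndicator_ne_zero {ε : ℝ} (hε : 0 < ε) {K : Set (ℝ × ℝ)} {x : ℝ × ℝ}
    (hx : smoothIndicator ε K x ≠ 0) : ∃ y ∈ K, ‖x - y‖ ≤ ε := by
  by_contra! h
  refine hx (setIntegral_eq_zero_of_forall_eq_zero fun y hy => ?_)
  by_contra h'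
  exact absurd (norm_le_of_tentKernel_ne_zero hε h') (not_le.2 (h y hy))

lemma hasCompactSupport_smoothIndicator {ε : ℝ} (hε : 0 < ε) {K : Set (ℝ × ℝ)}
    (hK : IsCompact K) : HasCompactSupport (smoothIndicator ε K) := by
  refine HasCompactSupport.of_support_subset_isCompact (hK.cthickening (r := ε)) ?_
  intro x hx
  obtain ⟨y, hy, hxy⟩ := exists_mem_of_smoothIndicator_ne_zero hε hx
  exact Metric.mem_cthickening_of_dist_le x y ε K hy (by rwa [dist_eq_norm])

/-- The Fourier transform of a convolution is the product of the transforms. -/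
lemma planeFourier_smoothIndicator {ε : ℝ} (hε : 0 < ε) {K : Set (ℝ × ℝ)} (hK : IsCompact K)
    (ξ : ℝ × ℝ) :
    planeFourier (fun x => (smoothIndicator ε K x : ℂ)) ξ =
      planeFourier (fun u => (tentKernel ε u : ℂ)) ξ * ∫ y in K, unitChar (-planeDot ξ y) := by
  set B := Metric.cthickening ε K with hB
  have hBc : IsCompact B := hK.cthickening
  have hz : ∀ y ∈ K, ∀ x, x ∉ B → tentKernel ε (x - y) = 0 := by
    intro y hy x hx
    by_contra h
    refine hx (Metric.mem_cthickening_of_dist_le x y ε K hy ?_)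
    rw [dist_eq_norm]; exact norm_le_of_tentKernel_ne_zero hε h
  have hsw : Integrable (Function.uncurry fun x y =>
      (tentKernel ε (x - y) : ℂ) * unitChar (-planeDot ξ x))
      ((volume.restrict B).prod (volume.restrict K)) := by
    rw [Measure.prod_restrict]
    refine ContinuousOn.integrableOn_compact (hBc.prod hK) (Continuous.continuousOn ?_)
    unfold Function.uncurry
    fun_prop
  calc planeFourier (fun x => (smoothIndicator ε K x : ℂ)) ξ
      = ∫ x in B, (∫ y in K, (tentKernel ε (x - y) : ℂ) * unitChar (-planeDot ξ x)) := by
        rw [planeFourier, ← setIntegral_eq_integral_of_forall_compl_eq_zero (s := B)]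
        · congr 1; ext x
          rw [integral_mul_const, smoothIndicator, ← integral_complex_ofReal]
        · intro x hx
          rw [smoothIndicator, setIntegral_eq_zero_of_forall_eq_zero fun y hy => hz y hy x hx]
          simp
    _ = ∫ y in K, (∫ x in B, (tentKernel ε (x - y) : ℂ) * unitChar (-planeDot ξ x)) :=
        integral_integral_swap hsw
    _ = ∫ y in K, planeFourier (fun u => (tentKernel ε u : ℂ)) ξ * unitChar (-planeDot ξ y) := by
        refine setIntegral_congr_fun hK.measurableSet fun y hy => ?_
        rw [setIntegral_eq_integral_of_forall_compl_eq_zero fun x hx => by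
          rw [hz y hy x hx]; simp, planeFourier, ← integral_mul_const,
          ← integral_add_right_eq_self (fun x => (tentKernel ε (x - y) : ℂ) *
            unitChar (-planeDot ξ x)) y]
        congr 1; ext x
        rw [mul_assoc, ← unitChar_add, planeDot_add, neg_add, add_sub_cancel_right]
    _ = _ := integral_const_mul _ _

/-! ### Trigonometric polynomials on the torus -/

@[simp] lemma latticePoint_zero : latticePoint 0 = 0 := by simp [latticePoint]

@[simp] lemma planeDot_zero_left (x : ℝ × ℝ) : planeDot 0 x = 0 := by simp [planeDot]

lemma torusSquare_prod : (volume.restrict torusSquare : Measure (ℝ × ℝ)) =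
    (volume.restrict (Set.Ico (-1 / 2 : ℝ) (1 / 2))).prod
      (volume.restrict (Set.Ico (-1 / 2 : ℝ) (1 / 2))) := by
  rw [Measure.prod_restrict, torusSquare, Measure.volume_eq_prod]

instance isProbabilityMeasure_torusSquare :
    IsProbabilityMeasure (volume.restrict torusSquare : Measure (ℝ × ℝ)) := by
  constructor
  rw [torusSquare_prod, ← Set.univ_prod_univ, Measure.prod_prod]
  simp; norm_num

lemma integral_unitChar_int_mul (k : ℤ) :
    ∫ x in Set.Ico (-1 / 2 : ℝ) (1 / 2), unitChar (k * x) = if k = 0 then 1 else 0 := by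
  split_ifs with hk
  · simp [hk, unitChar_zero]; norm_num
  · rw [integral_Ico_eq_integral_Ioc, ← intervalIntegral.integral_of_le (by norm_num)]
    have hc : (2 * Real.pi * k * Complex.I : ℂ) ≠ 0 := by
      have : (k : ℂ) ≠ 0 := by exact_mod_cast hk
      have : (Real.pi : ℂ) ≠ 0 := by exact_mod_cast Real.pi_ne_zero
      simp [*]
    have e : ∀ x : ℝ, unitChar (k * x) = Complex.exp (2 * Real.pi * k * Complex.I * x) := by
      intro x; rw [unitChar]; congr 1; push_cast; ring
    simp_rw [e]
    rw [integral_exp_mul_complex hc, ← e, ← e]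
    have : (k : ℝ) * (1 / 2) = k * (-1 / 2) + k := by ring
    rw [this, unitChar_add, unitChar_int]; simp

lemma integral_torusSquare_unitChar (m : ℤ × ℤ) :
    ∫ t in torusSquare, unitChar (planeDot (latticePoint m) t) = if m = 0 then 1 else 0 := by
  rw [torusSquare_prod]
  have e : ∀ t : ℝ × ℝ, unitChar (planeDot (latticePoint m) t)
      = unitChar (m.1 * t.1) * unitChar (m.2 * t.2) := by
    intro t; rw [← unitChar_add]; rfl
  simp_rw [e]
  rw [integral_prod_mul (fun x => unitChar (m.1 * x)) fun x => unitChar (m.2 * x),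
    integral_unitChar_int_mul, integral_unitChar_int_mul]
  simp only [Prod.ext_iff, Prod.fst_zero, Prod.snd_zero]
  by_cases h1 : m.1 = 0 <;> by_cases h2 : m.2 = 0 <;> simp [h1, h2]

/-- The trigonometric polynomial with coefficients `a` and frequencies in `-s`. -/
noncomputable def trigPoly (a : ℤ × ℤ → ℂ) (s : Finset (ℤ × ℤ)) (t : ℝ × ℝ) : ℂ :=
  ∑ m ∈ s, a m * unitChar (planeDot (latticePoint m) (-t))

@[fun_prop]
lemma continuous_trigPoly (a : ℤ × ℤ → ℂ) (s : Finset (ℤ × ℤ)) : Continuous (trigPoly a s) := by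
  unfold trigPoly; fun_prop

lemma norm_trigPoly_le (a : ℤ × ℤ → ℂ) (s : Finset (ℤ × ℤ)) (t : ℝ × ℝ) :
    ‖trigPoly a s t‖ ≤ ∑ m ∈ s, ‖a m‖ := by
  refine (norm_sum_le _ _).trans (Finset.sum_le_sum fun m _ => ?_)
  rw [norm_mul, norm_unitChar, mul_one]

/-- Parseval's identity for trigonometric polynomials. -/
lemma integral_norm_sq_trigPoly (a : ℤ × ℤ → ℂ) (s : Finset (ℤ × ℤ)) :
    ∫ t in torusSquare, ‖trigPoly a s t‖ ^ 2 = ∑ m ∈ s, ‖a m‖ ^ 2 := by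
  have hexp : ∀ t, ((‖trigPoly a s t‖ ^ 2 : ℝ) : ℂ) = ∑ m ∈ s, ∑ k ∈ s,
      (a m * (starRingEnd ℂ) (a k)) * unitChar (planeDot (latticePoint (k - m)) t) := by
    intro t
    push_cast
    rw [← Complex.mul_conj', trigPoly, map_sum, Finset.sum_mul_sum]
    refine Finset.sum_congr rfl fun m _ => Finset.sum_congr rfl fun k _ => ?_
    rw [map_mul, ← unitChar_neg]
    have : planeDot (latticePoint (k - m)) t
        = planeDot (latticePoint m) (-t) + -planeDot (latticePoint k) (-t) := by
      simp [planeDot, latticePoint]; ring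
    rw [this, unitChar_add]; ring
  have hint : ∀ m k : ℤ × ℤ, Integrable (fun t =>
      (a m * (starRingEnd ℂ) (a k)) * unitChar (planeDot (latticePoint (k - m)) t))
      (volume.restrict torusSquare) := by
    intro m k
    refine Integrable.const_mul ?_ _
    refine (integrable_const (1 : ℝ)).mono' (by fun_prop) ?_
    exact Filter.Eventually.of_forall fun t => (norm_unitChar _).le
  apply Complex.ofReal_injective
  rw [← integral_complex_ofReal]
  simp_rw [hexp]
  rw [integral_finsetSum _ fun m _ => integrable_finsetSum _ fun k _ => hint m k]
  push_cast
  refine Finset.sum_congr rfl fun m hm => ?_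
  rw [integral_finsetSum _ fun k _ => hint m k]
  simp_rw [integral_const_mul, integral_torusSquare_unitChar, sub_eq_zero]
  simp [hm, Complex.mul_conj']

lemma eLpNorm_two_trigPoly (a : ℤ × ℤ → ℂ) (s : Finset (ℤ × ℤ)) :
    eLpNorm (trigPoly a s) (ENNReal.ofReal 2) (volume.restrict torusSquare) =
      ENNReal.ofReal (√(∑ m ∈ s, ‖a m‖ ^ 2)) := by
  have hint : Integrable (fun t => ‖trigPoly a s t‖ ^ 2) (volume.restrict torusSquare) := by
    refine (integrable_const ((∑ m ∈ s, ‖a m‖) ^ 2)).mono' (by fun_prop) ?_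
    refine Filter.Eventually.of_forall fun t => ?_
    rw [Real.norm_of_nonneg (by positivity)]
    exact pow_le_pow_left₀ (norm_nonneg _) (norm_trigPoly_le a s t) 2
  rw [eLpNorm_eq_lintegral_rpow_enorm_toReal (by simp) (by simp), ENNReal.toReal_ofReal (by norm_num),
    Real.sqrt_eq_rpow, ← ENNReal.ofReal_rpow_of_nonneg (by positivity) (by norm_num),
    ← integral_norm_sq_trigPoly, ofReal_integral_eq_lintegral_ofReal hint
      (Filter.Eventually.of_forall fun t => by positivity)]
  congr 2; ext t
  rw [ENNReal.ofReal_pow (norm_nonneg _), ofReal_norm]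
  norm_cast

/-! ### Interpolation between `L^q` and the supremum -/

/-- Interpolation between `L^q` and the supremum. The function need not be measurable, since the
pointwise bound of the integrands suffices. -/
lemma eLpNorm_le_interpolation {α E : Type*} [MeasurableSpace α] [NormedAddCommGroup E]
    {μ : Measure α} {f : α → E} {M : ℝ≥0∞} (hM : M ≠ ⊤) (hfM : ∀ x, ‖f x‖ₑ ≤ M) {p q : ℝ}
    (hq : 0 < q) (hqp : q ≤ p) :
    eLpNorm f (ENNReal.ofReal p) μ ≤
      M ^ (1 - q / p) * eLpNorm f (ENNReal.ofReal q) μ ^ (q / p) := by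
  have hp : 0 < p := hq.trans_le hqp
  rw [eLpNorm_eq_lintegral_rpow_enorm_toReal (by simpa using hp) (by simp),
    eLpNorm_eq_lintegral_rpow_enorm_toReal (by simpa using hq) (by simp),
    ENNReal.toReal_ofReal hp.le, ENNReal.toReal_ofReal hq.le]
  have h1 : ∫⁻ x, ‖f x‖ₑ ^ p ∂μ ≤ M ^ (p - q) * ∫⁻ x, ‖f x‖ₑ ^ q ∂μ := by
    rw [← lintegral_const_mul' _ _ (ENNReal.rpow_ne_top_of_nonneg (by linarith) hM)]
    refine lintegral_mono fun x => ?_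
    calc ‖f x‖ₑ ^ p = ‖f x‖ₑ ^ (p - q) * ‖f x‖ₑ ^ q := by
          rw [← ENNReal.rpow_add_of_nonneg _ _ (by linarith) hq.le]; congr 1; ring
      _ ≤ M ^ (p - q) * ‖f x‖ₑ ^ q := by
          exact mul_le_mul' (ENNReal.rpow_le_rpow (hfM x) (by linarith)) le_rfl
  calc (∫⁻ x, ‖f x‖ₑ ^ p ∂μ) ^ (1 / p)
      ≤ (M ^ (p - q) * ∫⁻ x, ‖f x‖ₑ ^ q ∂μ) ^ (1 / p) := by gcongr
    _ = _ := by
        rw [ENNReal.mul_rpow_of_nonneg _ _ (by positivity), ← ENNReal.rpow_mul, ← ENNReal.rpow_mul]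
        congr 2 <;> field_simp

/-! ### Sums over dyadic shells -/

lemma sum_one_div_sqrt_abs_le (N : ℕ) :
    ∑ i ∈ Finset.Icc (-N : ℤ) N, 1 / √|(i : ℝ)| ≤ 4 * √N := by
  induction N with
  | zero => simp
  | succ n ih =>
    have hI : Finset.Icc (-(n + 1 : ℕ) : ℤ) (n + 1 : ℕ) =
        insert (-(n + 1) : ℤ) (insert ((n : ℤ) + 1) (Finset.Icc (-n : ℤ) n)) := by
      ext i; simp only [Finset.mem_insert, Finset.mem_Icc]; push_cast; omega
    rw [hI, Finset.sum_insert (by simp; omega), Finset.sum_insert (by simp)]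
    have hn : (0 : ℝ) ≤ n := Nat.cast_nonneg n
    have e1 : |((-(n + 1) : ℤ) : ℝ)| = n + 1 := by
      push_cast; rw [abs_neg, abs_of_nonneg (by linarith)]
    have e2 : |(((n : ℤ) + 1 : ℤ) : ℝ)| = n + 1 := by
      push_cast; rw [abs_of_nonneg (by linarith)]
    rw [e1, e2]
    push_cast
    have ha : 0 < √((n : ℝ) + 1) := Real.sqrt_pos.2 (by linarith)
    have ha2 := Real.sq_sqrt (show (0 : ℝ) ≤ n + 1 by linarith)
    have hb2 := Real.sq_sqrt hn
    have : 1 / √((n : ℝ) + 1) ≤ 2 * (√((n : ℝ) + 1) - √n) := by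
      rw [div_le_iff₀ ha]; nlinarith [sq_nonneg (√((n : ℝ) + 1) - √n)]
    linarith

/-- The lattice points of supremum norm less than `2 ^ j`. -/
noncomputable def dyadicBox (j : ℕ) : Finset (ℤ × ℤ) :=
  Finset.Ioo (-2 ^ j) (2 ^ j) ×ˢ Finset.Ioo (-2 ^ j) (2 ^ j)

/-- The lattice points of supremum norm at least `2 ^ j` and less than `2 ^ (j + 1)`. -/
noncomputable def dyadicShell (j : ℕ) : Finset (ℤ × ℤ) := dyadicBox (j + 1) \ dyadicBox j

lemma mem_dyadicBox {j : ℕ} {m : ℤ × ℤ} : m ∈ dyadicBox j ↔ |m.1| < 2 ^ j ∧ |m.2| < 2 ^ j := by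
  simp [dyadicBox, abs_lt]

lemma dyadicBox_subset_succ (j : ℕ) : dyadicBox j ⊆ dyadicBox (j + 1) := by
  intro m hm
  rw [mem_dyadicBox] at hm ⊢
  have : (2 : ℤ) ^ j ≤ 2 ^ (j + 1) := pow_le_pow_right₀ (by norm_num) (by omega)
  exact ⟨hm.1.trans_le this, hm.2.trans_le this⟩

lemma dyadicBox_zero : dyadicBox 0 = {0} := by
  ext m
  rw [mem_dyadicBox, Finset.mem_singleton, pow_zero, Int.abs_lt_one_iff, Int.abs_lt_one_iff,
    Prod.ext_iff]
  rfl

lemma tendsto_dyadicBox : Filter.Tendsto dyadicBox Filter.atTop Filter.atTop := by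
  refine Filter.tendsto_atTop_finset_of_monotone (monotone_nat_of_le_succ dyadicBox_subset_succ) ?_
  intro m
  refine ⟨max m.1.natAbs m.2.natAbs, ?_⟩
  have key : ∀ i : ℤ, ∀ N : ℕ, i.natAbs ≤ N → |i| < 2 ^ N := by
    intro i N h
    have h2 : N < 2 ^ N := Nat.lt_two_pow_self
    have h3 : i.natAbs < 2 ^ N := h.trans_lt h2
    rw [Int.abs_eq_natAbs]; exact_mod_cast h3
  rw [mem_dyadicBox]
  exact ⟨key _ _ (le_max_left _ _), key _ _ (le_max_right _ _)⟩

lemma sum_dyadicBox {E : Type*} [AddCommGroup E] (f : ℤ × ℤ → E) (hf : f 0 = 0) (J : ℕ) :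
    ∑ m ∈ dyadicBox J, f m = ∑ j ∈ Finset.range J, ∑ m ∈ dyadicShell j, f m := by
  induction J with
  | zero => simp [dyadicBox_zero, hf]
  | succ n ih =>
    rw [Finset.sum_range_succ, ← ih, dyadicShell,
      ← Finset.sum_sdiff (dyadicBox_subset_succ n), add_comm]

lemma norm_latticePoint (m : ℤ × ℤ) : ‖latticePoint m‖ = max |(m.1 : ℝ)| |(m.2 : ℝ)| := rfl

lemma two_pow_le_norm_of_mem_dyadicShell {j : ℕ} {m : ℤ × ℤ} (hm : m ∈ dyadicShell j) :
    (2 : ℝ) ^ j ≤ ‖latticePoint m‖ := by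
  rw [dyadicShell, Finset.mem_sdiff, mem_dyadicBox, mem_dyadicBox, not_and_or, not_lt, not_lt] at hm
  rw [norm_latticePoint, le_max_iff]
  rcases hm.2 with h | h
  · left; exact_mod_cast h
  · right; exact_mod_cast h

lemma card_dyadicShell_le (j : ℕ) : ((dyadicShell j).card : ℝ) ≤ (4 * 2 ^ j) ^ 2 := by
  have h1 : (dyadicShell j).card ≤ (dyadicBox (j + 1)).card :=
    Finset.card_le_card Finset.sdiff_subset
  have h2 : (dyadicBox (j + 1)).card ≤ (4 * 2 ^ j) ^ 2 := by
    rw [dyadicBox, Finset.card_product, Int.card_Ioo, sq]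
    have : (2 ^ (j + 1) - -2 ^ (j + 1) - 1 : ℤ).toNat ≤ 4 * 2 ^ j := by
      rw [Int.toNat_le]; push_cast; rw [pow_succ]; linarith
    exact Nat.mul_le_mul this this
  exact_mod_cast h1.trans h2

/-- On a shell the singularity at the vertical axis of the bound in `CoeffDecay.off_axis` is harmless on
average. -/
lemma sum_dyadicShell_one_div_sqrt_le (j : ℕ) :
    ∑ m ∈ dyadicShell j, 1 / √|(m.1 : ℝ)| ≤ 32 * 2 ^ j * √(2 ^ j) := by
  have h1 : ∑ m ∈ dyadicShell j, 1 / √|(m.1 : ℝ)| ≤ ∑ m ∈ dyadicBox (j + 1), 1 / √|(m.1 : ℝ)| :=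
    Finset.sum_le_sum_of_subset_of_nonneg Finset.sdiff_subset fun _ _ _ => by positivity
  have h2 : ∑ m ∈ dyadicBox (j + 1), 1 / √|(m.1 : ℝ)|
      = ((Finset.Ioo (-2 ^ (j + 1) : ℤ) (2 ^ (j + 1))).card : ℝ) *
        ∑ i ∈ Finset.Ioo (-2 ^ (j + 1) : ℤ) (2 ^ (j + 1)), 1 / √|(i : ℝ)| := by
    rw [dyadicBox, Finset.sum_product_right]
    simp only [Finset.sum_const, nsmul_eq_mul]
  have h3 : ((Finset.Ioo (-2 ^ (j + 1) : ℤ) (2 ^ (j + 1))).card : ℝ) ≤ 4 * 2 ^ j := by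
    rw [Int.card_Ioo]
    have : (2 ^ (j + 1) - -2 ^ (j + 1) - 1 : ℤ).toNat ≤ 4 * 2 ^ j := by
      rw [Int.toNat_le]; push_cast; rw [pow_succ]; linarith
    exact_mod_cast this
  have h4 : ∑ i ∈ Finset.Ioo (-2 ^ (j + 1) : ℤ) (2 ^ (j + 1)), 1 / √|(i : ℝ)|
      ≤ 8 * √(2 ^ j) := by
    have hs : Finset.Ioo (-2 ^ (j + 1) : ℤ) (2 ^ (j + 1))
        ⊆ Finset.Icc (-(2 ^ (j + 1) : ℕ) : ℤ) ((2 ^ (j + 1) : ℕ) : ℤ) := by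
      push_cast; exact Finset.Ioo_subset_Icc_self
    refine (Finset.sum_le_sum_of_subset_of_nonneg hs fun _ _ _ => by positivity).trans ?_
    refine (sum_one_div_sqrt_abs_le _).trans ?_
    have : √((2 ^ (j + 1) : ℕ) : ℝ) ≤ 2 * √(2 ^ j) := by
      rw [Real.sqrt_le_left (by positivity), mul_pow, Real.sq_sqrt (by positivity)]
      push_cast; rw [pow_succ]; have : (0 : ℝ) < 2 ^ j := by positivity
      linarith
    linarith
  calc _ ≤ _ := h1
    _ = _ := h2
    _ ≤ (4 * 2 ^ j) * (8 * √(2 ^ j)) := by gcongr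
    _ = _ := by ring

/-- A geometric sum that grows up to the scale `1 / ε` and decays beyond it is comparable with its
largest term. -/
lemma exists_sum_two_pow_mul_min_le {θ : ℝ} (hθ : 0 < θ) (hθ' : θ ≤ 1 / 2) :
    ∃ C : ℝ, 0 < C ∧ ∀ (n : ℕ) (ε : ℝ), 0 < ε → ε ≤ 1 →
      ∑ j ∈ Finset.range n, ((2 : ℝ) ^ j) ^ θ * min 1 (1 / (ε * 2 ^ j)) ≤ C * ε ^ (-θ) := by
  have h2θ : 1 < (2 : ℝ) ^ θ := Real.one_lt_rpow (by norm_num) hθ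
  set D : ℝ := 1 / (2 ^ θ - 1) with hD
  have hDpos : 0 < D := by rw [hD]; apply one_div_pos.2; linarith
  set C : ℝ := 2 ^ θ * (4 + D) with hC
  have hCpos : 0 < C := by positivity
  -- the decaying part
  have hdec : ∀ (n : ℕ) (ε : ℝ), 1 ≤ ε →
      ∑ j ∈ Finset.range n, ((2 : ℝ) ^ j) ^ θ * min 1 (1 / (ε * 2 ^ j)) ≤ 4 := by
    intro n ε hε
    have hr0 : (0 : ℝ) ≤ 1 / √2 := by positivity
    have hs2 : (1.4 : ℝ) ≤ √2 := by
      apply Real.le_sqrt_of_sq_le; norm_num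
    have hr1 : 1 / √2 ≤ 3 / 4 := by
      rw [div_le_div_iff₀ (by positivity) (by norm_num)]; linarith
    calc ∑ j ∈ Finset.range n, ((2 : ℝ) ^ j) ^ θ * min 1 (1 / (ε * 2 ^ j))
        ≤ ∑ j ∈ Finset.range n, (3 / 4 : ℝ) ^ j := by
          refine Finset.sum_le_sum fun j _ => ?_
          have hp : (1 : ℝ) ≤ 2 ^ j := one_le_pow₀ (by norm_num)
          have h1 : ((2 : ℝ) ^ j) ^ θ ≤ √(2 ^ j) := by
            rw [Real.sqrt_eq_rpow]; exact Real.rpow_le_rpow_of_exponent_le hp hθ'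
          have h2 : min 1 (1 / (ε * 2 ^ j)) ≤ 1 / 2 ^ j := by
            refine (min_le_right _ _).trans ?_
            apply one_div_le_one_div_of_le (by positivity); nlinarith
          calc ((2 : ℝ) ^ j) ^ θ * min 1 (1 / (ε * 2 ^ j)) ≤ √(2 ^ j) * (1 / 2 ^ j) := by
                gcongr
            _ = (1 / √2) ^ j := by
                have : √((2 : ℝ) ^ j) = √2 ^ j := by
                  rw [Real.sqrt_eq_rpow, Real.sqrt_eq_rpow, ← Real.rpow_natCast, ← Real.rpow_natCast,
                    ← Real.rpow_mul (by norm_num), ← Real.rpow_mul (by norm_num), mul_comm]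
                rw [this, one_div, ← inv_pow, ← mul_pow]
                congr 1
                rw [← div_eq_mul_inv, Real.sqrt_div_self']
            _ ≤ (3 / 4) ^ j := pow_le_pow_left₀ hr0 hr1 j
      _ ≤ (1 - 3 / 4)⁻¹ := by
          have := Summable.sum_le_tsum (f := fun j : ℕ => (3 / 4 : ℝ) ^ j) (Finset.range n)
            (fun _ _ => by positivity) (summable_geometric_of_lt_one (by norm_num) (by norm_num))
          rwa [tsum_geometric_of_lt_one (by norm_num) (by norm_num)] at this
      _ = 4 := by norm_num
  -- stepping down from scale `2ε` to scale `ε`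
  have key : ∀ (n : ℕ) (ε : ℝ), 0 < ε → ε ≤ 2 →
      ∑ j ∈ Finset.range n, ((2 : ℝ) ^ j) ^ θ * min 1 (1 / (ε * 2 ^ j)) ≤ C * ε ^ (-θ) - D := by
    have hbig : ∀ (n : ℕ) (ε : ℝ), 1 ≤ ε → ε ≤ 2 →
        ∑ j ∈ Finset.range n, ((2 : ℝ) ^ j) ^ θ * min 1 (1 / (ε * 2 ^ j)) ≤ C * ε ^ (-θ) - D := by
      intro n ε h1 h2
      have : (2 : ℝ) ^ (-θ) ≤ ε ^ (-θ) :=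
        Real.rpow_le_rpow_of_nonpos (by linarith) h2 (by linarith)
      have h3 : C * 2 ^ (-θ) = 4 + D := by
        rw [hC, mul_right_comm, ← Real.rpow_add (by norm_num)]; simp
      have := mul_le_mul_of_nonneg_left this hCpos.le
      linarith [hdec n ε h1]
    intro n
    induction n with
    | zero =>
      intro ε h0 h2
      rcases le_or_gt 1 ε with h | h
      · exact hbig 0 ε h h2
      · have : (1 : ℝ) ≤ ε ^ (-θ) := Real.one_le_rpow_of_pos_of_le_one_of_nonpos h0 h.le (by linarith)
        have hCD : D ≤ C := by rw [hC]; nlinarith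
        simp only [Finset.range_zero, Finset.sum_empty]
        nlinarith
    | succ n ih =>
      intro ε h0 h2
      rcases le_or_gt 1 ε with h | h
      · exact hbig _ ε h h2
      have hih := ih (2 * ε) (by linarith) (by linarith)
      rw [Finset.sum_range_succ']
      have e : ∑ j ∈ Finset.range n, ((2 : ℝ) ^ (j + 1)) ^ θ * min 1 (1 / (ε * 2 ^ (j + 1)))
          = 2 ^ θ * ∑ j ∈ Finset.range n, ((2 : ℝ) ^ j) ^ θ * min 1 (1 / (2 * ε * 2 ^ j)) := by
        rw [Finset.mul_sum]
        refine Finset.sum_congr rfl fun j _ => ?_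
        rw [pow_succ, Real.mul_rpow (by positivity) (by norm_num)]
        have : ε * (2 ^ j * 2) = 2 * ε * 2 ^ j := by ring
        rw [this]; ring
      rw [e]
      have e2 : (2 : ℝ) ^ θ * (C * (2 * ε) ^ (-θ)) = C * ε ^ (-θ) := by
        rw [Real.mul_rpow (by norm_num) h0.le, Real.rpow_neg (by norm_num)]
        field_simp
      have e3 : (2 ^ θ - 1) * D = 1 := by rw [hD]; field_simp [show (2 : ℝ) ^ θ - 1 ≠ 0 by linarith]
      have h0' : ((2 : ℝ) ^ 0) ^ θ * min 1 (1 / (ε * 2 ^ 0)) ≤ 1 := by simp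
      have := mul_le_mul_of_nonneg_left hih (show (0 : ℝ) ≤ 2 ^ θ by positivity)
      rw [mul_sub, e2] at this
      linarith
  exact ⟨C, hCpos, fun n ε h0 h1 => (key n ε h0 (by linarith)).trans (by linarith)⟩

/-- The decay of the nonconstant Fourier coefficients of a smoothed lattice point count: `A` is the
size contributed by the points of nonvanishing curvature, `B` the one contributed by the flat point,
whose normal is the vertical direction, and `ε` is the scale of smoothing. As `0 ^ (-b) = 0`, the bound
on the axis forces the constant coefficient to vanish. -/
structure CoeffDecay (a : ℤ × ℤ → ℂ) (A B ε b : ℝ) : Prop where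
  off_axis : ∀ m : ℤ × ℤ, m.1 ≠ 0 → ‖a m‖ ^ 2 ≤
    A ^ 2 / (‖latticePoint m‖ ^ 2 * √(‖latticePoint m‖ * |(m.1 : ℝ)|)) *
      min 1 (1 / (ε * ‖latticePoint m‖)) ^ 2
  on_axis : ∀ m : ℤ × ℤ, m.1 = 0 → ‖a m‖ ≤ B * |(m.2 : ℝ)| ^ (-b)

/-- The coefficients at frequencies outside the vertical axis. -/
noncomputable def offAxis (a : ℤ × ℤ → ℂ) (m : ℤ × ℤ) : ℂ := if m.1 = 0 then 0 else a m

/-- The coefficients at frequencies on the vertical axis. -/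
noncomputable def onAxis (a : ℤ × ℤ → ℂ) (m : ℤ × ℤ) : ℂ := if m.1 = 0 then a m else 0

lemma onAxis_add_offAxis (a : ℤ × ℤ → ℂ) (m : ℤ × ℤ) : onAxis a m + offAxis a m = a m := by
  by_cases h : m.1 = 0 <;> simp [onAxis, offAxis, h]

lemma norm_onAxis_add_norm_offAxis (a : ℤ × ℤ → ℂ) (m : ℤ × ℤ) :
    ‖onAxis a m‖ + ‖offAxis a m‖ = ‖a m‖ := by
  by_cases h : m.1 = 0 <;> simp [onAxis, offAxis, h]

namespace CoeffDecay

variable {a : ℤ × ℤ → ℂ} {A B ε b : ℝ}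

lemma sum_sq_dyadicShell_le (h : CoeffDecay a A B ε b) (hε : 0 < ε) (j : ℕ) :
    ∑ m ∈ dyadicShell j, ‖offAxis a m‖ ^ 2 ≤
      32 * A ^ 2 * min 1 (1 / (ε * 2 ^ j)) ^ 2 / 2 ^ j := by
  set τ := min 1 (1 / (ε * 2 ^ j)) with hτ
  have hτ0 : 0 ≤ τ := le_min zero_le_one (by positivity)
  have h2 : (0 : ℝ) < 2 ^ j := by positivity
  have hterm : ∀ m ∈ dyadicShell j, ‖offAxis a m‖ ^ 2 ≤
      A ^ 2 * τ ^ 2 / ((2 ^ j) ^ 2 * √(2 ^ j)) * (1 / √|(m.1 : ℝ)|) := by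
    intro m hm
    have hN := two_pow_le_norm_of_mem_dyadicShell hm
    by_cases h0 : m.1 = 0
    · simp [offAxis, h0]
    · have hm1 : 0 < |(m.1 : ℝ)| := abs_pos.2 (by exact_mod_cast h0)
      rw [offAxis, if_neg h0]
      refine (h.off_axis m h0).trans ?_
      have hmin : min 1 (1 / (ε * ‖latticePoint m‖)) ≤ τ := by
        refine min_le_min le_rfl (one_div_le_one_div_of_le (by positivity) ?_)
        gcongr
      have hmin0 : 0 ≤ min 1 (1 / (ε * ‖latticePoint m‖)) := le_min zero_le_one (by positivity)
      calc A ^ 2 / (‖latticePoint m‖ ^ 2 * √(‖latticePoint m‖ * |(m.1 : ℝ)|)) *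
            min 1 (1 / (ε * ‖latticePoint m‖)) ^ 2
          ≤ A ^ 2 / ((2 ^ j) ^ 2 * √(2 ^ j * |(m.1 : ℝ)|)) * τ ^ 2 := by gcongr
        _ = _ := by rw [Real.sqrt_mul h2.le]; field_simp
  refine (Finset.sum_le_sum hterm).trans ?_
  rw [← Finset.mul_sum]
  have hs : 0 < √((2 : ℝ) ^ j) := Real.sqrt_pos.2 h2
  calc A ^ 2 * τ ^ 2 / ((2 ^ j) ^ 2 * √(2 ^ j)) * ∑ m ∈ dyadicShell j, 1 / √|(m.1 : ℝ)|
      ≤ A ^ 2 * τ ^ 2 / ((2 ^ j) ^ 2 * √(2 ^ j)) * (32 * 2 ^ j * √(2 ^ j)) := by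
        gcongr; exact sum_dyadicShell_one_div_sqrt_le j
    _ = _ := by field_simp

lemma sqrt_sum_sq_dyadicShell_le (h : CoeffDecay a A B ε b) (hε : 0 < ε) (hA : 0 ≤ A) (j : ℕ) :
    √(∑ m ∈ dyadicShell j, ‖offAxis a m‖ ^ 2) ≤
      6 * A * min 1 (1 / (ε * 2 ^ j)) * ((2 : ℝ) ^ j) ^ (-(1 / 2) : ℝ) := by
  have hτ0 : 0 ≤ min 1 (1 / (ε * 2 ^ j)) := le_min zero_le_one (by positivity)
  rw [Real.sqrt_le_left (by positivity)]
  refine (h.sum_sq_dyadicShell_le hε j).trans ?_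
  have : (((2 : ℝ) ^ j) ^ (-(1 / 2) : ℝ)) ^ 2 = 1 / 2 ^ j := by
    rw [← Real.rpow_natCast, ← Real.rpow_mul (by positivity)]
    norm_num [Real.rpow_neg_one]
  rw [mul_pow, this, mul_pow, mul_pow, mul_one_div]
  gcongr
  norm_num

lemma sum_dyadicShell_le_mul_sqrt (a : ℤ × ℤ → ℂ) (j : ℕ) :
    ∑ m ∈ dyadicShell j, ‖offAxis a m‖ ≤
      4 * 2 ^ j * √(∑ m ∈ dyadicShell j, ‖offAxis a m‖ ^ 2) := by
  have h1 := sq_sum_le_card_mul_sum_sq (s := dyadicShell j) (f := fun m => ‖offAxis a m‖)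
  rw [← Real.sqrt_sq (show (0 : ℝ) ≤ 4 * 2 ^ j by positivity), ← Real.sqrt_mul (by positivity)]
  refine Real.le_sqrt_of_sq_le (h1.trans ?_)
  gcongr
  exact card_dyadicShell_le j

/-- The supremum bound for a shell: the Cauchy–Schwarz inequality and the square sum. -/
lemma sum_dyadicShell_le (h : CoeffDecay a A B ε b) (hε : 0 < ε) (hA : 0 ≤ A) (j : ℕ) :
    ∑ m ∈ dyadicShell j, ‖offAxis a m‖ ≤
      24 * A * (((2 : ℝ) ^ j) ^ (1 / 2 : ℝ) * min 1 (1 / (ε * 2 ^ j))) := by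
  refine (sum_dyadicShell_le_mul_sqrt a j).trans ?_
  refine (mul_le_mul_of_nonneg_left (h.sqrt_sum_sq_dyadicShell_le hε hA j)
    (by positivity)).trans (le_of_eq ?_)
  have : (2 : ℝ) ^ j * ((2 : ℝ) ^ j) ^ (-(1 / 2) : ℝ) = ((2 : ℝ) ^ j) ^ (1 / 2 : ℝ) := by
    rw [← Real.rpow_one_add' (by positivity) (by norm_num)]; norm_num
  rw [← this]; ring

/-- The `L^p` norm of a shell, interpolated between the `L^2` norm and the supremum. -/
lemma eLpNorm_dyadicShell_le (h : CoeffDecay a A B ε b) (hε : 0 < ε) (hA : 0 ≤ A) {p : ℝ}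
    (hp : 2 ≤ p) (j : ℕ) :
    eLpNorm (trigPoly (offAxis a) (dyadicShell j)) (ENNReal.ofReal p)
        (volume.restrict torusSquare) ≤
      ENNReal.ofReal (24 * A * (((2 : ℝ) ^ j) ^ (1 / 2 - 2 / p) * min 1 (1 / (ε * 2 ^ j)))) := by
  set q := √(∑ m ∈ dyadicShell j, ‖offAxis a m‖ ^ 2) with hq
  have hq0 : 0 ≤ q := Real.sqrt_nonneg _
  have hτ0 : 0 ≤ min 1 (1 / (ε * 2 ^ j)) := le_min zero_le_one (by positivity)
  have hx : (0 : ℝ) < 2 ^ j := by positivity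
  have h2p : 2 / p ≤ 1 := by rw [div_le_one (by linarith)]; exact hp
  have h2p0 : 0 ≤ 2 / p := by positivity
  have h1 := eLpNorm_le_interpolation (μ := volume.restrict torusSquare)
    (f := trigPoly (offAxis a) (dyadicShell j)) (M := ENNReal.ofReal (4 * 2 ^ j * q)) (q := 2)
    (p := p) ENNReal.ofReal_ne_top (fun t => by
      rw [← ofReal_norm]
      exact ENNReal.ofReal_le_ofReal
        ((norm_trigPoly_le _ _ t).trans (sum_dyadicShell_le_mul_sqrt a j))) (by norm_num) hp
  rw [eLpNorm_two_trigPoly, ← hq, ENNReal.ofReal_rpow_of_nonneg (by positivity) (by linarith),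
    ENNReal.ofReal_rpow_of_nonneg hq0 h2p0, ← ENNReal.ofReal_mul (by positivity)] at h1
  refine h1.trans (ENNReal.ofReal_le_ofReal ?_)
  have e1 : (4 * 2 ^ j * q) ^ (1 - 2 / p) * q ^ (2 / p) = (4 * 2 ^ j) ^ (1 - 2 / p) * q := by
    rw [Real.mul_rpow (by positivity) hq0, mul_assoc,
      ← Real.rpow_add_of_nonneg hq0 (by linarith) h2p0]
    simp
  have e2 : (4 * 2 ^ j : ℝ) ^ (1 - 2 / p) ≤ 4 * (2 ^ j) ^ (1 - 2 / p) := by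
    rw [Real.mul_rpow (by norm_num) hx.le]
    gcongr
    exact Real.rpow_le_self_of_one_le (by norm_num) (by linarith)
  have e3 : ((2 : ℝ) ^ j) ^ (1 - 2 / p) * ((2 : ℝ) ^ j) ^ (-(1 / 2) : ℝ)
      = ((2 : ℝ) ^ j) ^ (1 / 2 - 2 / p) := by
    rw [← Real.rpow_add hx]; congr 1; ring
  rw [e1]
  calc (4 * 2 ^ j : ℝ) ^ (1 - 2 / p) * q ≤ 4 * (2 ^ j) ^ (1 - 2 / p) *
        (6 * A * min 1 (1 / (ε * 2 ^ j)) * ((2 : ℝ) ^ j) ^ (-(1 / 2) : ℝ)) := by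
        gcongr; exact h.sqrt_sum_sq_dyadicShell_le hε hA j
    _ = _ := by rw [← e3]; ring

lemma sum_onAxis_le (h : CoeffDecay a A B ε b) (hB : 0 ≤ B) (hb : 1 < b) (J : ℕ) :
    ∑ m ∈ dyadicBox J, ‖onAxis a m‖ ≤ B * ∑' k : ℤ, |(k : ℝ)| ^ (-b) := by
  have hs := Real.summable_abs_int_rpow hb
  calc ∑ m ∈ dyadicBox J, ‖onAxis a m‖
      ≤ ∑ m ∈ dyadicBox J, if m.1 = 0 then B * |(m.2 : ℝ)| ^ (-b) else 0 := by
        refine Finset.sum_le_sum fun m _ => ?_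
        by_cases h0 : m.1 = 0
        · rw [onAxis, if_pos h0, if_pos h0]; exact h.on_axis m h0
        · simp [onAxis, h0]
    _ = ∑ k ∈ Finset.Ioo (-2 ^ J : ℤ) (2 ^ J), B * |(k : ℝ)| ^ (-b) := by
        rw [dyadicBox, Finset.sum_product_right]
        refine Finset.sum_congr rfl fun k _ => ?_
        simp only
        rw [Finset.sum_ite_eq' _ (0 : ℤ)]
        simp
    _ = B * ∑ k ∈ Finset.Ioo (-2 ^ J : ℤ) (2 ^ J), |(k : ℝ)| ^ (-b) := by rw [Finset.mul_sum]
    _ ≤ _ := by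
        gcongr
        exact hs.sum_le_tsum _ fun k _ => by positivity

end CoeffDecay

/-- The sum of the moduli of the coefficients, dominated by the shell at the smoothing scale. -/
theorem exists_tsum_norm_le_of_coeffDecay {b : ℝ} (hb : 1 < b) :
    ∃ C : ℝ, 0 < C ∧ ∀ (a : ℤ × ℤ → ℂ) (A B ε : ℝ), 0 ≤ A → 0 ≤ B → 0 < ε → ε ≤ 1 →
      CoeffDecay a A B ε b →
      (Summable fun m => ‖a m‖) ∧ ∑' m, ‖a m‖ ≤ C * (A * ε ^ (-(1 / 2) : ℝ) + B) := by
  obtain ⟨C, hC, hsum⟩ := exists_sum_two_pow_mul_min_le (θ := 1 / 2) (by norm_num) le_rfl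
  set S : ℝ := ∑' k : ℤ, |(k : ℝ)| ^ (-b)
  have hS : 0 ≤ S := tsum_nonneg fun k => by positivity
  refine ⟨24 * C + S, by positivity, fun a A B ε hA hB hε hε1 h => ?_⟩
  have hbox : ∀ J, ∑ m ∈ dyadicBox J, ‖a m‖ ≤ (24 * C + S) * (A * ε ^ (-(1 / 2) : ℝ) + B) := by
    intro J
    simp_rw [← norm_onAxis_add_norm_offAxis a]
    rw [Finset.sum_add_distrib, sum_dyadicBox (fun m => ‖offAxis a m‖) (by simp [offAxis])]
    have h1 := h.sum_onAxis_le hB hb J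
    have h2 : ∑ j ∈ Finset.range J, ∑ m ∈ dyadicShell j, ‖offAxis a m‖
        ≤ 24 * A * (C * ε ^ (-(1 / 2) : ℝ)) := by
      refine (Finset.sum_le_sum fun j _ => h.sum_dyadicShell_le hε hA j).trans ?_
      rw [← Finset.mul_sum]
      gcongr
      exact hsum J ε hε hε1
    have h3 : 0 ≤ A * ε ^ (-(1 / 2) : ℝ) := by positivity
    nlinarith [mul_nonneg hC.le hB, mul_nonneg hS h3]
  have hfin : ∀ s : Finset (ℤ × ℤ), ∑ m ∈ s, ‖a m‖
      ≤ (24 * C + S) * (A * ε ^ (-(1 / 2) : ℝ) + B) := by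
    intro s
    obtain ⟨J, hJ⟩ := (tendsto_dyadicBox.eventually_ge_atTop s).exists
    exact (Finset.sum_le_sum_of_subset_of_nonneg hJ fun _ _ _ => norm_nonneg _).trans (hbox J)
  have hsm : Summable fun m => ‖a m‖ := summable_of_sum_le (fun _ => norm_nonneg _) hfin
  exact ⟨hsm, hsm.tsum_le_of_sum_le hfin⟩

/-- The trigonometric series with coefficients `a` and frequencies `-m`. -/
noncomputable def trigSeries (a : ℤ × ℤ → ℂ) (t : ℝ × ℝ) : ℂ :=
  ∑' m, a m * unitChar (planeDot (latticePoint m) (-t))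

lemma continuous_trigSeries {a : ℤ × ℤ → ℂ} (ha : Summable fun m => ‖a m‖) :
    Continuous (trigSeries a) := by
  refine continuous_tsum (fun m => by fun_prop) ha fun m t => ?_
  rw [norm_mul, norm_unitChar, mul_one]

lemma norm_trigSeries_le {a : ℤ × ℤ → ℂ} (ha : Summable fun m => ‖a m‖) (t : ℝ × ℝ) :
    ‖trigSeries a t‖ ≤ ∑' m, ‖a m‖ := by
  refine tsum_of_norm_bounded ha.hasSum fun m => ?_
  rw [norm_mul, norm_unitChar, mul_one]

/-- The `L^p` norm of the trigonometric series, for `p > 4`: each dyadic shell is interpolated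
between Parseval's identity and the supremum bound. -/
theorem exists_eLpNorm_trigSeries_le_of_coeffDecay {b : ℝ} (hb : 1 < b) {p : ℝ} (hp : 4 < p) :
    ∃ C : ℝ, 0 < C ∧ ∀ (a : ℤ × ℤ → ℂ) (A B ε : ℝ), 0 ≤ A → 0 ≤ B → 0 < ε → ε ≤ 1 →
      CoeffDecay a A B ε b → (Summable fun m => ‖a m‖) →
      eLpNorm (trigSeries a) (ENNReal.ofReal p) (volume.restrict torusSquare) ≤
        ENNReal.ofReal (C * (A * ε ^ (-(1 / 2 - 2 / p)) + B)) := by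
  have hθ : 0 < 1 / 2 - 2 / p := by
    have : 2 / p < 1 / 2 := by rw [div_lt_div_iff₀ (by linarith) (by norm_num)]; linarith
    linarith
  obtain ⟨C, hC, hsum⟩ := exists_sum_two_pow_mul_min_le hθ
    (by have : 0 ≤ 2 / p := by positivity
        linarith)
  set S : ℝ := ∑' k : ℤ, |(k : ℝ)| ^ (-b)
  have hS : 0 ≤ S := tsum_nonneg fun k => by positivity
  refine ⟨24 * C + S, by positivity, fun a A B ε hA hB hε hε1 h hsm => ?_⟩
  have hp1 : 1 ≤ ENNReal.ofReal p := by
    rw [← ENNReal.ofReal_one]; exact ENNReal.ofReal_le_ofReal (by linarith)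
  have hlim : ∀ t, Filter.Tendsto (fun J => trigPoly a (dyadicBox J) t) Filter.atTop
      (𝓝 (trigSeries a t)) := by
    intro t
    have hs : Summable fun m => a m * unitChar (planeDot (latticePoint m) (-t)) := by
      refine Summable.of_norm ?_
      simpa [norm_unitChar] using hsm
    exact hs.hasSum.comp tendsto_dyadicBox
  have hJ : ∀ J, eLpNorm (trigPoly a (dyadicBox J)) (ENNReal.ofReal p)
      (volume.restrict torusSquare) ≤
        ENNReal.ofReal ((24 * C + S) * (A * ε ^ (-(1 / 2 - 2 / p)) + B)) := by
    intro J
    have hdec : trigPoly a (dyadicBox J) = trigPoly (onAxis a) (dyadicBox J) +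
        ∑ j ∈ Finset.range J, trigPoly (offAxis a) (dyadicShell j) := by
      ext t
      rw [Pi.add_apply, Finset.sum_apply]
      simp only [trigPoly]
      rw [← sum_dyadicBox (fun m => offAxis a m * unitChar (planeDot (latticePoint m) (-t)))
        (by simp [offAxis]), ← Finset.sum_add_distrib]
      refine Finset.sum_congr rfl fun m _ => ?_
      rw [← add_mul, onAxis_add_offAxis]
    have hon : eLpNorm (trigPoly (onAxis a) (dyadicBox J)) (ENNReal.ofReal p)
        (volume.restrict torusSquare) ≤ ENNReal.ofReal (B * S) := by
      refine (eLpNorm_le_of_ae_bound (C := B * S) (Filter.Eventually.of_forall fun t =>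
        (norm_trigPoly_le _ _ t).trans (h.sum_onAxis_le hB hb J))).trans ?_
      simp
    have hoff : eLpNorm (∑ j ∈ Finset.range J, trigPoly (offAxis a) (dyadicShell j))
        (ENNReal.ofReal p) (volume.restrict torusSquare) ≤
        ENNReal.ofReal (24 * A * (C * ε ^ (-(1 / 2 - 2 / p)))) := by
      refine (eLpNorm_sum_le (fun j _ => (continuous_trigPoly _ _).aestronglyMeasurable) hp1).trans ?_
      refine (Finset.sum_le_sum fun j _ => h.eLpNorm_dyadicShell_le hε hA (by linarith) j).trans ?_
      rw [← ENNReal.ofReal_sum_of_nonneg fun j _ => by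
        have : 0 ≤ min 1 (1 / (ε * 2 ^ j)) := le_min zero_le_one (by positivity)
        positivity]
      refine ENNReal.ofReal_le_ofReal ?_
      rw [← Finset.mul_sum]
      gcongr
      exact hsum J ε hε hε1
    rw [hdec]
    refine (eLpNorm_add_le (continuous_trigPoly _ _).aestronglyMeasurable
      (by fun_prop) hp1).trans ?_
    refine (add_le_add hon hoff).trans ?_
    rw [← ENNReal.ofReal_add (by positivity) (by positivity)]
    refine ENNReal.ofReal_le_ofReal ?_
    have h3 : 0 ≤ A * ε ^ (-(1 / 2 - 2 / p)) := by positivity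
    nlinarith [mul_nonneg hC.le hB, mul_nonneg hS h3]
  refine (Lp.eLpNorm_lim_le_liminf_eLpNorm
    (fun J => (continuous_trigPoly a (dyadicBox J)).aestronglyMeasurable) _
    (Filter.Eventually.of_forall hlim)).trans ?_
  exact Filter.liminf_le_of_frequently_le' (Filter.Frequently.of_forall hJ)

/-! ### Uniform convexity of the power function -/

lemma abs_rpow_tangent_le {γ : ℝ} (hγ : 2 < γ) (a b : ℝ) :
    |a| ^ γ + γ * |a| ^ (γ - 2) * a * (b - a) ≤ |b| ^ γ := by
  rcases eq_or_ne a 0 with rfl | ha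
  · simp [Real.zero_rpow (show γ ≠ 0 by linarith)]
    positivity
  have ha' : 0 < |a| := abs_pos.2 ha
  have hB := one_add_mul_self_le_rpow_one_add (s := |b| / |a| - 1) (p := γ)
    (by have : 0 ≤ |b| / |a| := by positivity
        linarith) (by linarith)
  rw [add_sub_cancel, Real.div_rpow (abs_nonneg _) (abs_nonneg _)] at hB
  have hpos : 0 < |a| ^ γ := Real.rpow_pos_of_pos ha' _
  have hsplit : |a| ^ γ = |a| ^ (γ - 2) * (a * a) := by
    rw [← abs_mul_abs_self a, ← mul_assoc, ← Real.rpow_add_one ha'.ne', ← Real.rpow_add_one ha'.ne']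
    congr 1; ring
  have h1 := mul_le_mul_of_nonneg_right hB hpos.le
  rw [div_mul_cancel₀ _ hpos.ne'] at h1
  refine le_trans ?_ h1
  have hp2 : 0 < |a| ^ (γ - 2) := Real.rpow_pos_of_pos ha' _
  have h2 : a * b ≤ |b| / |a| * (a * a) := by
    have : |b| / |a| * (a * a) = |b| * |a| := by
      rw [← abs_mul_abs_self a]; field_simp
    rw [this, mul_comm]
    calc b * a ≤ |b * a| := le_abs_self _
      _ = _ := abs_mul _ _
  rw [hsplit]
  have h3 := mul_le_mul_of_nonneg_left h2 (show 0 ≤ γ * |a| ^ (γ - 2) by positivity)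
  nlinarith

/-- Two lower bounds for the Bregman distance of `|x| ^ γ`. They follow from the parallelogram-type
inequality `(|u + v| ^ γ + |u - v| ^ γ) / 2 ≥ (u ^ 2 + v ^ 2) ^ (γ / 2)` at the midpoint `u`. -/
lemma abs_rpow_bregman {γ : ℝ} (hγ : 2 < γ) (hγ3 : γ ≤ 3) (a b : ℝ) :
    |b - a| ^ γ / 4 ≤ |b| ^ γ - |a| ^ γ - γ * |a| ^ (γ - 2) * a * (b - a) ∧
    |a| ^ (γ - 2) * (b - a) ^ 2 / 4 ≤
      |b| ^ γ - |a| ^ γ - γ * |a| ^ (γ - 2) * a * (b - a) := by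
  have sqr : ∀ x : ℝ, |x| ^ γ = (x ^ 2) ^ (γ / 2) := by
    intro x
    rw [← sq_abs, ← Real.rpow_natCast, ← Real.rpow_mul (abs_nonneg _)]
    congr 1; push_cast; ring
  set u := (a + b) / 2 with hu
  set v := (b - a) / 2 with hv
  have hq : 1 ≤ γ / 2 := by linarith
  have hmean : (u ^ 2 + v ^ 2) ^ (γ / 2) ≤ (|a| ^ γ + |b| ^ γ) / 2 := by
    have := (convexOn_rpow hq).2 (x := a ^ 2) (y := b ^ 2) (sq_nonneg a) (sq_nonneg b)
      (by norm_num : (0 : ℝ) ≤ 1 / 2) (by norm_num : (0 : ℝ) ≤ 1 / 2) (by norm_num)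
    simp only [smul_eq_mul] at this
    rw [← sqr, ← sqr] at this
    have e : u ^ 2 + v ^ 2 = 1 / 2 * a ^ 2 + 1 / 2 * b ^ 2 := by rw [hu, hv]; ring
    rw [e]; linarith
  have htan := abs_rpow_tangent_le hγ a u
  have hua : u - a = (b - a) / 2 := by rw [hu]; ring
  rw [hua] at htan
  -- it remains to bound the mean from below
  have red : ∀ X : ℝ, |u| ^ γ + X ≤ (u ^ 2 + v ^ 2) ^ (γ / 2) →
      2 * X ≤ |b| ^ γ - |a| ^ γ - γ * |a| ^ (γ - 2) * a * (b - a) := by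
    intro X hX
    nlinarith
  have part1 : |b - a| ^ γ / 4 ≤ |b| ^ γ - |a| ^ γ - γ * |a| ^ (γ - 2) * a * (b - a) := by
    refine le_trans ?_ (red (|v| ^ γ) ?_)
    · rw [hv, abs_div, abs_two, Real.div_rpow (abs_nonneg _) (by norm_num)]
      have h8 : (2 : ℝ) ^ γ ≤ 8 := by
        calc (2 : ℝ) ^ γ ≤ 2 ^ (3 : ℝ) := Real.rpow_le_rpow_of_exponent_le (by norm_num) hγ3
          _ = 8 := by norm_num
      have : |b - a| ^ γ / 8 ≤ |b - a| ^ γ / 2 ^ γ := by gcongr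
      linarith
    · rw [sqr u, sqr v]
      exact Real.add_rpow_le_rpow_add (by positivity) (by positivity) hq
  refine ⟨part1, ?_⟩
  rcases le_or_gt |b - a| |a| with hba | hba
  · have hubern : |u| ^ γ + |u| ^ (γ - 2) * v ^ 2 ≤ (u ^ 2 + v ^ 2) ^ (γ / 2) := by
      rcases eq_or_ne u 0 with h0 | h0
      · rw [h0, abs_zero, Real.zero_rpow (by linarith), Real.zero_rpow (by linarith)]
        simp; positivity
      · have hu2 : 0 < u ^ 2 := by positivity
        have hB := one_add_mul_self_le_rpow_one_add (s := v ^ 2 / u ^ 2) (p := γ / 2)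
          (by have : 0 ≤ v ^ 2 / u ^ 2 := by positivity
              linarith) hq
        have e1 : (u ^ 2 + v ^ 2) ^ (γ / 2) = |u| ^ γ * (1 + v ^ 2 / u ^ 2) ^ (γ / 2) := by
          rw [sqr u, ← Real.mul_rpow hu2.le (by positivity)]
          congr 1; field_simp
        have e2 : |u| ^ γ = |u| ^ (γ - 2) * u ^ 2 := by
          rw [← sq_abs u, ← Real.rpow_natCast, ← Real.rpow_add (abs_pos.2 h0)]
          congr 1; push_cast; ring
        have e3 : |u| ^ (γ - 2) * v ^ 2 = |u| ^ γ * (v ^ 2 / u ^ 2) := by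
          rw [e2]; field_simp
        have hup : 0 ≤ |u| ^ γ := by positivity
        rw [e1, e3]
        have h1 := mul_le_mul_of_nonneg_left hB hup
        have h2 : v ^ 2 / u ^ 2 ≤ γ / 2 * (v ^ 2 / u ^ 2) :=
          le_mul_of_one_le_left (by positivity) hq
        nlinarith [mul_le_mul_of_nonneg_left h2 hup]
    refine le_trans ?_ (red _ hubern)
    have hua2 : |a| / 2 ≤ |u| := by
      have h1 : u = a + (b - a) / 2 := by rw [hu]; ring
      have h2 : |a| ≤ |u| + |(b - a) / 2| := by
        have := abs_sub u ((b - a) / 2)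
        rwa [show u - (b - a) / 2 = a by rw [h1]; ring] at this
      rw [abs_div (b - a), abs_two] at h2
      linarith
    have h3 : |a| ^ (γ - 2) / 2 ≤ |u| ^ (γ - 2) := by
      calc |a| ^ (γ - 2) / 2 ≤ |a| ^ (γ - 2) / 2 ^ (γ - 2) := by
            gcongr
            calc (2 : ℝ) ^ (γ - 2) ≤ 2 ^ (1 : ℝ) :=
                  Real.rpow_le_rpow_of_exponent_le (by norm_num) (by linarith)
              _ = 2 := by norm_num
        _ = (|a| / 2) ^ (γ - 2) := by rw [Real.div_rpow (abs_nonneg _) (by norm_num)]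
        _ ≤ |u| ^ (γ - 2) := Real.rpow_le_rpow (by positivity) hua2 (by linarith)
    have h4 := mul_le_mul_of_nonneg_right h3 (sq_nonneg v)
    have h5 : v ^ 2 = (b - a) ^ 2 / 4 := by rw [hv]; ring
    rw [h5] at h4 ⊢
    linarith
  · refine le_trans ?_ part1
    have hpos : 0 < |b - a| := (abs_nonneg a).trans_lt hba
    have e : |b - a| ^ γ = |b - a| ^ (γ - 2) * (b - a) ^ 2 := by
      rw [← sq_abs (b - a), ← Real.rpow_natCast, ← Real.rpow_add hpos]
      congr 1; push_cast; ring
    rw [e]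
    gcongr

/-- Combines the height `Y` above the graph with the Bregman distance `E` between the points of the graph
at horizontal distance `d`, for points at distance `N`. -/
lemma rpow_le_of_le_add {γ Y d E N : ℝ} (hγ : 2 < γ) (hγ3 : γ ≤ 3) (hY0 : 0 ≤ Y) (hY1 : Y ≤ 1)
    (hd0 : 0 ≤ d) (hN0 : 0 ≤ N) (hN : N ≤ Y + 3 * d) (hE : d ^ γ / 4 ≤ E) :
    N ^ γ ≤ 864 * (Y + E) := by
  have hm := (convexOn_rpow (show 1 ≤ γ by linarith)).2 (x := Y) (y := 3 * d) hY0
    (show (0 : ℝ) ≤ 3 * d by positivity)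
    (by norm_num : (0 : ℝ) ≤ 1 / 2) (by norm_num : (0 : ℝ) ≤ 1 / 2) (by norm_num)
  simp only [smul_eq_mul] at hm
  have hYγ : Y ^ γ ≤ Y := by
    calc Y ^ γ ≤ Y ^ (1 : ℝ) :=
          Real.rpow_le_rpow_of_exponent_ge_of_imp hY0 hY1 (by linarith) (by intros; linarith)
      _ = Y := Real.rpow_one Y
  have h3 : ∀ k : ℝ, 1 ≤ k → k ^ γ ≤ k ^ 3 := by
    intro k hk
    calc k ^ γ ≤ k ^ (3 : ℝ) := Real.rpow_le_rpow_of_exponent_le hk hγ3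
      _ = k ^ 3 := by norm_cast
  have h27 := h3 3 (by norm_num)
  have h8 := h3 2 (by norm_num)
  rw [Real.mul_rpow (by norm_num) hd0] at hm
  have hdγ : 0 ≤ d ^ γ := by positivity
  calc N ^ γ ≤ (Y + 3 * d) ^ γ := Real.rpow_le_rpow hN0 hN (by linarith)
    _ = 2 ^ γ * (1 / 2 * Y + 1 / 2 * (3 * d)) ^ γ := by
        rw [← Real.mul_rpow (by norm_num) (by positivity)]; congr 1; ring
    _ ≤ 2 ^ 3 * (1 / 2 * Y + 1 / 2 * (3 ^ 3 * d ^ γ)) := by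
        refine mul_le_mul h8 (hm.trans ?_) (by positivity) (by norm_num)
        gcongr
    _ ≤ 864 * (Y + E) := by linarith

/-- The quadratic variant of `rpow_le_of_le_add`, with weight `t` in the role of the curvature. -/
lemma mul_sq_le_of_le_add {t Y d E N : ℝ} (ht0 : 0 ≤ t) (ht1 : t ≤ 1) (hY0 : 0 ≤ Y) (hY1 : Y ≤ 1)
    (hN0 : 0 ≤ N) (hN : N ≤ Y + 3 * d) (hE : t * d ^ 2 / 4 ≤ E) :
    t * N ^ 2 ≤ 72 * (Y + E) := by
  have hNsq : N ^ 2 ≤ 2 * Y ^ 2 + 18 * d ^ 2 := by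
    have := pow_le_pow_left₀ hN0 hN 2
    nlinarith [sq_nonneg (Y - 3 * d)]
  have i1 : t * Y ^ 2 ≤ 1 * Y := by
    rw [sq]
    exact mul_le_mul ht1 (mul_le_of_le_one_left hY0 hY1) (mul_nonneg hY0 hY0) zero_le_one
  calc t * N ^ 2 ≤ t * (2 * Y ^ 2 + 18 * d ^ 2) := mul_le_mul_of_nonneg_left hNsq ht0
    _ = 2 * (t * Y ^ 2) + 18 * (t * d ^ 2) := by ring
    _ ≤ 72 * (Y + E) := by linarith

/-! ### Supporting lines of planar convex sets -/

/-- The point `z` of `C` maximizes the pairing with `ξ` over `C`. -/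
def IsSupportedAt (C : Set (ℝ × ℝ)) (ξ z : ℝ × ℝ) : Prop :=
  z ∈ C ∧ ∀ x ∈ C, planeDot ξ x ≤ planeDot ξ z

lemma planeDot_zero_right (ξ : ℝ × ℝ) : planeDot ξ 0 = 0 := by simp [planeDot]

lemma exists_planeDot_eq_norm (ξ : ℝ × ℝ) : ∃ u : ℝ × ℝ, ‖u‖ ≤ 1 ∧ planeDot ξ u = ‖ξ‖ := by
  have key : ∀ s : ℝ, ∃ v : ℝ, |v| ≤ 1 ∧ s * v = |s| := by
    intro s
    rcases le_total 0 s with h | h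
    · exact ⟨1, by simp, by rw [abs_of_nonneg h, mul_one]⟩
    · exact ⟨-1, by simp, by rw [abs_of_nonpos h]; ring⟩
  rcases max_choice ‖ξ.1‖ ‖ξ.2‖ with h | h
  · obtain ⟨v, hv, he⟩ := key ξ.1
    refine ⟨(v, 0), by simpa [Prod.norm_def] using hv, ?_⟩
    rw [Prod.norm_def, h, planeDot, Real.norm_eq_abs, ← he]; simp
  · obtain ⟨v, hv, he⟩ := key ξ.2
    refine ⟨(0, v), by simpa [Prod.norm_def] using hv, ?_⟩
    rw [Prod.norm_def, h, planeDot, Real.norm_eq_abs, ← he]; simp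

/-- A supporting line at `z` stays away from an interior ball. -/
lemma IsSupportedAt.mul_norm_le {C : Set (ℝ × ℝ)} {ξ z q : ℝ × ℝ} {r : ℝ} (hr : 0 ≤ r)
    (h : IsSupportedAt C ξ z) (hq : Metric.closedBall q r ⊆ C) :
    r * ‖ξ‖ ≤ planeDot ξ (z - q) := by
  obtain ⟨u, hu, he⟩ := exists_planeDot_eq_norm ξ
  have := h.2 (q + r • u) (hq ?_)
  · rw [planeDot_add, planeDot_smul, he] at this
    rw [planeDot_sub]; linarith
  · rw [Metric.mem_closedBall, dist_eq_norm, add_sub_cancel_left, norm_smul, Real.norm_of_nonneg hr]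
    exact mul_le_of_le_one_right hr hu

lemma IsSupportedAt.eq_zero_of_mem_interior {C : Set (ℝ × ℝ)} {ξ z : ℝ × ℝ}
    (h : IsSupportedAt C ξ z) (hz : z ∈ interior C) : ξ = 0 := by
  rw [mem_interior_iff_mem_nhds, Metric.nhds_basis_closedBall.mem_iff] at hz
  obtain ⟨r, hr, hsub⟩ := hz
  have := h.mul_norm_le hr.le hsub
  rw [sub_self, planeDot_zero_right] at this
  exact norm_le_zero_iff.1 (by nlinarith [norm_nonneg ξ])

lemma exists_isSupportedAt_of_mem_frontier {C : Set (ℝ × ℝ)} (hC : IsClosed C)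
    (hconv : Convex ℝ C) (hne : (interior C).Nonempty) {z : ℝ × ℝ} (hz : z ∈ frontier C) :
    ∃ ξ, ξ ≠ 0 ∧ IsSupportedAt C ξ z := by
  have hz' : z ∉ interior C := hz.2
  obtain ⟨f, hf⟩ := geometric_hahn_banach_open_point hconv.interior isOpen_interior hz'
  have hfd : ∀ x, f x = planeDot (f (1, 0), f (0, 1)) x := by
    intro x
    have : x = x.1 • ((1 : ℝ), (0 : ℝ)) + x.2 • ((0 : ℝ), (1 : ℝ)) := by ext <;> simp
    conv_lhs => rw [this]
    rw [map_add, map_smul, map_smul, planeDot]; simp [mul_comm]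
  refine ⟨(f (1, 0), f (0, 1)), ?_, hC.frontier_subset hz, fun x hx => ?_⟩
  · intro h0
    obtain ⟨y, hy⟩ := hne
    have := hf y hy
    rw [hfd y, hfd z, h0] at this
    simp at this
  · rw [← hfd, ← hfd]
    have hx' : x ∈ closure (interior C) := by
      rw [hconv.closure_interior_eq_closure_of_nonempty_interior hne]; exact subset_closure hx
    exact closure_minimal (fun y hy => (hf y hy).le) (isClosed_le f.continuous continuous_const) hx'

/-- The two quantitative forms of strict convexity of `C` at its boundary point `z` with outer
normal `ξ`, tested at the point `w`. The first holds uniformly in all directions, the second is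
stronger for directions away from the vertical one. -/
def StrictConvexBound (γ c : ℝ) (ξ z w : ℝ × ℝ) : Prop :=
  c * ‖ξ‖ * ‖z - w‖ ^ γ ≤ planeDot ξ (z - w) ∧
    c * √(|ξ.1| * ‖ξ‖) * ‖z - w‖ ^ 2 ≤ planeDot ξ (z - w)

lemma StrictConvexBound.mono {γ c c' : ℝ} {ξ z w : ℝ × ℝ} (h : StrictConvexBound γ c ξ z w)
    (hc : c' ≤ c) : StrictConvexBound γ c' ξ z w :=
  ⟨le_trans (by gcongr) h.1, le_trans (by gcongr) h.2⟩

lemma strictConvexBound_zero (γ c : ℝ) (z w : ℝ × ℝ) : StrictConvexBound γ c 0 z w := by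
  simp [StrictConvexBound]

/-! ### Convexity along the graph of the power function -/

section Graph

variable {γ : ℝ} {C U : Set (ℝ × ℝ)}

/-- At a point of the graph of `|x| ^ γ` the only normal direction is the downward normal of the graph. -/
lemma isSupportedAt_graph (hγ : 2 < γ) (hγ3 : γ ≤ 3) (hU : IsOpen U)
    (hgraph : {z : ℝ × ℝ | z.2 = |z.1| ^ γ} ∩ U ⊆ C) {ξ z : ℝ × ℝ} (hξ : ξ ≠ 0) (hzU : z ∈ U)
    (hz : z.2 = |z.1| ^ γ) (h : IsSupportedAt C ξ z) :
    ξ.2 < 0 ∧ ξ.1 = -ξ.2 * (γ * |z.1| ^ (γ - 2) * z.1) := by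
  have hcont : Continuous fun b : ℝ => (b, |b| ^ γ) := by
    refine continuous_id.prodMk ?_
    exact continuous_abs.rpow_const fun _ => Or.inr (by linarith)
  have hz' : (z.1, |z.1| ^ γ) = z := by rw [← hz]
  have hnhds : ∀ᶠ b in 𝓝 z.1, (b, |b| ^ γ) ∈ U :=
    hcont.continuousAt.eventually (by
      change U ∈ 𝓝 (z.1, |z.1| ^ γ)
      rw [hz']; exact hU.mem_nhds hzU)
  have hle : ∀ᶠ b in 𝓝 z.1, ξ.1 * b + ξ.2 * |b| ^ γ ≤ ξ.1 * z.1 + ξ.2 * |z.1| ^ γ := by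
    filter_upwards [hnhds] with b hb
    have := h.2 _ (hgraph ⟨rfl, hb⟩)
    simpa [planeDot, hz] using this
  have hder : HasDerivAt (fun b => ξ.1 * b + ξ.2 * |b| ^ γ)
      (ξ.1 * 1 + ξ.2 * (γ * |z.1| ^ (γ - 2) * z.1)) z.1 :=
    ((hasDerivAt_id z.1).const_mul _).add ((hasDerivAt_abs_rpow z.1 (by linarith)).const_mul _)
  have h0 : ξ.1 * 1 + ξ.2 * (γ * |z.1| ^ (γ - 2) * z.1) = 0 :=
    IsLocalMax.hasDerivAt_eq_zero hle hder
  have h1 : ξ.1 = -ξ.2 * (γ * |z.1| ^ (γ - 2) * z.1) := by linarith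
  refine ⟨?_, h1⟩
  have hne : ξ.2 ≠ 0 := by
    intro h2
    refine hξ (Prod.ext ?_ h2)
    rw [h1, h2]; simp
  refine lt_of_le_of_ne ?_ hne
  obtain ⟨δ, hδ, hball⟩ := Metric.eventually_nhds_iff.1 hle
  have hb := hball (y := z.1 + δ / 2) (by
    rw [Real.dist_eq, add_sub_cancel_left, abs_of_pos (by linarith)]; linarith)
  have hbreg := (abs_rpow_bregman hγ hγ3 z.1 (z.1 + δ / 2)).1
  rw [add_sub_cancel_left] at hbreg
  have hpos : 0 < |δ / 2| ^ γ / 4 := by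
    have : 0 < |δ / 2| := abs_pos.2 (by linarith)
    positivity
  by_contra hcon
  rw [not_le] at hcon
  rw [h1] at hb
  have := mul_pos hcon (hpos.trans_le hbreg)
  nlinarith

/-- Strict convexity near a point of the graph of `|x| ^ γ`, with a constant independent of the
distance to the flat point. -/
lemma strictConvexBound_graph (hγ : 2 < γ) (hγ3 : γ ≤ 3) (hC : IsClosed C) (hconv : Convex ℝ C)
    (hne : (interior C).Nonempty)
    (hsq : C ⊆ Set.Ioo (-1 / 2 : ℝ) (1 / 2) ×ˢ Set.Ioo (-1 / 2 : ℝ) (1 / 2)) (hU : IsOpen U)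
    (hgraph : frontier C ∩ U = {z : ℝ × ℝ | z.2 = |z.1| ^ γ} ∩ U) {ξ z w : ℝ × ℝ}
    (hzU : z ∈ U) (h : IsSupportedAt C ξ z) (hw : w ∈ C) (hwU : (w.1, |w.1| ^ γ) ∈ U) :
    StrictConvexBound γ (1 / 2592) ξ z w := by
  rcases eq_or_ne ξ 0 with rfl | hξ
  · exact strictConvexBound_zero _ _ _ _
  have hgC : {z : ℝ × ℝ | z.2 = |z.1| ^ γ} ∩ U ⊆ C := by
    rw [← hgraph]; exact fun x hx => hC.frontier_subset hx.1
  have hzf : z ∈ frontier C := by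
    refine ⟨subset_closure h.1, fun hi => hξ (h.eq_zero_of_mem_interior hi)⟩
  have hz : z.2 = |z.1| ^ γ := (hgraph.le ⟨hzf, hzU⟩).1
  obtain ⟨hξ2, hξ1⟩ := isSupportedAt_graph hγ hγ3 hU hgC hξ hzU hz h
  -- `C` lies above the graph
  have habove : |w.1| ^ γ ≤ w.2 := by
    have hf : (w.1, |w.1| ^ γ) ∈ frontier C := (hgraph.ge ⟨rfl, hwU⟩).1
    obtain ⟨η, hη, hsup⟩ := exists_isSupportedAt_of_mem_frontier hC hconv hne hf
    have hη2 := (isSupportedAt_graph hγ hγ3 hU hgC hη hwU rfl hsup).1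
    have := hsup.2 w hw
    simp only [planeDot] at this
    nlinarith
  obtain ⟨a, za⟩ := z
  obtain ⟨b, y⟩ := w
  simp only at hz hξ1 habove hwU
  subst hz
  have hzs := hsq h.1
  have hws := hsq hw
  simp only [Set.mem_prod, Set.mem_Ioo] at hzs hws
  have ha1 : |a| ≤ 1 := by rw [abs_le]; constructor <;> linarith [hzs.1.1, hzs.1.2]
  have hb1 : |b| ≤ 1 := by rw [abs_le]; constructor <;> linarith [hws.1.1, hws.1.2]
  set n := -ξ.2 with hn
  have hnpos : 0 < n := by linarith
  set Y := y - |b| ^ γ with hY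
  have hY0 : 0 ≤ Y := by linarith
  have hY1 : Y ≤ 1 := by
    have : 0 ≤ |b| ^ γ := by positivity
    linarith [hws.2.2]
  obtain ⟨hE1, hE2⟩ := abs_rpow_bregman hγ hγ3 a b
  set E := |b| ^ γ - |a| ^ γ - γ * |a| ^ (γ - 2) * a * (b - a) with hE
  have hdot : planeDot ξ ((a, |a| ^ γ) - (b, y)) = n * (Y + E) := by
    simp only [planeDot, Prod.mk_sub_mk]
    rw [hξ1, hE, hY, hn]; ring
  have hslope : ∀ x : ℝ, |x| ≤ 1 → |γ * |x| ^ (γ - 2) * x| ≤ 3 := by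
    intro x hx
    have h1 : |x| ^ (γ - 2) ≤ 1 := Real.rpow_le_one (abs_nonneg _) hx (by linarith)
    have h0 : 0 ≤ |x| ^ (γ - 2) := by positivity
    rw [abs_mul, abs_mul, abs_of_pos (by linarith : 0 < γ), abs_of_nonneg h0]
    calc γ * |x| ^ (γ - 2) * |x| ≤ 3 * 1 * 1 := by gcongr
      _ = 3 := by norm_num
  have hξn : ‖ξ‖ ≤ 3 * n := by
    rw [Prod.norm_def]
    refine max_le ?_ ?_
    · rw [hξ1, Real.norm_eq_abs, abs_mul, abs_of_pos hnpos, mul_comm]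
      gcongr; exact hslope a ha1
    · rw [Real.norm_eq_abs, abs_of_neg hξ2]; linarith
  set d := |b - a| with hd
  have hd0 : 0 ≤ d := abs_nonneg _
  have hlip : ∀ x x' : ℝ, |x| ≤ 1 → |x' - x| = d → |x| ^ γ - |x'| ^ γ ≤ 3 * d := by
    intro x x' hx hxd
    have h1 := abs_rpow_tangent_le hγ x x'
    have h2 : |γ * |x| ^ (γ - 2) * x * (x' - x)| ≤ 3 * d := by
      rw [abs_mul, hxd]; gcongr; exact hslope x hx
    linarith [(abs_le.1 h2).1]
  have hnorm : ‖((a, |a| ^ γ) : ℝ × ℝ) - (b, y)‖ ≤ Y + 3 * d := by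
    rw [Prod.mk_sub_mk, Prod.norm_def]
    refine max_le ?_ ?_
    · rw [Real.norm_eq_abs, abs_sub_comm]; linarith
    · rw [Real.norm_eq_abs, abs_le]
      have l1 := hlip a b ha1 rfl
      have l2 := hlip b a hb1 (abs_sub_comm _ _)
      constructor <;> linarith
  set N := ‖((a, |a| ^ γ) : ℝ × ℝ) - (b, y)‖ with hN
  have hN0 : 0 ≤ N := norm_nonneg _
  have hEnn : 0 ≤ E := le_trans (by positivity) hE1
  rw [StrictConvexBound, hdot]
  constructor
  · have h1 := rpow_le_of_le_add hγ hγ3 hY0 hY1 hd0 hN0 hnorm hE1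
    have h2 := mul_le_mul hξn h1 (Real.rpow_nonneg hN0 γ) (by positivity)
    linarith
  · have hsqrt : √(|ξ.1| * ‖ξ‖) ≤ 3 * n * |a| ^ (γ - 2) := by
      rcases eq_or_ne a 0 with rfl | ha
      · rw [hξ1]; simp; positivity
      have hapos : 0 < |a| := abs_pos.2 ha
      rw [Real.sqrt_le_left (by positivity)]
      have h1 : |ξ.1| ≤ 3 * n * |a| ^ (γ - 1) := by
        rw [hξ1, abs_mul, abs_of_pos hnpos, abs_mul, abs_mul, abs_of_pos (by linarith : 0 < γ),
          abs_of_nonneg (by positivity : 0 ≤ |a| ^ (γ - 2)), mul_assoc γ,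
          ← Real.rpow_add_one hapos.ne']
        rw [show γ - 2 + 1 = γ - 1 by ring]
        have : 0 ≤ |a| ^ (γ - 1) := by positivity
        nlinarith [mul_nonneg hnpos.le this]
      -- here `γ ≤ 3` enters, as `2 * (γ - 2) ≤ γ - 1`
      have h2 : |a| ^ (γ - 1) ≤ (|a| ^ (γ - 2)) ^ 2 := by
        rw [← Real.rpow_natCast, ← Real.rpow_mul (abs_nonneg _)]
        refine Real.rpow_le_rpow_of_exponent_ge hapos ha1 ?_
        push_cast; linarith
      calc |ξ.1| * ‖ξ‖ ≤ (3 * n * |a| ^ (γ - 1)) * (3 * n) :=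
            mul_le_mul h1 hξn (norm_nonneg _) (by positivity)
        _ ≤ (3 * n * (|a| ^ (γ - 2)) ^ 2) * (3 * n) := by gcongr
        _ = _ := by ring
    have ht1 : |a| ^ (γ - 2) ≤ 1 := Real.rpow_le_one (abs_nonneg _) ha1 (by linarith)
    have ht0 : 0 ≤ |a| ^ (γ - 2) := by positivity
    have h3 := mul_sq_le_of_le_add (E := E) ht0 ht1 hY0 hY1 hN0 hnorm (by rwa [hd, sq_abs])
    have h4 := mul_le_mul_of_nonneg_right hsqrt (sq_nonneg N)
    have h5 := mul_le_mul_of_nonneg_left h3 hnpos.le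
    have h6 : 0 ≤ n * (Y + E) := mul_nonneg hnpos.le (add_nonneg hY0 hEnn)
    linarith

end Graph

/-! ### Strict convexity near points of positive curvature -/

/-- Taylor's formula of order two with Lagrange remainder, on an open interval. -/
lemma exists_eq_taylor_two {ψ ψ' ψ'' : ℝ → ℝ} {η s τ : ℝ}
    (h1 : ∀ u ∈ Set.Ioo (-η) η, HasDerivAt ψ (ψ' u) u)
    (h2 : ∀ u ∈ Set.Ioo (-η) η, HasDerivAt ψ' (ψ'' u) u) (hs : s ∈ Set.Ioo (-η) η)
    (hτ : τ ∈ Set.Ioo (-η) η) :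
    ∃ σ ∈ Set.Ioo (-η) η, ψ s = ψ τ + ψ' τ * (s - τ) + ψ'' σ / 2 * (s - τ) ^ 2 := by
  rcases eq_or_ne s τ with rfl | hne
  · exact ⟨s, hs, by ring⟩
  have hst : s - τ ≠ 0 := sub_ne_zero.2 hne
  set K : ℝ := (ψ s - ψ τ - ψ' τ * (s - τ)) / (s - τ) ^ 2 with hK
  have hKe : K * (s - τ) ^ 2 = ψ s - ψ τ - ψ' τ * (s - τ) := by rw [hK]; field_simp
  set G : ℝ → ℝ := fun u => ψ s - ψ u - ψ' u * (s - u) - K * (s - u) ^ 2 with hG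
  have hGs : G s = 0 := by simp [hG]
  have hGτ : G τ = 0 := by simp only [hG]; rw [hKe]; ring
  have hGd : ∀ u ∈ Set.Ioo (-η) η, HasDerivAt G ((2 * K - ψ'' u) * (s - u)) u := by
    intro u hu
    have hsu : HasDerivAt (fun u => s - u) (-1) u := by
      simpa using (hasDerivAt_id u).const_sub s
    have := (((h1 u hu).const_sub (ψ s)).sub ((h2 u hu).mul hsu)).sub ((hsu.pow 2).const_mul K)
    refine this.congr_deriv ?_
    simp; ring
  have rolle : ∀ a b, a < b → a ∈ Set.Ioo (-η) η → b ∈ Set.Ioo (-η) η → G a = G b →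
      (∀ u ∈ Set.Ioo a b, u ≠ s) → ∃ σ ∈ Set.Ioo (-η) η, K = ψ'' σ / 2 := by
    intro a b hab ha hb he hns
    have hsub : Set.Icc a b ⊆ Set.Ioo (-η) η := fun u hu =>
      ⟨ha.1.trans_le hu.1, hu.2.trans_lt hb.2⟩
    obtain ⟨σ, hσ, h0⟩ := exists_hasDerivAt_eq_zero hab
      (fun u hu => (hGd u (hsub hu)).continuousAt.continuousWithinAt) he
      (fun u hu => hGd u (hsub (Set.Ioo_subset_Icc_self hu)))
    refine ⟨σ, hsub (Set.Ioo_subset_Icc_self hσ), ?_⟩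
    rcases mul_eq_zero.1 h0 with h | h
    · linarith
    · exact absurd (by linarith) (hns σ hσ)
  have : ∃ σ ∈ Set.Ioo (-η) η, K = ψ'' σ / 2 := by
    rcases lt_or_gt_of_ne hne with h | h
    · exact rolle s τ h hs hτ (by rw [hGs, hGτ]) fun u hu => hu.1.ne'
    · exact rolle τ s h hτ hs (by rw [hGs, hGτ]) fun u hu => hu.2.ne
  obtain ⟨σ, hσ, hKσ⟩ := this
  refine ⟨σ, hσ, ?_⟩
  rw [← hKσ, hKe]; ring

/-- A boundary curve of `C` is orthogonal to the normals of `C`. -/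
lemma IsSupportedAt.deriv_eq_zero {C : Set (ℝ × ℝ)} {x y : ℝ → ℝ} {ξ : ℝ × ℝ} {τ x' y' : ℝ}
    (hx : HasDerivAt x x' τ) (hy : HasDerivAt y y' τ) (hmem : ∀ᶠ s in 𝓝 τ, (x s, y s) ∈ C)
    (h : IsSupportedAt C ξ (x τ, y τ)) : ξ.1 * x' + ξ.2 * y' = 0 := by
  have hder : HasDerivAt (fun s => planeDot ξ (x s, y s)) (ξ.1 * x' + ξ.2 * y') τ :=
    (hx.const_mul _).add (hy.const_mul _)
  refine IsLocalMax.hasDerivAt_eq_zero ?_ hder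
  filter_upwards [hmem] with s hs
  exact h.2 _ hs

/-- Along a boundary curve with nonvanishing curvature the boundary leaves its tangent lines
quadratically. -/
lemma planeDot_curve_sub_ge {C : Set (ℝ × ℝ)} {x y x' y' x'' y'' : ℝ → ℝ} {η k L : ℝ}
    (hx : ∀ u ∈ Set.Ioo (-η) η, HasDerivAt x (x' u) u)
    (hy : ∀ u ∈ Set.Ioo (-η) η, HasDerivAt y (y' u) u)
    (hx' : ∀ u ∈ Set.Ioo (-η) η, HasDerivAt x' (x'' u) u)
    (hy' : ∀ u ∈ Set.Ioo (-η) η, HasDerivAt y' (y'' u) u)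
    (hmem : ∀ u ∈ Set.Ioo (-η) η, (x u, y u) ∈ C) (hL : 0 < L)
    (hxL : ∀ u ∈ Set.Ioo (-η) η, |x' u| ≤ L) (hyL : ∀ u ∈ Set.Ioo (-η) η, |y' u| ≤ L)
    (hk : ∀ u ∈ Set.Ioo (-η) η, ∀ v ∈ Set.Ioo (-η) η, k ≤ |x' u * y'' v - y' u * x'' v|)
    {ξ : ℝ × ℝ} {s τ : ℝ} (hs : s ∈ Set.Ioo (-η) η) (hτ : τ ∈ Set.Ioo (-η) η)
    (h : IsSupportedAt C ξ (x τ, y τ)) :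
    k / (2 * L) * ‖ξ‖ * (s - τ) ^ 2 ≤ planeDot ξ ((x τ, y τ) - (x s, y s)) := by
  have horth := h.deriv_eq_zero (hx τ hτ) (hy τ hτ)
    (Filter.eventually_of_mem (isOpen_Ioo.mem_nhds hτ) hmem)
  obtain ⟨σ, hσ, hT⟩ := exists_eq_taylor_two (ψ := fun u => ξ.1 * x u + ξ.2 * y u)
    (ψ' := fun u => ξ.1 * x' u + ξ.2 * y' u) (ψ'' := fun u => ξ.1 * x'' u + ξ.2 * y'' u)
    (fun u hu => ((hx u hu).const_mul _).add ((hy u hu).const_mul _))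
    (fun u hu => ((hx' u hu).const_mul _).add ((hy' u hu).const_mul _)) hs hτ
  rw [horth, zero_mul, add_zero] at hT
  set P := ξ.1 * x'' σ + ξ.2 * y'' σ with hP
  have hle := h.2 _ (hmem s hs)
  have hdot : planeDot ξ ((x τ, y τ) - (x s, y s)) = -(P / 2 * (s - τ) ^ 2) := by
    simp only [planeDot, Prod.mk_sub_mk]; linarith
  -- both components of `ξ` are controlled by the second derivative
  have hkP : k * ‖ξ‖ ≤ L * |P| := by
    have e1 : ξ.1 * (x' τ * y'' σ - y' τ * x'' σ) = -(y' τ) * P := by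
      rw [hP]; linear_combination y'' σ * horth
    have e2 : ξ.2 * (x' τ * y'' σ - y' τ * x'' σ) = x' τ * P := by
      rw [hP]; linear_combination -x'' σ * horth
    have hkk := hk τ hτ σ hσ
    have f1 : |ξ.1| * |x' τ * y'' σ - y' τ * x'' σ| = |y' τ| * |P| := by
      rw [← abs_mul, e1, abs_mul, abs_neg]
    have f2 : |ξ.2| * |x' τ * y'' σ - y' τ * x'' σ| = |x' τ| * |P| := by
      rw [← abs_mul, e2, abs_mul]
    rcases max_choice ‖ξ.1‖ ‖ξ.2‖ with hm | hm
    · rw [Prod.norm_def, hm, Real.norm_eq_abs, mul_comm]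
      calc |ξ.1| * k ≤ _ := mul_le_mul_of_nonneg_left hkk (abs_nonneg _)
        _ = _ := f1
        _ ≤ _ := mul_le_mul_of_nonneg_right (hyL τ hτ) (abs_nonneg _)
    · rw [Prod.norm_def, hm, Real.norm_eq_abs, mul_comm]
      calc |ξ.2| * k ≤ _ := mul_le_mul_of_nonneg_left hkk (abs_nonneg _)
        _ = _ := f2
        _ ≤ _ := mul_le_mul_of_nonneg_right (hxL τ hτ) (abs_nonneg _)
  have hnn : 0 ≤ planeDot ξ ((x τ, y τ) - (x s, y s)) := by
    rw [planeDot_sub]; linarith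
  have habs : planeDot ξ ((x τ, y τ) - (x s, y s)) = |P| / 2 * (s - τ) ^ 2 := by
    rw [← abs_of_nonneg hnn, hdot, abs_neg, abs_mul, abs_div, abs_two, abs_of_nonneg (sq_nonneg (s - τ))]
  rw [habs]
  have : k / (2 * L) * ‖ξ‖ ≤ |P| / 2 := by
    rw [div_mul_eq_mul_div, div_le_div_iff₀ (by positivity) (by norm_num)]; nlinarith
  exact mul_le_mul_of_nonneg_right this (sq_nonneg _)

/-- Strict convexity near a boundary point of nonvanishing curvature. -/
lemma exists_strictConvexBound_of_smoothCurveAt {γ κ : ℝ} {C : Set (ℝ × ℝ)} (hγ : 2 ≤ γ)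
    (hκ : 0 < κ) (hC : IsClosed C) (hconv : Convex ℝ C) (hne : (interior C).Nonempty)
    (hdiam : ∀ z ∈ C, ∀ w ∈ C, ‖z - w‖ ≤ 1) {z₀ : ℝ × ℝ} (hz₀ : z₀ ∈ frontier C)
    (hsm : SmoothCurveAtWithCurvatureGE (frontier C) z₀ κ) :
    ∃ c : ℝ, 0 < c ∧ ∃ W ∈ 𝓝 z₀, ∀ ξ z w : ℝ × ℝ, z ∈ W → IsSupportedAt C ξ z → w ∈ C → w ∈ W →
      StrictConvexBound γ c ξ z w := by
  obtain ⟨V, hV, δ, hδ, x, y, hxC, hyC, hvel, h0, himg, hcurv⟩ := hsm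
  set I := Set.Ioo (-δ) δ with hI
  have hIo : IsOpen I := isOpen_Ioo
  have h0I : (0 : ℝ) ∈ I := ⟨by linarith, hδ⟩
  have d1 : ∀ f : ℝ → ℝ, ContDiffOn ℝ ∞ f I → ContDiffOn ℝ ∞ (deriv f) I := fun f hf =>
    hf.deriv_of_isOpen hIo (by simp)
  have hder : ∀ f : ℝ → ℝ, ContDiffOn ℝ ∞ f I → ∀ u ∈ I, HasDerivAt f (deriv f u) u :=
    fun f hf u hu => ((hf.differentiableOn (by simp)).differentiableAt (hIo.mem_nhds hu)).hasDerivAt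
  have hcts : ∀ f : ℝ → ℝ, ContDiffOn ℝ ∞ f I → ContinuousAt f 0 := fun f hf =>
    hf.continuousOn.continuousAt (hIo.mem_nhds h0I)
  have hXF : ∀ u ∈ I, (x u, y u) ∈ frontier C := fun u hu => (himg.le ⟨u, hu, rfl⟩).1
  have hXC : ∀ u ∈ I, (x u, y u) ∈ C := fun u hu => hC.frontier_subset (hXF u hu)
  obtain ⟨q, hq⟩ := hne
  have hq' := hq
  rw [mem_interior_iff_mem_nhds, Metric.nhds_basis_closedBall.mem_iff] at hq'
  obtain ⟨r, hr, hqr⟩ := hq'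
  have hqC : q ∈ C := interior_subset hq
  have hz₀C : z₀ ∈ C := hC.frontier_subset hz₀
  set e := q - z₀ with he
  have he1 : ‖e‖ ≤ 1 := hdiam q hqC z₀ hz₀C
  -- supporting normals near `z₀` are transversal to `e`
  have htrans : ∀ ξ z, IsSupportedAt C ξ z → ‖z - z₀‖ ≤ r / 4 → planeDot ξ e ≤ -(r / 2 * ‖ξ‖) := by
    intro ξ z h hz
    have h1 := h.mul_norm_le hr.le hqr
    have h2 := le_of_abs_le (abs_planeDot_le ξ (z - z₀))
    have h3 : 2 * ‖ξ‖ * ‖z - z₀‖ ≤ 2 * ‖ξ‖ * (r / 4) := by gcongr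
    rw [planeDot_sub] at h1 h2
    rw [he, planeDot_sub]
    linarith
  have hsupp : ∀ z ∈ frontier C, ∃ ξ, ξ ≠ 0 ∧ IsSupportedAt C ξ z := fun z hz =>
    exists_isSupportedAt_of_mem_frontier hC hconv ⟨q, hq⟩ hz
  set k₀ := |deriv x 0 * deriv (deriv y) 0 - deriv y 0 * deriv (deriv x) 0| with hk₀
  have hk₀pos : 0 < k₀ := by
    rw [hk₀, abs_pos]
    intro hz
    rw [planeCurvature, hz, zero_div, abs_zero] at hcurv
    linarith
  set L := max |deriv x 0| |deriv y 0| + 1 with hL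
  have hLpos : 0 < L := by
    have : 0 ≤ max |deriv x 0| |deriv y 0| := le_max_of_le_left (abs_nonneg _)
    linarith
  have ev1 : ∀ᶠ p : ℝ × ℝ in 𝓝 (0, 0), k₀ / 2 <
      |deriv x p.1 * deriv (deriv y) p.2 - deriv y p.1 * deriv (deriv x) p.2| := by
    have c1 : ContinuousAt (fun p : ℝ × ℝ => deriv x p.1) (0, 0) :=
      (hcts _ (d1 x hxC)).comp_of_eq continuousAt_fst rfl
    have c2 : ContinuousAt (fun p : ℝ × ℝ => deriv (deriv y) p.2) (0, 0) :=
      (hcts _ (d1 _ (d1 y hyC))).comp_of_eq continuousAt_snd rfl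
    have c3 : ContinuousAt (fun p : ℝ × ℝ => deriv y p.1) (0, 0) :=
      (hcts _ (d1 y hyC)).comp_of_eq continuousAt_fst rfl
    have c4 : ContinuousAt (fun p : ℝ × ℝ => deriv (deriv x) p.2) (0, 0) :=
      (hcts _ (d1 _ (d1 x hxC))).comp_of_eq continuousAt_snd rfl
    exact ((c1.mul c2).sub (c3.mul c4)).abs.eventually_const_lt (half_lt_self hk₀pos)
  have ev2 : ∀ᶠ u in 𝓝 (0 : ℝ), |deriv x u| < L ∧ |deriv y u| < L := by
    refine Filter.Eventually.and ?_ ?_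
    · exact (hcts _ (d1 x hxC)).abs.eventually_lt_const
        (lt_of_le_of_lt (le_max_left _ _) (lt_add_one _))
    · exact (hcts _ (d1 y hyC)).abs.eventually_lt_const
        (lt_of_le_of_lt (le_max_right _ _) (lt_add_one _))
  have ev3 : ∀ᶠ u in 𝓝 (0 : ℝ), ‖(x u, y u) - z₀‖ < r / 4 := by
    have c : ContinuousAt (fun u => ‖(x u, y u) - z₀‖) 0 :=
      (((hcts x hxC).prodMk (hcts y hyC)).sub continuousAt_const).norm
    refine c.eventually_lt_const ?_
    change ‖(x 0, y 0) - z₀‖ < r / 4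
    rw [h0, sub_self, norm_zero]; linarith
  obtain ⟨η₁, hη₁, hb1⟩ := Metric.eventually_nhds_iff.1 ev1
  obtain ⟨η₂, hη₂, hb2⟩ := Metric.eventually_nhds_iff.1 (ev2.and ev3)
  set η := min δ (min η₁ η₂) with hη
  have hηpos : 0 < η := lt_min hδ (lt_min hη₁ hη₂)
  have hηI : Set.Ioo (-η) η ⊆ I :=
    Set.Ioo_subset_Ioo (neg_le_neg (min_le_left _ _)) (min_le_left _ _)
  have hη0 : ∀ u ∈ Set.Ioo (-η) η, |u| < η₁ ∧ |u| < η₂ := by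
    intro u hu
    have : |u| < η := abs_lt.2 hu
    exact ⟨this.trans_le ((min_le_right _ _).trans (min_le_left _ _)),
      this.trans_le ((min_le_right _ _).trans (min_le_right _ _))⟩
  have hk : ∀ u ∈ Set.Ioo (-η) η, ∀ v ∈ Set.Ioo (-η) η,
      k₀ / 2 ≤ |deriv x u * deriv (deriv y) v - deriv y u * deriv (deriv x) v| := by
    intro u hu v hv
    refine (hb1 (y := (u, v)) ?_).le
    rw [Prod.dist_eq, Real.dist_eq, Real.dist_eq, sub_zero, sub_zero]
    exact max_lt (hη0 u hu).1 (hη0 v hv).1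
  have hb2' : ∀ u ∈ Set.Ioo (-η) η, (|deriv x u| < L ∧ |deriv y u| < L) ∧
      ‖(x u, y u) - z₀‖ < r / 4 := by
    intro u hu
    refine hb2 ?_
    rw [Real.dist_eq, sub_zero]; exact (hη0 u hu).2
  -- the curve covers a neighbourhood of `z₀` in the direction transversal to `e`
  set g : ℝ → ℝ := fun u => x u * e.2 - y u * e.1 with hg
  have hgd : HasStrictDerivAt g (deriv x 0 * e.2 - deriv y 0 * e.1) 0 := by
    have hs : ∀ f : ℝ → ℝ, ContDiffOn ℝ ∞ f I → HasStrictDerivAt f (deriv f 0) 0 := fun f hf =>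
      (hf.contDiffAt (hIo.mem_nhds h0I)).hasStrictDerivAt (by simp)
    exact ((hs x hxC).mul_const _).sub ((hs y hyC).mul_const _)
  have hgd0 : deriv x 0 * e.2 - deriv y 0 * e.1 ≠ 0 := by
    intro hz
    obtain ⟨ξ, hξ, hs⟩ := hsupp z₀ hz₀
    have ht := htrans ξ z₀ hs (by rw [sub_self, norm_zero]; linarith)
    have hξn : 0 < ‖ξ‖ := norm_pos_iff.2 hξ
    have hneg : ξ.1 * e.1 + ξ.2 * e.2 ≠ 0 := by
      have : planeDot ξ e < 0 := lt_of_le_of_lt ht (by have := mul_pos hr hξn; linarith)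
      exact this.ne
    rw [← h0] at hs
    have horth := hs.deriv_eq_zero (hder x hxC 0 h0I) (hder y hyC 0 h0I)
      (Filter.eventually_of_mem (hIo.mem_nhds h0I) hXC)
    refine hvel 0 h0I (Prod.ext ?_ ?_)
    · refine (mul_eq_zero.1 (?_ : deriv x 0 * (ξ.1 * e.1 + ξ.2 * e.2) = 0)).resolve_right hneg
      linear_combination ξ.2 * hz + e.1 * horth
    · refine (mul_eq_zero.1 (?_ : deriv y 0 * (ξ.1 * e.1 + ξ.2 * e.2) = 0)).resolve_right hneg
      linear_combination -ξ.1 * hz + e.2 * horth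
  have hgim : g '' Set.Ioo (-η) η ∈ 𝓝 (g 0) := by
    rw [← hgd.map_nhds_eq hgd0]
    exact Filter.image_mem_map (isOpen_Ioo.mem_nhds ⟨by linarith, hηpos⟩)
  set ℓ : ℝ × ℝ → ℝ := fun p => p.1 * e.2 - p.2 * e.1 with hℓ
  have hℓg : ℓ z₀ = g 0 := by rw [← h0]
  set W := Metric.ball z₀ (r / 4) ∩ ℓ ⁻¹' (g '' Set.Ioo (-η) η) with hW
  have hWn : W ∈ 𝓝 z₀ := by
    refine Filter.inter_mem (Metric.ball_mem_nhds _ (by linarith)) ?_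
    have : Continuous ℓ := by fun_prop
    exact this.continuousAt.preimage_mem_nhds (by rw [hℓg]; exact hgim)
  have hene : e.1 ^ 2 + e.2 ^ 2 ≠ 0 := by
    intro hz
    have h1 : e.1 = 0 := by nlinarith [sq_nonneg e.1, sq_nonneg e.2]
    have h2 : e.2 = 0 := by nlinarith [sq_nonneg e.1, sq_nonneg e.2]
    have : q = z₀ := sub_eq_zero.1 (Prod.ext h1 h2)
    rw [this] at hq
    exact hz₀.2 hq
  have hrep : ∀ w ∈ C, w ∈ W → ∃ s ∈ Set.Ioo (-η) η, ∃ t : ℝ, 0 ≤ t ∧ w = (x s, y s) + t • e := by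
    intro w hw hwW
    obtain ⟨s, hs, hgs⟩ := hwW.2
    simp only [hg, hℓ] at hgs
    set t := ((w.1 - x s) * e.1 + (w.2 - y s) * e.2) / (e.1 ^ 2 + e.2 ^ 2) with ht
    have hwt : w = (x s, y s) + t • e := by
      refine Prod.ext ?_ ?_
      · simp only [Prod.fst_add, Prod.smul_fst, smul_eq_mul]
        rw [ht]; field_simp; linear_combination -e.2 * hgs
      · simp only [Prod.snd_add, Prod.smul_snd, smul_eq_mul]
        rw [ht]; field_simp; linear_combination e.1 * hgs
    refine ⟨s, hs, t, ?_, hwt⟩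
    obtain ⟨ξ, hξ, hsup⟩ := hsupp _ (hXF s (hηI hs))
    have htr := htrans ξ _ hsup (hb2' s hs).2.le
    have hle := hsup.2 w hw
    rw [hwt, planeDot_add, planeDot_smul] at hle
    have hξn : 0 < ‖ξ‖ := norm_pos_iff.2 hξ
    have := mul_pos hr hξn
    by_contra hneg
    rw [not_le] at hneg
    nlinarith
  set c := min (k₀ / 2 / (2 * L) / (2 * L ^ 2)) (r / 4) with hc
  have hcpos : 0 < c := lt_min (by positivity) (by linarith)
  refine ⟨c, hcpos, W, hWn, fun ξ z w hzW hsup hw hwW => ?_⟩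
  rcases eq_or_ne ξ 0 with rfl | hξ
  · exact strictConvexBound_zero _ _ _ _
  have hξn : 0 < ‖ξ‖ := norm_pos_iff.2 hξ
  have htr := htrans ξ z hsup (by
    have := hzW.1; rw [Metric.mem_ball, dist_eq_norm] at this; exact this.le)
  obtain ⟨τ, hτ, t', ht', hzt⟩ := hrep z hsup.1 hzW
  obtain ⟨s, hs, t, ht, hwt⟩ := hrep w hw hwW
  -- a maximizer lies on the curve
  have hzX : z = (x τ, y τ) := by
    have hle := hsup.2 _ (hXC τ (hηI hτ))
    rw [hzt, planeDot_add, planeDot_smul] at hle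
    have : t' = 0 := by
      by_contra hne'
      have : 0 < t' := lt_of_le_of_ne ht' (Ne.symm hne')
      have := mul_pos hr hξn
      nlinarith
    rw [hzt, this, zero_smul, add_zero]
  have hsup' := hsup
  rw [hzX] at hsup'
  have hquad := planeDot_curve_sub_ge (fun u hu => hder x hxC u (hηI hu))
    (fun u hu => hder y hyC u (hηI hu)) (fun u hu => hder _ (d1 x hxC) u (hηI hu))
    (fun u hu => hder _ (d1 y hyC) u (hηI hu)) (fun u hu => hXC u (hηI hu)) hLpos
    (fun u hu => (hb2' u hu).1.1.le) (fun u hu => (hb2' u hu).1.2.le) hk hs hτ hsup'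
  have hlip : ∀ f : ℝ → ℝ, ContDiffOn ℝ ∞ f I → (∀ u ∈ Set.Ioo (-η) η, |deriv f u| ≤ L) →
      |f τ - f s| ≤ L * |s - τ| := by
    intro f hf hfL
    have := (convex_Ioo (-η) η).norm_image_sub_le_of_norm_hasDerivWithin_le (f := f)
      (fun u hu => (hder f hf u (hηI hu)).hasDerivWithinAt) hfL hs hτ
    rw [Real.norm_eq_abs, Real.norm_eq_abs] at this
    rwa [abs_sub_comm s τ]
  have hXlip : ‖(x τ, y τ) - (x s, y s)‖ ≤ L * |s - τ| := by
    rw [Prod.mk_sub_mk, Prod.norm_def]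
    exact max_le (hlip x hxC fun u hu => (hb2' u hu).1.1.le)
      (hlip y hyC fun u hu => (hb2' u hu).1.2.le)
  have hte : t * ‖e‖ ≤ 1 := by
    have := hdiam w hw _ (hXC s (hηI hs))
    rwa [hwt, add_sub_cancel_left, norm_smul, Real.norm_of_nonneg ht] at this
  set N := ‖z - w‖ with hN
  have hN1 : N ≤ 1 := hdiam z hsup.1 w hw
  have hN0 : 0 ≤ N := norm_nonneg _
  have hzw : z - w = ((x τ, y τ) - (x s, y s)) - t • e := by rw [hzX, hwt]; abel
  have hNle : N ≤ L * |s - τ| + t * ‖e‖ := by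
    rw [hN, hzw]
    refine (norm_sub_le _ _).trans (add_le_add hXlip ?_)
    rw [norm_smul, Real.norm_of_nonneg ht]
  have hte0 : 0 ≤ t * ‖e‖ := by positivity
  have hNsq : N ^ 2 ≤ 2 * L ^ 2 * (s - τ) ^ 2 + 2 * t := by
    have h1 := pow_le_pow_left₀ hN0 hNle 2
    have h2 : (t * ‖e‖) ^ 2 ≤ t := by
      calc (t * ‖e‖) ^ 2 ≤ t * ‖e‖ := by rw [sq]; exact mul_le_of_le_one_left hte0 hte
        _ ≤ t := mul_le_of_le_one_right ht he1
    have h3 : (L * |s - τ|) ^ 2 = L ^ 2 * (s - τ) ^ 2 := by rw [mul_pow, sq_abs]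
    nlinarith [sq_nonneg (L * |s - τ| - t * ‖e‖)]
  have hmain : c * ‖ξ‖ * N ^ 2 ≤ planeDot ξ (z - w) := by
    have hd : planeDot ξ (z - w) = planeDot ξ ((x τ, y τ) - (x s, y s)) - t * planeDot ξ e := by
      rw [hzw, planeDot_sub, planeDot_smul]
    have hc1 : c * (2 * L ^ 2) ≤ k₀ / 2 / (2 * L) :=
      (le_div_iff₀ (by positivity)).1 (min_le_left _ _)
    have hc2 : c ≤ r / 4 := min_le_right _ _
    have h1 : c * N ^ 2 ≤ k₀ / 2 / (2 * L) * (s - τ) ^ 2 + r / 2 * t := by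
      have a1 := mul_le_mul_of_nonneg_left hNsq hcpos.le
      have a2 := mul_le_mul_of_nonneg_right hc1 (sq_nonneg (s - τ))
      have a3 := mul_le_mul_of_nonneg_right hc2 ht
      linarith
    have h2 := mul_le_mul_of_nonneg_left h1 hξn.le
    have h3 := mul_le_mul_of_nonneg_left htr ht
    rw [hd]
    linarith
  constructor
  · refine le_trans ?_ hmain
    have : N ^ γ ≤ N ^ 2 := by
      rw [← Real.rpow_natCast]
      exact Real.rpow_le_rpow_of_exponent_ge_of_imp hN0 hN1 (by exact_mod_cast hγ)
        fun _ h => by linarith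
    gcongr
  · refine le_trans ?_ hmain
    have : √(|ξ.1| * ‖ξ‖) ≤ ‖ξ‖ := by
      rw [Real.sqrt_le_left (norm_nonneg _), sq]
      exact mul_le_mul_of_nonneg_right (norm_fst_le ξ) (norm_nonneg _)
    gcongr

/-! ### Global strict convexity -/

namespace IsCGamma

variable {γ : ℝ} {C : Set (ℝ × ℝ)}

lemma norm_sub_le_one (hC : IsCGamma γ C) : ∀ z ∈ C, ∀ w ∈ C, ‖z - w‖ ≤ 1 := by
  intro z hz w hw
  have h1 := hC.subset_square hz
  have h2 := hC.subset_square hw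
  simp only [Set.mem_prod, Set.mem_Ioo] at h1 h2
  rw [Prod.norm_def]
  refine max_le ?_ ?_
  · rw [Prod.fst_sub, Real.norm_eq_abs, abs_le]; constructor <;> linarith [h1.1.1, h1.1.2, h2.1.1, h2.1.2]
  · rw [Prod.snd_sub, Real.norm_eq_abs, abs_le]; constructor <;> linarith [h1.2.1, h1.2.2, h2.2.1, h2.2.2]

/-- The body is not contained in a line, since near the origin its boundary is curved. -/
lemma interior_nonempty (hC : IsCGamma γ C) (hγ : 2 < γ) : (interior C).Nonempty := by
  obtain ⟨U, hU, h0U, -, hgraph, -⟩ := hC.boundary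
  by_contra hempty
  rw [Set.not_nonempty_iff_eq_empty] at hempty
  have hfr : frontier C = C := by
    rw [frontier, hempty, Set.sdiff_empty, hC.isCompact.isClosed.closure_eq]
  rw [hfr] at hgraph
  have hcont : Continuous fun b : ℝ => (b, |b| ^ γ) :=
    continuous_id.prodMk (continuous_abs.rpow_const fun _ => Or.inr (by linarith))
  have hz0 : ((0 : ℝ), |(0 : ℝ)| ^ γ) = 0 := by
    rw [abs_zero, Real.zero_rpow (by linarith)]; rfl
  have hev : ∀ᶠ b in 𝓝 (0 : ℝ), (b, |b| ^ γ) ∈ U := by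
    refine hcont.continuousAt.eventually ?_
    change U ∈ 𝓝 ((0 : ℝ), |(0 : ℝ)| ^ γ)
    rw [hz0]; exact hU.mem_nhds h0U
  have hev2 : ∀ᶠ b in 𝓝 (0 : ℝ), (1 / 2 : ℝ) • (b, |b| ^ γ) ∈ U := by
    have hc2 : Continuous fun b : ℝ => (1 / 2 : ℝ) • (b, |b| ^ γ) :=
      hcont.const_smul (1 / 2 : ℝ)
    refine hc2.continuousAt.eventually ?_
    change U ∈ 𝓝 ((1 / 2 : ℝ) • ((0 : ℝ), |(0 : ℝ)| ^ γ))
    rw [hz0, smul_zero]; exact hU.mem_nhds h0U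
  obtain ⟨δ, hδ, hball⟩ := Metric.eventually_nhds_iff.1 (hev.and hev2)
  have hb := hball (y := δ / 2) (by rw [Real.dist_eq, sub_zero, abs_of_pos (by linarith)]; linarith)
  set b := δ / 2 with hbdef
  have hbpos : 0 < b := by linarith
  have h0C : (0 : ℝ × ℝ) ∈ C := (hgraph.ge ⟨by
    change (0 : ℝ) = |(0 : ℝ)| ^ γ
    rw [abs_zero, Real.zero_rpow (by linarith)], h0U⟩).1
  have hbC : (b, |b| ^ γ) ∈ C := (hgraph.ge ⟨rfl, hb.1⟩).1
  have hmid : (1 / 2 : ℝ) • (b, |b| ^ γ) ∈ C := by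
    have := hC.convex hbC h0C (by norm_num : (0 : ℝ) ≤ 1 / 2) (by norm_num : (0 : ℝ) ≤ 1 / 2)
      (by norm_num)
    rwa [smul_zero, add_zero] at this
  have hg : 1 / 2 * |b| ^ γ = |1 / 2 * b| ^ γ := (hgraph.le ⟨hmid, hb.2⟩).1
  rw [abs_mul, Real.mul_rpow (abs_nonneg _) (abs_nonneg _), abs_of_pos (by norm_num : (0 : ℝ) < 1 / 2)]
    at hg
  have hp : 0 < |b| ^ γ := Real.rpow_pos_of_pos (abs_pos.2 hbpos.ne') _
  have h1 := mul_right_cancel₀ hp.ne' hg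
  have h2 : (1 / 2 : ℝ) ^ γ < (1 / 2) ^ (1 : ℝ) :=
    Real.rpow_lt_rpow_of_exponent_gt (by norm_num) (by norm_num) (by linarith)
  rw [Real.rpow_one] at h2
  linarith

lemma exists_local_strictConvexBound (hC : IsCGamma γ C) (hγ : 2 < γ) (hγ3 : γ ≤ 3) {z₀ : ℝ × ℝ}
    (hz₀ : z₀ ∈ C) :
    ∃ c : ℝ, 0 < c ∧ ∃ W ∈ 𝓝 z₀, ∀ ξ z w : ℝ × ℝ, z ∈ W → IsSupportedAt C ξ z → w ∈ C → w ∈ W →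
      StrictConvexBound γ c ξ z w := by
  have hne := hC.interior_nonempty hγ
  have hcl := hC.isCompact.isClosed
  by_cases hint : z₀ ∈ interior C
  · refine ⟨1, one_pos, interior C, isOpen_interior.mem_nhds hint, fun ξ z w hz h _ _ => ?_⟩
    rw [h.eq_zero_of_mem_interior hz]
    exact strictConvexBound_zero _ _ _ _
  have hfr : z₀ ∈ frontier C := ⟨subset_closure hz₀, hint⟩
  obtain ⟨U, hU, h0U, hUU, hgraph, κ, hκ, hsm⟩ := hC.boundary
  by_cases hzU : z₀ ∈ U
  · have hz : z₀.2 = |z₀.1| ^ γ := (hgraph.le ⟨hfr, hzU⟩).1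
    have hcont : Continuous fun p : ℝ × ℝ => (p.1, |p.1| ^ γ) :=
      continuous_fst.prodMk ((continuous_abs.comp continuous_fst).rpow_const
        fun _ => Or.inr (by linarith))
    have hpre : (fun p : ℝ × ℝ => (p.1, |p.1| ^ γ)) ⁻¹' U ∈ 𝓝 z₀ := by
      refine hcont.continuousAt.preimage_mem_nhds ?_
      rw [← hz]; exact hU.mem_nhds hzU
    refine ⟨1 / 2592, by norm_num, U ∩ (fun p : ℝ × ℝ => (p.1, |p.1| ^ γ)) ⁻¹' U,
      Filter.inter_mem (hU.mem_nhds hzU) hpre, fun ξ z w hz h hw hwW => ?_⟩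
    exact strictConvexBound_graph hγ hγ3 hcl hC.convex hne hC.subset_square hU hgraph hz.1 h hw
      hwW.2
  · exact exists_strictConvexBound_of_smoothCurveAt hγ.le hκ hcl hC.convex hne hC.norm_sub_le_one
      hfr (hsm z₀ ⟨hfr, fun h => hzU (hUU h)⟩)

/-- Strict convexity of the body, with constants uniform over its boundary: the local bounds are
patched by compactness, and far away points are reached by convexity. -/
theorem exists_strictConvexBound (hC : IsCGamma γ C) (hγ : 2 < γ) (hγ3 : γ ≤ 3) :
    ∃ c : ℝ, 0 < c ∧ ∀ ξ z w : ℝ × ℝ, IsSupportedAt C ξ z → w ∈ C →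
      StrictConvexBound γ c ξ z w := by
  have hloc : ∃ c : ℝ, 0 < c ∧ ∃ δ : ℝ, 0 < δ ∧ ∀ ξ z w : ℝ × ℝ, z ∈ C → IsSupportedAt C ξ z →
      w ∈ C → ‖z - w‖ < δ → StrictConvexBound γ c ξ z w := by
    refine hC.isCompact.induction_on (p := fun T => ∃ c : ℝ, 0 < c ∧ ∃ δ : ℝ, 0 < δ ∧
      ∀ ξ z w : ℝ × ℝ, z ∈ T → IsSupportedAt C ξ z → w ∈ C → ‖z - w‖ < δ →
        StrictConvexBound γ c ξ z w) ?_ ?_ ?_ ?_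
    · exact ⟨1, one_pos, 1, one_pos, fun ξ z w h => absurd h (Set.notMem_empty z)⟩
    · rintro s t hst ⟨c, hc, δ, hδ, h⟩
      exact ⟨c, hc, δ, hδ, fun ξ z w hz => h ξ z w (hst hz)⟩
    · rintro s t ⟨c, hc, δ, hδ, h⟩ ⟨c', hc', δ', hδ', h'⟩
      refine ⟨min c c', lt_min hc hc', min δ δ', lt_min hδ hδ', fun ξ z w hz hs hw hd => ?_⟩
      rcases hz with hz | hz
      · exact (h ξ z w hz hs hw (hd.trans_le (min_le_left _ _))).mono (min_le_left _ _)
      · exact (h' ξ z w hz hs hw (hd.trans_le (min_le_right _ _))).mono (min_le_right _ _)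
    · intro z₀ hz₀
      obtain ⟨c, hc, W, hW, h⟩ := hC.exists_local_strictConvexBound hγ hγ3 hz₀
      obtain ⟨δ, hδ, hball⟩ := Metric.mem_nhds_iff.1 hW
      refine ⟨Metric.ball z₀ (δ / 2), mem_nhdsWithin_of_mem_nhds (Metric.ball_mem_nhds _ (by linarith)),
        c, hc, δ / 2, by linarith, fun ξ z w hz hs hw hd => ?_⟩
      rw [Metric.mem_ball] at hz
      refine h ξ z w (hball (Metric.mem_ball.2 (by linarith))) hs hw (hball (Metric.mem_ball.2 ?_))
      have := dist_triangle w z z₀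
      rw [dist_comm w z, dist_eq_norm z w] at this
      linarith
  obtain ⟨c, hc, δ, hδ, h⟩ := hloc
  set c' := min c (min (c * (δ / 2) ^ γ) (c * (δ / 2) ^ 2)) with hc'
  refine ⟨c', lt_min hc (lt_min (by positivity) (by positivity)), fun ξ z w hs hw => ?_⟩
  rcases lt_or_ge ‖z - w‖ δ with hd | hd
  · exact (h ξ z w hs.1 hs hw hd).mono (min_le_left _ _)
  -- replace `w` by a point of the segment at distance `δ / 2` from `z`
  have hpos : 0 < ‖z - w‖ := hδ.trans_le hd
  set t := δ / 2 / ‖z - w‖ with ht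
  have ht0 : 0 < t := by positivity
  have ht1 : t ≤ 1 := by rw [ht, div_le_one hpos]; linarith
  have hw' : (1 - t) • z + t • w ∈ C :=
    hC.convex hs.1 hw (by linarith) ht0.le (by ring)
  have hzw' : z - ((1 - t) • z + t • w) = t • (z - w) := by
    rw [sub_smul, one_smul, smul_sub]; abel
  have hn' : ‖z - ((1 - t) • z + t • w)‖ = δ / 2 := by
    rw [hzw', norm_smul, Real.norm_of_nonneg ht0.le, ht]; field_simp
  have hb := h ξ z _ hs.1 hs hw' (by rw [hn']; linarith)
  rw [StrictConvexBound, hn', hzw', planeDot_smul] at hb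
  have hnn : 0 ≤ planeDot ξ (z - w) := by
    rw [planeDot_sub]; linarith [hs.2 w hw]
  have htd : t * planeDot ξ (z - w) ≤ planeDot ξ (z - w) := mul_le_of_le_one_left hnn ht1
  have hN1 := hC.norm_sub_le_one z hs.1 w hw
  constructor
  · refine le_trans ?_ (hb.1.trans htd)
    have h1 : ‖z - w‖ ^ γ ≤ 1 := Real.rpow_le_one (norm_nonneg _) hN1 (by linarith)
    have h2 : c' ≤ c * (δ / 2) ^ γ := (min_le_right _ _).trans (min_le_left _ _)
    calc c' * ‖ξ‖ * ‖z - w‖ ^ γ ≤ (c * (δ / 2) ^ γ) * ‖ξ‖ * 1 := by gcongr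
      _ = _ := by ring
  · refine le_trans ?_ (hb.2.trans htd)
    have h1 : ‖z - w‖ ^ 2 ≤ 1 := pow_le_one₀ (norm_nonneg _) hN1
    have h2 : c' ≤ c * (δ / 2) ^ 2 := (min_le_right _ _).trans (min_le_right _ _)
    calc c' * √(|ξ.1| * ‖ξ‖) * ‖z - w‖ ^ 2 ≤ (c * (δ / 2) ^ 2) * √(|ξ.1| * ‖ξ‖) * 1 := by gcongr
      _ = _ := by ring

end IsCGamma

/-! ### Fourier coefficients of dilates of the body -/

/-- The image `ρ C + v` of the set `C` under a dilation followed by a translation. -/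
def dilate (ρ : ℝ) (v : ℝ × ℝ) (C : Set (ℝ × ℝ)) : Set (ℝ × ℝ) := (fun z => ρ • z + v) '' C

lemma isCompact_dilate {C : Set (ℝ × ℝ)} (hC : IsCompact C) (ρ : ℝ) (v : ℝ × ℝ) :
    IsCompact (dilate ρ v C) := hC.image (by fun_prop)

lemma convex_dilate {C : Set (ℝ × ℝ)} (hC : Convex ℝ C) (ρ : ℝ) (v : ℝ × ℝ) :
    Convex ℝ (dilate ρ v C) := by
  have : dilate ρ v C = (fun z => z + v) '' (ρ • C) := by
    rw [dilate, ← Set.image_smul, Set.image_image]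
  rw [this]
  simpa [Set.image_add_right] using (hC.smul ρ).translate_preimage_left (-v)

lemma volume_real_dilate (C : Set (ℝ × ℝ)) (ρ : ℝ) (v : ℝ × ℝ) :
    volume.real (dilate ρ v C) = ρ ^ 2 * volume.real C := by
  have : dilate ρ v C = (fun z => z + v) '' (ρ • C) := by
    rw [dilate, ← Set.image_smul, Set.image_image]
  rw [this, Set.image_add_right, Measure.real, measure_preimage_add_right, Measure.addHaar_smul,
    ENNReal.toReal_mul, ENNReal.toReal_ofReal (abs_nonneg _)]
  simp [Measure.real]

/-- Points of `ρ C + v` on a common line orthogonal to `ξ`, close to the highest such line, are both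
close to a point where that height is attained. -/
lemma exists_norm_sub_le_of_chord {γ c ρ : ℝ} {C : Set (ℝ × ℝ)} {v ξ x y : ℝ × ℝ} (hρ : 0 < ρ)
    (hC : IsCompact C)
    (hsc : ∀ ξ z w : ℝ × ℝ, IsSupportedAt C ξ z → w ∈ C → StrictConvexBound γ c ξ z w)
    (hx : x ∈ dilate ρ v C) (hy : y ∈ dilate ρ v C) (hxy : planeDot ξ x = planeDot ξ y)
    (hnear : ∀ z ∈ dilate ρ v C, planeDot ξ z ≤ planeDot ξ x + 1) :
    ∃ s t : ℝ, 0 ≤ s ∧ 0 ≤ t ∧ ‖x - y‖ ≤ ρ * (s + t) ∧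
      (c * ‖ξ‖ * s ^ γ ≤ 1 / ρ ∧ c * √(|ξ.1| * ‖ξ‖) * s ^ 2 ≤ 1 / ρ) ∧
      (c * ‖ξ‖ * t ^ γ ≤ 1 / ρ ∧ c * √(|ξ.1| * ‖ξ‖) * t ^ 2 ≤ 1 / ρ) := by
  obtain ⟨z, hz, rfl⟩ := hx
  obtain ⟨w, hw, rfl⟩ := hy
  obtain ⟨z₀, hz₀, hmax⟩ := hC.exists_isMaxOn ⟨z, hz⟩ (continuous_planeDot ξ).continuousOn
  have hs : IsSupportedAt C ξ z₀ := ⟨hz₀, fun u hu => hmax hu⟩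
  have h0 := hnear _ ⟨z₀, hz₀, rfl⟩
  simp only [planeDot_add, planeDot_smul] at h0 hxy
  have hdz : planeDot ξ (z₀ - z) ≤ 1 / ρ := by
    rw [planeDot_sub, le_div_iff₀ hρ]; linarith
  have hdw : planeDot ξ (z₀ - w) ≤ 1 / ρ := by
    rw [planeDot_sub, le_div_iff₀ hρ]; linarith
  have h1 := hsc ξ z₀ z hs hz
  have h2 := hsc ξ z₀ w hs hw
  refine ⟨‖z₀ - z‖, ‖z₀ - w‖, norm_nonneg _, norm_nonneg _, ?_, ⟨h1.1.trans hdz, h1.2.trans hdz⟩,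
    h2.1.trans hdw, h2.2.trans hdw⟩
  have : ρ • z + v - (ρ • w + v) = ρ • (z - w) := by rw [smul_sub]; abel
  change ‖ρ • z + v - (ρ • w + v)‖ ≤ _
  rw [this, norm_smul, Real.norm_of_nonneg hρ.le]
  refine mul_le_mul_of_nonneg_left ?_ hρ.le
  have := norm_sub_le_norm_sub_add_norm_sub z z₀ w
  rwa [norm_sub_rev z z₀] at this

section

variable {γ c ρ : ℝ} {C : Set (ℝ × ℝ)}

/-- The Fourier transform of `ρ C + v` at `ξ`, bounded in terms of a bound `ℓ` for the distance in `C`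
from a maximizer of `ξ` or `-ξ` to the points within `1 / ρ` of the maximum. -/
lemma norm_mul_norm_setIntegral_dilate_le (hρ : 0 < ρ) (hC : IsCompact C) (hconv : Convex ℝ C)
    (hsc : ∀ ξ z w : ℝ × ℝ, IsSupportedAt C ξ z → w ∈ C → StrictConvexBound γ c ξ z w)
    (v ξ : ℝ × ℝ) {ℓ : ℝ} (hℓ0 : 0 ≤ ℓ)
    (hℓ : ∀ s, 0 ≤ s → c * ‖ξ‖ * s ^ γ ≤ 1 / ρ → c * √(|ξ.1| * ‖ξ‖) * s ^ 2 ≤ 1 / ρ → s ≤ ℓ) :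
    ‖ξ‖ * ‖∫ y in dilate ρ v C, unitChar (-planeDot ξ y)‖ ≤ 4 * ρ * ℓ := by
  have key : ∀ x ∈ dilate ρ v C, ∀ y ∈ dilate ρ v C, planeDot (-ξ) x = planeDot (-ξ) y →
      ((∀ z ∈ dilate ρ v C, planeDot (-ξ) z ≤ planeDot (-ξ) x + 1) ∨
        (∀ z ∈ dilate ρ v C, planeDot (-ξ) x - 1 ≤ planeDot (-ξ) z)) → ‖x - y‖ ≤ ρ * (2 * ℓ) := by
    intro x hx y hy hxy hor
    obtain ⟨s, t, hs, ht, hd, ⟨a1, a2⟩, b1, b2⟩ : ∃ s t : ℝ, 0 ≤ s ∧ 0 ≤ t ∧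
        ‖x - y‖ ≤ ρ * (s + t) ∧
        (c * ‖ξ‖ * s ^ γ ≤ 1 / ρ ∧ c * √(|ξ.1| * ‖ξ‖) * s ^ 2 ≤ 1 / ρ) ∧
        (c * ‖ξ‖ * t ^ γ ≤ 1 / ρ ∧ c * √(|ξ.1| * ‖ξ‖) * t ^ 2 ≤ 1 / ρ) := by
      rcases hor with h | h
      · simpa using exists_norm_sub_le_of_chord hρ hC hsc hx hy hxy h
      · simp only [planeDot_neg_left] at hxy h
        exact exists_norm_sub_le_of_chord hρ hC hsc hx hy (neg_injective hxy)
          fun z hz => by linarith [h z hz]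
    have h1 := hℓ s hs a1 a2
    have h2 := hℓ t ht b1 b2
    exact hd.trans (mul_le_mul_of_nonneg_left (by linarith) hρ.le)
  have := norm_setIntegral_unitChar_mul_norm_le (isCompact_dilate hC ρ v) (convex_dilate hconv ρ v)
    (by positivity) key
  simp only [planeDot_neg_left, norm_neg] at this
  linarith

/-- The nonconstant Fourier coefficients of the `ℤ²`-periodization of the smoothed indicator function
of `K`. -/
noncomputable def smoothCoeff (ε : ℝ) (K : Set (ℝ × ℝ)) (m : ℤ × ℤ) : ℂ :=
  if m = 0 then 0 else planeFourier (fun x => (smoothIndicator ε K x : ℂ)) (latticePoint m)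

lemma CoeffDecay.mono {a : ℤ × ℤ → ℂ} {A B A' B' ε b : ℝ} (h : CoeffDecay a A B ε b) (hA : 0 ≤ A)
    (hAA' : A ≤ A') (hBB' : B ≤ B') : CoeffDecay a A' B' ε b where
  off_axis m hm := (h.off_axis m hm).trans (by gcongr)
  on_axis m hm := (h.on_axis m hm).trans (by gcongr)

/-- The off-axis decay comes from the quadratic, the on-axis decay from the `γ`-th power form of strict
convexity. -/
theorem coeffDecay_smoothCoeff_dilate {ε : ℝ} (hγ : 0 < γ) (hc : 0 < c) (hρ : 0 < ρ) (hε : 0 < ε)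
    (hC : IsCompact C) (hconv : Convex ℝ C)
    (hsc : ∀ ξ z w : ℝ × ℝ, IsSupportedAt C ξ z → w ∈ C → StrictConvexBound γ c ξ z w)
    (v : ℝ × ℝ) :
    CoeffDecay (smoothCoeff ε (dilate ρ v C)) (√(16 / c * ρ))
      (4 * c ^ (-(1 / γ)) * ρ ^ (1 - 1 / γ)) ε (1 + 1 / γ) := by
  have hK := isCompact_dilate hC ρ v
  constructor
  · intro m hm
    have hm0 : m ≠ 0 := fun h => hm (by rw [h]; rfl)
    set ξ := latticePoint m with hξ
    have hξ1 : ξ.1 = (m.1 : ℝ) := rfl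
    have h1 : 0 < |(m.1 : ℝ)| := abs_pos.2 (by exact_mod_cast hm)
    have hN : 0 < ‖ξ‖ := by
      rw [hξ, norm_latticePoint]; exact lt_max_of_lt_left h1
    set S := √(‖ξ‖ * |(m.1 : ℝ)|) with hS
    have hSpos : 0 < S := Real.sqrt_pos.2 (mul_pos hN h1)
    have hI := norm_mul_norm_setIntegral_dilate_le hρ hC hconv hsc v ξ
      (ℓ := √(1 / (c * ρ * S))) (Real.sqrt_nonneg _) (fun s hs _ h2 => by
        refine Real.le_sqrt_of_sq_le ?_
        rw [hξ1, mul_comm |(m.1 : ℝ)|, ← hS, le_div_iff₀ hρ] at h2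
        rw [le_div_iff₀ (by positivity)]; linarith)
    rw [smoothCoeff, if_neg hm0, ← hξ, planeFourier_smoothIndicator hε hK, norm_mul]
    set T := ‖planeFourier (fun u => (tentKernel ε u : ℂ)) ξ‖ with hT
    set I := ‖∫ y in dilate ρ v C, unitChar (-planeDot ξ y)‖ with hIdef
    have hTm : T ≤ min 1 (1 / (ε * ‖ξ‖)) := by
      refine le_min (norm_planeFourier_tentKernel_le_one hε ξ) ?_
      rw [le_div_iff₀ (by positivity), mul_comm]
      exact mul_norm_planeFourier_tentKernel_le_one hε ξ
    have hI2 : I ^ 2 ≤ 16 / c * ρ / (‖ξ‖ ^ 2 * S) := by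
      have := pow_le_pow_left₀ (by positivity) hI 2
      rw [mul_pow, mul_pow, Real.sq_sqrt (by positivity)] at this
      rw [le_div_iff₀ (by positivity)]
      have e : (4 * ρ) ^ 2 * (1 / (c * ρ * S)) = 16 / c * ρ / S := by field_simp; ring
      rw [e, le_div_iff₀ hSpos] at this
      linarith
    rw [mul_pow, Real.sq_sqrt (by positivity), mul_comm]
    exact mul_le_mul hI2 (pow_le_pow_left₀ (norm_nonneg _) hTm 2) (by positivity) (by positivity)
  · intro m hm
    rcases eq_or_ne m 0 with rfl | hm0
    · rw [smoothCoeff, if_pos rfl, norm_zero]; positivity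
    set ξ := latticePoint m with hξ
    have h2 : m.2 ≠ 0 := fun h => hm0 (Prod.ext hm h)
    have hN : ‖ξ‖ = |(m.2 : ℝ)| := by
      rw [hξ, norm_latticePoint, hm, Int.cast_zero, abs_zero, max_eq_right (abs_nonneg _)]
    have h2' : 0 < |(m.2 : ℝ)| := abs_pos.2 (by exact_mod_cast h2)
    set N := |(m.2 : ℝ)|
    have hI := norm_mul_norm_setIntegral_dilate_le hρ hC hconv hsc v ξ
      (ℓ := (1 / (c * N * ρ)) ^ (1 / γ)) (by positivity) (fun s hs h1 _ => by
        rw [hN, le_div_iff₀ hρ] at h1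
        have : s ^ γ ≤ 1 / (c * N * ρ) := by rw [le_div_iff₀ (by positivity)]; linarith
        have h3 := Real.rpow_le_rpow (by positivity) this (by positivity : 0 ≤ 1 / γ)
        rwa [← Real.rpow_mul hs, mul_one_div_cancel hγ.ne', Real.rpow_one] at h3)
    rw [smoothCoeff, if_neg hm0, ← hξ, planeFourier_smoothIndicator hε hK, norm_mul]
    have hT := norm_planeFourier_tentKernel_le_one hε ξ
    rw [hN] at hI
    refine (mul_le_of_le_one_left (norm_nonneg _) hT).trans ?_
    refine le_of_mul_le_mul_left (hI.trans_eq ?_) h2'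
    rw [one_div (c * N * ρ), Real.inv_rpow (by positivity), ← Real.rpow_neg (by positivity),
      Real.mul_rpow (by positivity) hρ.le, Real.mul_rpow hc.le h2'.le, Real.rpow_sub hρ,
      Real.rpow_one, neg_add, Real.rpow_add h2', Real.rpow_neg_one, Real.rpow_neg hρ.le]
    field_simp

/-- Poisson summation for the smoothed lattice point count; its constant term is the area of `K`. -/
lemma abs_tsum_smoothIndicator_sub_le {ε : ℝ} (hε : 0 < ε) {K : Set (ℝ × ℝ)} (hK : IsCompact K)
    (hsum : Summable fun m => ‖smoothCoeff ε K m‖) (t : ℝ × ℝ) :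
    |∑' n, smoothIndicator ε K (-t + latticePoint n) - volume.real K| ≤
      ‖trigSeries (smoothCoeff ε K) t‖ := by
  set g : ℝ × ℝ → ℂ := fun x => (smoothIndicator ε K x : ℂ) with hg
  have hgc : Continuous g := Complex.continuous_ofReal.comp (continuous_smoothIndicator ε hK)
  have hgs : HasCompactSupport g :=
    (hasCompactSupport_smoothIndicator hε hK).comp_left Complex.ofReal_zero
  have hsum' : Summable fun m => planeFourier g (latticePoint m) := by
    refine ((hasSum_ite_eq (0 : ℤ × ℤ) (planeFourier g (latticePoint 0))).summable.add
      hsum.of_norm).congr fun m => ?_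
    by_cases hm : m = 0
    · simp [smoothCoeff, hm]
    · simp [smoothCoeff, hm, hg]
  have hP := hasSum_planeFourier_of_hasCompactSupport hgc hgs hsum' (-t)
  have h0 : planeFourier g (latticePoint 0) = (volume.real K : ℂ) := by
    rw [latticePoint_zero, hg, planeFourier_smoothIndicator hε hK]
    have e1 : planeFourier (fun u => (tentKernel ε u : ℂ)) 0 = 1 := by
      simp only [planeFourier, planeDot_zero_left, neg_zero, unitChar_zero, mul_one]
      rw [integral_complex_ofReal, integral_tentKernel hε, Complex.ofReal_one]
    rw [e1, one_mul]
    simp [unitChar_zero, planeDot_zero_left]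
  have hT : HasSum (fun m => smoothCoeff ε K m * unitChar (planeDot (latticePoint m) (-t)))
      (trigSeries (smoothCoeff ε K) t) := by
    refine Summable.hasSum (Summable.of_norm (hsum.congr fun m => ?_))
    rw [norm_mul, norm_unitChar, mul_one]
  have hP' : HasSum (fun m => planeFourier g (latticePoint m) *
      unitChar (planeDot (latticePoint m) (-t)))
      (volume.real K + trigSeries (smoothCoeff ε K) t) := by
    refine ((hasSum_ite_eq (0 : ℤ × ℤ) (volume.real K : ℂ)).add hT).congr_fun fun m => ?_
    by_cases hm : m = 0
    · subst hm
      rw [h0]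
      simp [smoothCoeff, latticePoint_zero, unitChar_zero]
    · simp [smoothCoeff, hm, hg]
  have he := hP.unique hP'
  rw [← Real.norm_eq_abs, ← Complex.norm_real, Complex.ofReal_sub, Complex.ofReal_tsum, he]
  simp

end

/-! ### Counting lattice points by smoothed indicator functions -/

lemma finite_setOf_latticePoint_mem {T : Set (ℝ × ℝ)} (hT : Bornology.IsBounded T) (t : ℝ × ℝ) :
    {n : ℤ × ℤ | -t + latticePoint n ∈ T}.Finite := by
  obtain ⟨B, hB⟩ := hT.exists_norm_le
  refine (finite_support_comp_add_latticePoint (g := T.indicator fun _ => (1 : ℝ)) (B := B)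
    (fun x hx => hB x (Set.mem_of_indicator_ne_zero hx)) (-t)).subset fun n hn => ?_
  have : -t + latticePoint n ∈ T := hn
  simp [this]

lemma finite_support_smoothIndicator {ε : ℝ} (hε : 0 < ε) {K : Set (ℝ × ℝ)} (hK : IsCompact K)
    (t : ℝ × ℝ) : (Function.support fun n => smoothIndicator ε K (-t + latticePoint n)).Finite := by
  obtain ⟨B, hB⟩ := (hasCompactSupport_smoothIndicator hε hK).isCompact.isBounded.exists_norm_le
  exact finite_support_comp_add_latticePoint (fun x hx => hB x (subset_tsupport _ hx)) (-t)

/-- The count of a set is at most the smoothed count of a set containing its `ε`-neighbourhood. -/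
lemma ncard_le_tsum_smoothIndicator {ε : ℝ} (hε : 0 < ε) {K T : Set (ℝ × ℝ)} (hK : IsCompact K)
    (hT : Bornology.IsBounded T) (h : ∀ x ∈ T, ∀ y, ‖x - y‖ ≤ ε → y ∈ K) (t : ℝ × ℝ) :
    ({n : ℤ × ℤ | -t + latticePoint n ∈ T}.ncard : ℝ) ≤
      ∑' n, smoothIndicator ε K (-t + latticePoint n) := by
  have hfin := finite_setOf_latticePoint_mem hT t
  have hsum : Summable fun n => smoothIndicator ε K (-t + latticePoint n) :=
    summable_of_hasFiniteSupport (finite_support_smoothIndicator hε hK t)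
  rw [Set.ncard_eq_toFinset_card _ hfin]
  refine le_trans (le_of_eq ?_)
    (hsum.sum_le_tsum hfin.toFinset fun n _ => smoothIndicator_nonneg hε K _)
  rw [Finset.sum_congr rfl fun n hn => smoothIndicator_eq_one hε (h _ (hfin.mem_toFinset.1 hn))]
  simp

/-- The smoothed count of `K` bounds the count of any set containing the `ε`-neighbourhood of `K` from
below. -/
lemma tsum_smoothIndicator_le_ncard {ε : ℝ} (hε : 0 < ε) {K T : Set (ℝ × ℝ)}
    (hT : Bornology.IsBounded T) (h : ∀ y ∈ K, ∀ x, ‖x - y‖ ≤ ε → x ∈ T) (t : ℝ × ℝ) :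
    ∑' n, smoothIndicator ε K (-t + latticePoint n) ≤
      ({n : ℤ × ℤ | -t + latticePoint n ∈ T}.ncard : ℝ) := by
  have hfin := finite_setOf_latticePoint_mem hT t
  rw [Set.ncard_eq_toFinset_card _ hfin, tsum_eq_sum (s := hfin.toFinset)]
  · refine (Finset.sum_le_sum fun n _ => smoothIndicator_le_one hε K _).trans_eq ?_
    simp
  · intro n hn
    by_contra hne
    obtain ⟨y, hy, hxy⟩ := exists_mem_of_smoothIndicator_ne_zero hε hne
    exact hn (hfin.mem_toFinset.2 (h y hy _ hxy))

/-- A dilate of a convex set swallows a smaller dilate together with its neighbourhood. -/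
lemma smul_add_smul_add_mem_dilate {C : Set (ℝ × ℝ)} (hconv : Convex ℝ C) {q z u : ℝ × ℝ}
    {r ρ s : ℝ} (hq : Metric.closedBall q r ⊆ C) (hz : z ∈ C) (hρ : 0 ≤ ρ) (hs : 0 < s)
    (hu : ‖u‖ ≤ s * r) : ∃ w ∈ C, (ρ + s) • w = ρ • z + s • q + u := by
  have hb : q + s⁻¹ • u ∈ C := by
    refine hq ?_
    rw [mem_closedBall_iff_norm, add_sub_cancel_left, norm_smul, norm_inv, Real.norm_of_nonneg hs.le,
      inv_mul_le_iff₀ hs]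
    exact hu
  have hρs : 0 < ρ + s := by linarith
  refine ⟨(ρ / (ρ + s)) • z + (s / (ρ + s)) • (q + s⁻¹ • u), hconv hz hb (by positivity)
    (by positivity) (by field_simp), ?_⟩
  rw [smul_add, smul_smul, smul_smul, mul_div_cancel₀ _ hρs.ne', mul_div_cancel₀ _ hρs.ne', smul_add,
    smul_smul, mul_inv_cancel₀ hs.ne', one_smul, add_assoc]

lemma discrepancy_eq {C : Set (ℝ × ℝ)} (R : ℝ) (t : ℝ × ℝ) :
    discrepancy C R t = -(R ^ 2 * volume.real C) +
      ({n : ℤ × ℤ | -t + latticePoint n ∈ dilate R 0 C}.ncard : ℝ) := by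
  rw [discrepancy]
  congr 4
  ext n
  simp only [dilate, Set.mem_image, add_zero]
  refine exists_congr fun z => and_congr_right fun _ => ?_
  change R • z + t = latticePoint n ↔ _
  rw [eq_neg_add_iff_add_eq, add_comm]

/-- The discrepancy is controlled by the trigonometric series attached to smoothings, at scale `ε`, of
a slightly larger and of a slightly smaller dilate. -/
theorem IsCGamma.exists_abs_discrepancy_le {γ : ℝ} {C : Set (ℝ × ℝ)} (hC : IsCGamma γ C)
    (hγ : 2 < γ) (hγ3 : γ ≤ 3) :
    ∃ η M : ℝ, 0 < η ∧ η ≤ 1 ∧ 0 < M ∧ ∀ R ε : ℝ, 1 ≤ R → 0 < ε → ε ≤ η →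
      ∃ a₁ a₂ : ℤ × ℤ → ℂ,
        CoeffDecay a₁ (M * √R) (M * R ^ (1 - 1 / γ)) ε (1 + 1 / γ) ∧
        CoeffDecay a₂ (M * √R) (M * R ^ (1 - 1 / γ)) ε (1 + 1 / γ) ∧
        ∀ t, |discrepancy C R t| ≤ ‖trigSeries a₁ t‖ + ‖trigSeries a₂ t‖ + M * (R * ε) := by
  obtain ⟨c, hc, hsc⟩ := hC.exists_strictConvexBound hγ hγ3
  obtain ⟨q, hq⟩ := hC.interior_nonempty hγ
  rw [mem_interior_iff_mem_nhds, Metric.nhds_basis_closedBall.mem_iff] at hq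
  obtain ⟨r, hr, hqr⟩ := hq
  have hγ0 : 0 < γ := by linarith
  have hg1 : 0 ≤ 1 - 1 / γ := by
    have : 1 / γ ≤ 1 := by rw [div_le_one hγ0]; linarith
    linarith
  set V := volume.real C with hV
  have hV0 : 0 ≤ V := measureReal_nonneg
  set M := √(16 / c * 2) + 4 * c ^ (-(1 / γ)) * 2 ^ (1 - 1 / γ) + 3 * V / r with hM
  have m1 : 0 < √(16 / c * 2) := Real.sqrt_pos.2 (by positivity)
  have m2 : 0 ≤ 4 * c ^ (-(1 / γ)) * 2 ^ (1 - 1 / γ) := by positivity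
  have m3 : 0 ≤ 3 * V / r := by positivity
  have hMpos : 0 < M := by linarith
  refine ⟨min 1 (r / 2), M, lt_min one_pos (by linarith), min_le_left _ _, hMpos,
    fun R ε hR hε hεη => ?_⟩
  set s := ε / r with hs
  have hspos : 0 < s := by positivity
  have hs1 : s ≤ 1 / 2 := by
    rw [hs, div_le_iff₀ hr]; linarith [hεη.trans (min_le_right _ _)]
  have hsr : s * r = ε := by rw [hs]; field_simp
  have hdec : ∀ ρ v, 0 < ρ → ρ ≤ 2 * R →
      CoeffDecay (smoothCoeff ε (dilate ρ v C)) (M * √R) (M * R ^ (1 - 1 / γ)) ε (1 + 1 / γ) := by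
    intro ρ v hρ hρR
    refine (coeffDecay_smoothCoeff_dilate hγ0 hc hρ hε hC.isCompact hC.convex hsc v).mono
      (Real.sqrt_nonneg _) ?_ ?_
    · calc √(16 / c * ρ) ≤ √(16 / c * 2 * R) := by
            refine Real.sqrt_le_sqrt ?_
            rw [mul_assoc]; gcongr
        _ = √(16 / c * 2) * √R := Real.sqrt_mul (by positivity) _
        _ ≤ M * √R := by gcongr; linarith
    · calc 4 * c ^ (-(1 / γ)) * ρ ^ (1 - 1 / γ) ≤ 4 * c ^ (-(1 / γ)) * (2 * R) ^ (1 - 1 / γ) := by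
            gcongr
        _ = 4 * c ^ (-(1 / γ)) * 2 ^ (1 - 1 / γ) * R ^ (1 - 1 / γ) := by
            rw [Real.mul_rpow (by norm_num) (by linarith)]; ring
        _ ≤ M * R ^ (1 - 1 / γ) := by gcongr; linarith
  -- the translations move the centre `q` of the inner ball back, so that the dilates are nested
  set K₁ := dilate (R + s) (-(s • q)) C with hK₁
  set K₂ := dilate (R - s) (s • q) C with hK₂
  have d1 := hdec (R + s) (-(s • q)) (by linarith) (by linarith)
  have d2 := hdec (R - s) (s • q) (by linarith) (by linarith)
  refine ⟨_, _, d1, d2, fun t => ?_⟩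
  have hb1 : (1 : ℝ) < 1 + 1 / γ := by have : 0 < 1 / γ := by positivity
                                       linarith
  obtain ⟨C₀, -, hsummable⟩ := exists_tsum_norm_le_of_coeffDecay hb1
  have hε1 : ε ≤ 1 := hεη.trans (min_le_left _ _)
  have s1 := (hsummable _ _ _ ε (by positivity) (by positivity) hε hε1 d1).1
  have s2 := (hsummable _ _ _ ε (by positivity) (by positivity) hε hε1 d2).1
  have c1 : IsCompact K₁ := isCompact_dilate hC.isCompact _ _
  have c2 : IsCompact K₂ := isCompact_dilate hC.isCompact _ _
  have p1 := abs_tsum_smoothIndicator_sub_le hε c1 s1 t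
  have p2 := abs_tsum_smoothIndicator_sub_le hε c2 s2 t
  have hbdd : Bornology.IsBounded (dilate R 0 C) := (isCompact_dilate hC.isCompact R 0).isBounded
  have n1 := ncard_le_tsum_smoothIndicator hε c1 hbdd (by
    rintro _ ⟨z, hz, rfl⟩ y hy
    obtain ⟨w, hw, he⟩ := smul_add_smul_add_mem_dilate hC.convex (u := y - R • z) (ρ := R) (s := s)
      hqr hz (by linarith) hspos (by
        rw [hsr, norm_sub_rev]; simpa using hy)
    refine ⟨w, hw, ?_⟩
    change (R + s) • w + -(s • q) = y
    rw [he]; abel) t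
  have n2 := tsum_smoothIndicator_le_ncard hε (K := K₂) hbdd (by
    rintro _ ⟨z, hz, rfl⟩ x hx
    obtain ⟨w, hw, he⟩ := smul_add_smul_add_mem_dilate hC.convex
      (u := x - ((R - s) • z + s • q)) (ρ := R - s) (s := s)
      hqr hz (by linarith) hspos (by rw [hsr]; exact hx)
    refine ⟨w, hw, ?_⟩
    change R • w + 0 = x
    rw [sub_add_cancel] at he
    rw [he]; abel) t
  rw [hK₁, volume_real_dilate, ← hK₁, ← hV] at p1
  rw [hK₂, volume_real_dilate, ← hK₂, ← hV] at p2
  rw [abs_le] at p1 p2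
  have hE : 3 * (R * s * V) ≤ M * (R * ε) := by
    have : 3 * (R * s * V) = 3 * V / r * (R * ε) := by rw [hs]; ring
    rw [this]
    have : 0 ≤ R * ε := by positivity
    gcongr; linarith
  have hss : s ^ 2 * V ≤ R * s * V := by
    rw [sq]; gcongr; linarith
  have hnn : 0 ≤ R * s * V := by positivity
  have hs2 : 0 ≤ s ^ 2 * V := by positivity
  have t1 := norm_nonneg (trigSeries (smoothCoeff ε K₁) t)
  have t2 := norm_nonneg (trigSeries (smoothCoeff ε K₂) t)
  rw [discrepancy_eq, abs_le, ← hV]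
  constructor <;> nlinarith

/-! ### Norms of the discrepancy -/

namespace IsCGamma

variable {γ : ℝ} {C : Set (ℝ × ℝ)}

/-- The uniform bound: smoothing at scale `R ^ (-1 / 3)`. -/
theorem exists_abs_discrepancy_le_rpow (hC : IsCGamma γ C) (hγ : 2 < γ) (hγ3 : γ ≤ 3) :
    ∃ c : ℝ, 0 < c ∧ ∀ R : ℝ, 1 ≤ R → ∀ t, |discrepancy C R t| ≤ c * R ^ (2 / 3 : ℝ) := by
  obtain ⟨η, M, hη, hη1, hM, h⟩ := hC.exists_abs_discrepancy_le hγ hγ3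
  have hγ0 : 0 < γ := by linarith
  obtain ⟨S, hS, hsum⟩ := exists_tsum_norm_le_of_coeffDecay (b := 1 + 1 / γ)
    (by have : 0 < 1 / γ := by positivity
        linarith)
  refine ⟨2 * (S * (M * η ^ (-(1 / 2) : ℝ) + M)) + M, by positivity, fun R hR t => ?_⟩
  have hR0 : 0 < R := by linarith
  set ε := η * R ^ (-(1 / 3) : ℝ) with hε
  have hε0 : 0 < ε := by positivity
  have hεη : ε ≤ η :=
    mul_le_of_le_one_right hη.le (Real.rpow_le_one_of_one_le_of_nonpos hR (by norm_num))
  obtain ⟨a₁, a₂, h₁, h₂, hD⟩ := h R ε hR hε0 hεη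
  have e1 : √R * ε ^ (-(1 / 2) : ℝ) = η ^ (-(1 / 2) : ℝ) * R ^ (2 / 3 : ℝ) := by
    rw [hε, Real.mul_rpow hη.le (by positivity), ← Real.rpow_mul hR0.le, Real.sqrt_eq_rpow,
      mul_left_comm, ← Real.rpow_add hR0]
    norm_num
  have e2 : R ^ (1 - 1 / γ) ≤ R ^ (2 / 3 : ℝ) := by
    refine Real.rpow_le_rpow_of_exponent_le hR ?_
    have : 1 / 3 ≤ 1 / γ := one_div_le_one_div_of_le hγ0 hγ3
    linarith
  have e3 : R * ε ≤ R ^ (2 / 3 : ℝ) := by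
    have : R * R ^ (-(1 / 3) : ℝ) = R ^ (2 / 3 : ℝ) := by
      rw [← Real.rpow_one_add' hR0.le (by norm_num)]; norm_num
    calc R * ε = η * (R * R ^ (-(1 / 3) : ℝ)) := by rw [hε]; ring
      _ ≤ 1 * (R * R ^ (-(1 / 3) : ℝ)) := by gcongr
      _ = _ := by rw [one_mul, this]
  have key : ∀ a, CoeffDecay a (M * √R) (M * R ^ (1 - 1 / γ)) ε (1 + 1 / γ) →
      ‖trigSeries a t‖ ≤ S * (M * η ^ (-(1 / 2) : ℝ) + M) * R ^ (2 / 3 : ℝ) := by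
    intro a ha
    obtain ⟨hs, hle⟩ := hsum a _ _ ε (by positivity) (by positivity) hε0 (hεη.trans hη1) ha
    calc ‖trigSeries a t‖ ≤ _ := norm_trigSeries_le hs t
      _ ≤ _ := hle
      _ = S * (M * (√R * ε ^ (-(1 / 2) : ℝ)) + M * R ^ (1 - 1 / γ)) := by ring
      _ ≤ S * (M * (η ^ (-(1 / 2) : ℝ) * R ^ (2 / 3 : ℝ)) + M * R ^ (2 / 3 : ℝ)) := by
        rw [e1]; gcongr
      _ = _ := by ring
  have k1 := key a₁ h₁
  have k2 := key a₂ h₂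
  have k3 := mul_le_mul_of_nonneg_left e3 hM.le
  linarith [hD t]

/-- The bound at the critical exponent `4 / (3 - γ)`: smoothing at scale `R ^ (-1 / γ)`. It is stated
for a continuous majorant, so that it passes to smaller exponents. -/
theorem exists_majorant_eLpNorm_le (hC : IsCGamma γ C) (hγ : 2 < γ) (hγ3 : γ < 3) :
    ∃ c : ℝ, 0 < c ∧ ∀ R : ℝ, 1 ≤ R → ∃ G : ℝ × ℝ → ℝ, Continuous G ∧
      (∀ t, |discrepancy C R t| ≤ G t) ∧
      eLpNorm G (ENNReal.ofReal (4 / (3 - γ))) (volume.restrict torusSquare) ≤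
        ENNReal.ofReal (c * R ^ (1 - 1 / γ)) := by
  obtain ⟨η, M, hη, hη1, hM, h⟩ := hC.exists_abs_discrepancy_le hγ hγ3.le
  have hγ0 : 0 < γ := by linarith
  have h3γ : 0 < 3 - γ := by linarith
  set p := 4 / (3 - γ) with hp
  have hp4 : 4 < p := by rw [hp, lt_div_iff₀ h3γ]; linarith
  have hb : 1 < 1 + 1 / γ := by
    have : 0 < 1 / γ := by positivity
    linarith
  obtain ⟨S, hS, hsum⟩ := exists_tsum_norm_le_of_coeffDecay hb
  obtain ⟨T, hT, hLp⟩ := exists_eLpNorm_trigSeries_le_of_coeffDecay hb hp4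
  set θ := 1 / 2 - 2 / p with hθ
  have hθγ : θ = (γ - 2) / 2 := by rw [hθ, hp]; field_simp; ring
  refine ⟨2 * (T * (M * η ^ (-θ) + M)) + M, by positivity, fun R hR => ?_⟩
  have hR0 : 0 < R := by linarith
  set ε := η * R ^ (-(1 / γ)) with hε
  have hε0 : 0 < ε := by positivity
  have hεη : ε ≤ η := mul_le_of_le_one_right hη.le
    (Real.rpow_le_one_of_one_le_of_nonpos hR (neg_nonpos.2 (by positivity)))
  obtain ⟨a₁, a₂, h₁, h₂, hD⟩ := h R ε hR hε0 hεη
  set X := R ^ (1 - 1 / γ) with hX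
  have hX0 : 0 < X := by positivity
  have e1 : √R * ε ^ (-θ) = η ^ (-θ) * X := by
    rw [hε, Real.mul_rpow hη.le (by positivity), ← Real.rpow_mul hR0.le, Real.sqrt_eq_rpow,
      mul_left_comm, ← Real.rpow_add hR0, hX]
    congr 2
    rw [hθγ]; field_simp; ring
  have e3 : R * ε ≤ X := by
    have : R * R ^ (-(1 / γ)) = X := by
      rw [hX, sub_eq_add_neg, Real.rpow_add hR0, Real.rpow_one]
    calc R * ε = η * (R * R ^ (-(1 / γ))) := by rw [hε]; ring
      _ ≤ 1 * (R * R ^ (-(1 / γ))) := by gcongr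
      _ = _ := by rw [one_mul, this]
  have key : ∀ a, CoeffDecay a (M * √R) (M * X) ε (1 + 1 / γ) → Continuous (trigSeries a) ∧
      eLpNorm (fun t => ‖trigSeries a t‖) (ENNReal.ofReal p) (volume.restrict torusSquare) ≤
        ENNReal.ofReal (T * (M * η ^ (-θ) + M) * X) := by
    intro a ha
    have hs := (hsum a _ _ ε (by positivity) (by positivity) hε0 (hεη.trans hη1) ha).1
    refine ⟨continuous_trigSeries hs, ?_⟩
    rw [eLpNorm_norm]
    refine (hLp a _ _ ε (by positivity) (by positivity) hε0 (hεη.trans hη1) ha hs).trans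
      (ENNReal.ofReal_le_ofReal (le_of_eq ?_))
    rw [mul_assoc M, e1]; ring
  obtain ⟨c1, k1⟩ := key a₁ h₁
  obtain ⟨c2, k2⟩ := key a₂ h₂
  have hp1 : 1 ≤ ENNReal.ofReal p := by
    rw [← ENNReal.ofReal_one]; exact ENNReal.ofReal_le_ofReal (by linarith)
  have hp0 : ENNReal.ofReal p ≠ 0 := (zero_lt_one.trans_le hp1).ne'
  refine ⟨(fun t => ‖trigSeries a₁ t‖) + (fun t => ‖trigSeries a₂ t‖) + fun _ => M * (R * ε),
    (c1.norm.add c2.norm).add continuous_const, fun t => hD t, ?_⟩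
  refine (eLpNorm_add_le (c1.norm.add c2.norm).aestronglyMeasurable
    aestronglyMeasurable_const hp1).trans ?_
  refine (add_le_add (eLpNorm_add_le c1.norm.aestronglyMeasurable
    c2.norm.aestronglyMeasurable hp1) le_rfl).trans ?_
  have k3 : eLpNorm (fun _ : ℝ × ℝ => M * (R * ε)) (ENNReal.ofReal p)
      (volume.restrict torusSquare) ≤ ENNReal.ofReal (M * X) := by
    rw [eLpNorm_const _ hp0 (IsProbabilityMeasure.ne_zero _), measure_univ, ENNReal.one_rpow,
      mul_one, Real.enorm_eq_ofReal (by positivity)]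
    exact ENNReal.ofReal_le_ofReal (by gcongr)
  refine (add_le_add (add_le_add k1 k2) k3).trans_eq ?_
  rw [← ENNReal.ofReal_add (by positivity) (by positivity),
    ← ENNReal.ofReal_add (by positivity) (by positivity)]
  congr 1
  ring

lemma discrepancyNorm_le_of_forall_abs_le {R c : ℝ} (h : ∀ t, |discrepancy C R t| ≤ c) (p : ℝ≥0∞) :
    discrepancyNorm C R p ≤ ENNReal.ofReal c := by
  have hb : ∀ t, ‖discrepancy C R t‖ₑ ≤ ENNReal.ofReal c := fun t => by
    rw [← ofReal_norm, Real.norm_eq_abs]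
    exact ENNReal.ofReal_le_ofReal (h t)
  rw [discrepancyNorm]
  split_ifs with hp
  · exact iSup₂_le fun t _ => hb t
  · refine (eLpNorm_le_of_ae_bound (Filter.Eventually.of_forall h)).trans_eq ?_
    simp

end IsCGamma

/-- In `ℝ≥0∞` the threshold `4 / ENNReal.ofReal (3 - γ)` is `∞` when `γ = 3`, and
`p⁻¹.toReal` is `1 / p` for finite `p` and `0` for `p = ∞`. -/
theorem mainTheorem5 (γ : ℝ) (hγ2 : 2 < γ) (hγ3 : γ ≤ 3) (C : Set (ℝ × ℝ))
    (hC : IsCGamma γ C) :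
    ∃ c : ℝ, 0 < c ∧ ∀ R : ℝ, 1 ≤ R → ∀ p : ℝ≥0∞, 1 ≤ p →
      (p ≤ 4 / ENNReal.ofReal (3 - γ) →
        discrepancyNorm C R p ≤ ENNReal.ofReal (c * R ^ (1 - 1 / γ))) ∧
      (4 / ENNReal.ofReal (3 - γ) < p →
        discrepancyNorm C R p ≤
          ENNReal.ofReal (c * R ^ ((2 / 3 : ℝ) * (1 - 2 / γ * p⁻¹.toReal)))) := by
  have hγ0 : 0 < γ := by linarith
  obtain ⟨c₁, hc₁, hsup⟩ := hC.exists_abs_discrepancy_le_rpow hγ2 hγ3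
  -- for `γ = 3` both exponents of `R` are `2 / 3`, and the supremum bound suffices
  rcases hγ3.eq_or_lt with rfl | hγ3'
  · refine ⟨c₁, hc₁, fun R hR p _ => ⟨fun _ => ?_, fun hp => ?_⟩⟩
    · refine (IsCGamma.discrepancyNorm_le_of_forall_abs_le (hsup R hR) p).trans_eq ?_
      norm_num
    -- here the threshold is infinite
    · rw [sub_self, ENNReal.ofReal_zero, ENNReal.div_zero (by norm_num)] at hp
      exact absurd hp not_top_lt
  obtain ⟨c₂, hc₂, hmaj⟩ := hC.exists_majorant_eLpNorm_le hγ2 hγ3'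
  have h3γ : 0 < 3 - γ := by linarith
  set q := 4 / (3 - γ) with hq
  have hq0 : 0 < q := by positivity
  have hthr : 4 / ENNReal.ofReal (3 - γ) = ENNReal.ofReal q := by
    rw [hq, ENNReal.ofReal_div_of_pos h3γ]; norm_num
  rw [hthr]
  set c := max c₁ c₂ with hc
  have hcpos : 0 < c := lt_max_of_lt_left hc₁
  refine ⟨c, hcpos, fun R hR p _ => ?_⟩
  have hR0 : 0 < R := by linarith
  obtain ⟨G, hG, hDG, hGle⟩ := hmaj R hR
  have hDle : ∀ s : ℝ≥0∞, s ≤ ENNReal.ofReal q →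
      eLpNorm (discrepancy C R) s (volume.restrict torusSquare) ≤
        ENNReal.ofReal (c * R ^ (1 - 1 / γ)) := by
    intro s hs
    calc eLpNorm (discrepancy C R) s (volume.restrict torusSquare)
        ≤ eLpNorm G s (volume.restrict torusSquare) := eLpNorm_mono_real hDG
      _ ≤ eLpNorm G (ENNReal.ofReal q) (volume.restrict torusSquare) :=
        eLpNorm_le_eLpNorm_of_exponent_le hs hG.aestronglyMeasurable
      _ ≤ _ := hGle
      _ ≤ _ := ENNReal.ofReal_le_ofReal (by gcongr; exact le_max_right _ _)
  have hsup' : ∀ t, |discrepancy C R t| ≤ c * R ^ (2 / 3 : ℝ) := fun t =>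
    (hsup R hR t).trans (by gcongr; exact le_max_left _ _)
  refine ⟨fun hp => ?_, fun hp => ?_⟩
  · rw [discrepancyNorm, if_neg (ne_top_of_le_ne_top ENNReal.ofReal_ne_top hp)]
    exact hDle p hp
  rcases eq_or_ne p ⊤ with rfl | hpt
  · simpa using IsCGamma.discrepancyNorm_le_of_forall_abs_le hsup' ⊤
  rw [discrepancyNorm, if_neg hpt]
  obtain ⟨P, hP0, rfl⟩ : ∃ P : ℝ, 0 ≤ P ∧ p = ENNReal.ofReal P :=
    ⟨p.toReal, ENNReal.toReal_nonneg, (ENNReal.ofReal_toReal hpt).symm⟩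
  have hqP : q < P := (ENNReal.ofReal_lt_ofReal_iff_of_nonneg hq0.le).1 hp
  have hPpos : 0 < P := hq0.trans hqP
  have hu0 : 0 ≤ q / P := by positivity
  have hu1 : 0 ≤ 1 - q / P := by
    rw [sub_nonneg, div_le_one hPpos]; exact hqP.le
  have hb : ∀ t, ‖discrepancy C R t‖ₑ ≤ ENNReal.ofReal (c * R ^ (2 / 3 : ℝ)) := fun t => by
    rw [← ofReal_norm, Real.norm_eq_abs]
    exact ENNReal.ofReal_le_ofReal (hsup' t)
  calc eLpNorm (discrepancy C R) (ENNReal.ofReal P) (volume.restrict torusSquare)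
      ≤ ENNReal.ofReal (c * R ^ (2 / 3 : ℝ)) ^ (1 - q / P) *
          eLpNorm (discrepancy C R) (ENNReal.ofReal q) (volume.restrict torusSquare) ^ (q / P) :=
        eLpNorm_le_interpolation ENNReal.ofReal_ne_top hb hq0 hqP.le
    _ ≤ ENNReal.ofReal (c * R ^ (2 / 3 : ℝ)) ^ (1 - q / P) *
          ENNReal.ofReal (c * R ^ (1 - 1 / γ)) ^ (q / P) := by
        gcongr
        exact hDle _ le_rfl
    _ = ENNReal.ofReal ((c * R ^ (2 / 3 : ℝ)) ^ (1 - q / P) *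
          (c * R ^ (1 - 1 / γ)) ^ (q / P)) := by
        rw [ENNReal.ofReal_rpow_of_nonneg (by positivity) hu1,
          ENNReal.ofReal_rpow_of_nonneg (by positivity) hu0, ← ENNReal.ofReal_mul (by positivity)]
    _ = _ := by
        congr 1
        rw [Real.mul_rpow hcpos.le (by positivity), Real.mul_rpow hcpos.le (by positivity),
          mul_mul_mul_comm, ← Real.rpow_add hcpos, sub_add_cancel, Real.rpow_one,
          ← Real.rpow_mul hR0.le, ← Real.rpow_mul hR0.le, ← Real.rpow_add hR0]
        congr 2
        rw [ENNReal.toReal_inv, ENNReal.toReal_ofReal hP0, hq]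
        field_simp
        ring
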